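/- Let $p$ be an odd prime, $m\ge 0$ an integer, and let $\mathcal G$ be a (topologically) finitely generated pro-$p$ group on which a finite group $\Delta$ of order prime to $p$ acts by continuous automorphisms; put $\Gamma=\mathcal G\rtimes\Delta$. Let $\mathcal T$ be the torsion subgroup of $\mathcal G^{ab}=\mathcal G/\overline{[\mathcal G,\mathcal G]}$ and $\mathcal T[p]=\{x\in\mathcal G^{ab}: x^p=1\}$, a finite $\mathbb F_p[\Delta]$-module. Let $\rho_0:\Delta\to GL_m(\mathbb Z_p)$ be a homomorphism and $\Delta'=\rho_0(\Delta)$. Let $G$ be a subgroup of $\ker(GL_m(\mathbb Z_p)\to GL_m(\mathbb F_p))$ which is a uniform pro-$p$ group: $G$ is a finitely generated pro-$p$ group and, with $G_1=G$ and $G_{n+1}=\overline{G_n^p[G,G_n]}$, the map $x\mapsto x^p$ induces an isomorphism $G_n/G_{n+1}\to G_{n+1}/G_{n+2}$ for every $n\ge1$. Suppose that $\Delta'$ normalizes $G$. Let $\mathfrak g=\log(G)$, a $\mathbb Z_p$-Lie algebra of $m\times m$ matrices over $\mathbb Q_p$, and $\mathfrak g_p=\mathfrak g/p\mathfrak g$;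 $\Delta$ acts on both by conjugation through $\rho_0$. Let $k\ge 0$, and let $g_1,\dots,g_s\in G$ be elements whose logarithms $z_i=\log(g_i)$ (so $g_i=\exp(z_i)$) lie in $p^k\mathfrak g$ and are linearly independent over $\mathbb F_p$ in $p^k\mathfrak g/p^{k+1}\mathfrak g$. Let $G'$ be the closed subgroup generated by $g_1,\dots,g_s$, suppose that $\Delta'$ normalizes $G'$, and put $(G')^{p,el}=G'/(G')^p[G',G']$. Let $$f:\Gamma=\mathcal G\rtimes\Delta\twoheadrightarrow (G')^{p,el}\rtimes\Delta'$$ be a continuous surjective homomorphism with $f|_\Delta=\rho_0$. Suppose that (i) $H^2(\mathcal G,\mathbb Q_p/\mathbb Z_p)=0$ (continuous cohomology, trivial action), and (ii) $\mathcal T[p]\perp\mathfrak g_p$, i.e. no irreducible $\mathbb C_p$-character of $\Delta$ occurs in both $\mathcal T[p]$ and $\mathfrak g_p$; since $p\nmid|\Delta|$, this means that no irreducible representation of $\Delta$ over $\overline{\mathbb F}_p$ occurs in both $\overline{\mathbb F}_p\otimes\mathcal T[p]$ and $\overline{\mathbb F}_p\otimes\mathfrak g_p$. Then there is a continuous surjective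 homomorphism $\psi:\Gamma\twoheadrightarrow G'\rtimes\Delta'$ whose composite with the natural map $G'\rtimes\Delta'\to(G')^{p,el}\rtimes\Delta'$ is $f$, and which satisfies $\psi|_\Delta=\rho_0$. -/

import Mathlib

open scoped Pointwise TensorProduct

universe u

/-! ## Pro-`p` groups, the descending `p`-central series, uniform groups -/

section ProP

/-- A pro-`p` group: a compact, totally disconnected topological group all of whose open normal
subgroups have index a power of `p`. -/
structure IsProP (p : ℕ) (G : Type*) [Group G] [TopologicalSpace G] [IsTopologicalGroup G] :
    Prop where
  compact : CompactSpace G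
  totallyDisconnected : TotallyDisconnectedSpace G
  index_eq : ∀ U : Subgroup G, U.Normal → IsOpen (U : Set G) → ∃ n : ℕ, U.index = p ^ n

/-- The closed subgroup generated by a subset. -/
def closedSubgroupGen {G : Type*} [Group G] [TopologicalSpace G] [IsTopologicalGroup G]
    (S : Set G) : Subgroup G :=
  (Subgroup.closure S).topologicalClosure

/-- Topologically finitely generated. -/
def IsTopFG (G : Type*) [Group G] [TopologicalSpace G] [IsTopologicalGroup G] : Prop :=
  ∃ S : Set G, S.Finite ∧ closedSubgroupGen S = ⊤

variable (p : ℕ) (G : Type*) [Group G] [TopologicalSpace G] [IsTopologicalGroup G]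

/-- The closed subgroup `H ^ p [G, H]` generated by the `p`-th powers of elements of `H` and the
commutators of elements of `G` with elements of `H`. -/
def powComm (H : Subgroup G) : Subgroup G :=
  (Subgroup.closure ((fun x => x ^ p) '' (H : Set G)) ⊔ ⁅(⊤ : Subgroup G), H⁆).topologicalClosure

/-- The descending `p`-central series, with `lowerP p G n` the usual `G_{n+1}`:
`G_1 = G` and `G_{n+1} = G_n ^ p [G, G_n]`. -/
def lowerP : ℕ → Subgroup G
  | 0 => ⊤
  | n + 1 => powComm p G (lowerP n)

/-- `G ^ p [G, G]`; the quotient by it is the largest abelian quotient of exponent `p`. -/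
abbrev frattiniP : Subgroup G := powComm p G ⊤

variable {G}

theorem pow_mem_powComm {H : Subgroup G} {x : G} (hx : x ∈ H) : x ^ p ∈ powComm p G H :=
  Subgroup.le_topologicalClosure _
    (Subgroup.mem_sup_left (Subgroup.subset_closure (Set.mem_image_of_mem _ hx)))

/-- `powComm` is preserved by continuous automorphisms preserving `H`. -/
theorem map_mem_powComm {H : Subgroup G} (φ : G →* G) (hφ : Continuous φ)
    (hH : ∀ x ∈ H, φ x ∈ H) {x : G} (hx : x ∈ powComm p G H) : φ x ∈ powComm p G H := by
  have key : (Subgroup.closure ((fun x => x ^ p) '' (H : Set G)) ⊔ ⁅(⊤ : Subgroup G), H⁆).map φ ≤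
      Subgroup.closure ((fun x => x ^ p) '' (H : Set G)) ⊔ ⁅(⊤ : Subgroup G), H⁆ := by
    rw [Subgroup.map_sup, Subgroup.map_commutator]
    refine sup_le_sup ?_ (Subgroup.commutator_mono le_top ?_)
    · rw [MonoidHom.map_closure]
      refine Subgroup.closure_mono ?_
      rintro _ ⟨_, ⟨y, hy, rfl⟩, rfl⟩
      exact ⟨φ y, hH y hy, (map_pow φ y p).symm⟩
    · rintro _ ⟨y, hy, rfl⟩
      exact hH y hy
  exact map_mem_closure hφ hx fun y hy => key (Subgroup.mem_map_of_mem φ hy)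

instance powComm_normal (H : Subgroup G) [hH : H.Normal] : (powComm p G H).Normal where
  conj_mem x hx g := by
    have h := map_mem_powComm p (H := H) (MulAut.conj g).toMonoidHom
      (IsTopologicalGroup.continuous_conj g)
      (fun y hy => by simpa using hH.conj_mem y hy g) hx
    simpa using h

instance lowerP_normal (n : ℕ) : (lowerP p G n).Normal := by
  induction n with
  | zero => exact inferInstanceAs (⊤ : Subgroup G).Normal
  | succ n ih => exact inferInstanceAs (powComm p G (lowerP p G n)).Normal

variable (G)

/-- A uniform pro-`p` group: a finitely generated pro-`p` group such that, for every `n`, the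
`p`-th power map induces an isomorphism `G_n / G_{n+1} ≃ G_{n+1} / G_{n+2}`. -/
structure IsUniform : Prop where
  isProP : IsProP p G
  isTopFG : IsTopFG G
  pow_iso : ∀ n : ℕ, ∃ α :
    (lowerP p G n ⧸ (lowerP p G (n + 1)).subgroupOf (lowerP p G n)) ≃*
      (lowerP p G (n + 1) ⧸ (lowerP p G (n + 2)).subgroupOf (lowerP p G (n + 1))),
    ∀ x : lowerP p G n,
      α (QuotientGroup.mk x) =
        QuotientGroup.mk (⟨(x : G) ^ p, pow_mem_powComm p x.2⟩ : lowerP p G (n + 1))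

end ProP

/-! ## Group actions and semidirect products -/

section Actions

/-- The product topology on a semidirect product. -/
instance semidirectTopology {N D : Type*} [Group N] [Group D] [TopologicalSpace N]
    [TopologicalSpace D] (φ : D →* MulAut N) : TopologicalSpace (N ⋊[φ] D) :=
  TopologicalSpace.induced SemidirectProduct.equivProd inferInstance

/-- The action induced on the quotient by a stable normal subgroup. -/
def quotAct {N D : Type*} [Group N] [Group D] (φ : D →* MulAut N) (K : Subgroup N) [K.Normal]
    (h : ∀ d, ∀ x ∈ K, φ d x ∈ K) : D →* MulAut (N ⧸ K) where
  toFun d :=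
    { QuotientGroup.map K K (φ d).toMonoidHom (h d) with
      invFun := QuotientGroup.map K K (φ d⁻¹).toMonoidHom (h d⁻¹)
      left_inv := fun x => by
        induction x using QuotientGroup.induction_on
        simp
      right_inv := fun x => by
        induction x using QuotientGroup.induction_on
        simp }
  map_one' := by
    ext x
    induction x using QuotientGroup.induction_on
    simp
  map_mul' a b := by
    ext x
    induction x using QuotientGroup.induction_on
    simp

/-- If `D` normalizes `H`, then `D` acts on `H` by conjugation. -/
def conjAct {L : Type*} [Group L] (H D : Subgroup L)
    (h : D ≤ Subgroup.normalizer (H : Set L)) : D →* MulAut H :=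
  H.normalizerMonoidHom.comp (Subgroup.inclusion h)

section

variable (p : ℕ) {L : Type*} [Group L] [TopologicalSpace L] [IsTopologicalGroup L]
  (H D : Subgroup L) (h : D ≤ Subgroup.normalizer (H : Set L))

theorem conjAct_continuous (d : D) : Continuous (conjAct H D h d) :=
  Continuous.subtype_mk
    ((IsTopologicalGroup.continuous_conj (d : L)).comp continuous_subtype_val) _

theorem conjAct_mem_frattiniP (d : D) (x : H) (hx : x ∈ frattiniP p H) :
    conjAct H D h d x ∈ frattiniP p H :=
  map_mem_powComm p (conjAct H D h d).toMonoidHom (conjAct_continuous H D h d)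
    (fun _ _ => Subgroup.mem_top _) hx

/-- The conjugation action of `D` on `H / H ^ p [H, H]`. -/
def conjActFrattini : D →* MulAut (H ⧸ frattiniP p H) :=
  quotAct (conjAct H D h) (frattiniP p H) (conjAct_mem_frattiniP p H D h)

/-- The natural map `H ⋊ D → (H / H ^ p [H, H]) ⋊ D`. -/
def toFrattiniSemidirect :
    H ⋊[conjAct H D h] D →* (H ⧸ frattiniP p H) ⋊[conjActFrattini p H D h] D :=
  SemidirectProduct.map (QuotientGroup.mk' _) (MonoidHom.id D) fun _ => rfl

end

end Actions

/-! ## Orthogonality of `𝔽_p[Δ]`-modules -/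

section Orthogonality

variable {p : ℕ} [Fact p.Prime] {Δ : Type*} [Group Δ]

/-- Extension of scalars of a representation from `𝔽_p` to an algebraic closure. -/
noncomputable def geomRep {M : Type*} [AddCommGroup M] [Module (ZMod p) M]
    (ρ : Representation (ZMod p) Δ M) :
    Representation (AlgebraicClosure (ZMod p)) Δ (AlgebraicClosure (ZMod p) ⊗[ZMod p] M) where
  toFun δ := (ρ δ).baseChange (AlgebraicClosure (ZMod p))
  map_one' := by rw [map_one]; exact LinearMap.baseChange_id
  map_mul' a b := by rw [map_mul]; exact LinearMap.baseChange_comp _ _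

/-- The multiplicity `r_φ M` of an absolutely irreducible representation `φ` in an
`𝔽_p[Δ]`-module `M`: the dimension of the space of `Δ`-maps from `φ` to `𝔽̄_p ⊗ M`. -/
noncomputable def irrMult {M V : Type*} [AddCommGroup M] [Module (ZMod p) M]
    [AddCommGroup V] [Module (AlgebraicClosure (ZMod p)) V]
    (φ : Representation (AlgebraicClosure (ZMod p)) Δ V) (ρ : Representation (ZMod p) Δ M) : ℕ :=
  Module.finrank (AlgebraicClosure (ZMod p)) (Representation.IntertwiningMap φ (geomRep ρ))

/-- Two finite `𝔽_p[Δ]`-modules (with `Δ` finite of order prime to `p`) are orthogonal if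
`r_φ M * r_φ N = 0` for every absolutely irreducible `φ`. As `p` does not divide `|Δ|`, reduction
identifies the irreducible characters of `Δ` over `ℂ_p` with the irreducible representations over
`𝔽̄_p`, compatibly with multiplicities, and the latter are used here. -/
def ModOrthogonal {M N : Type*} [AddCommGroup M] [Module (ZMod p) M] [AddCommGroup N]
    [Module (ZMod p) N] (ρ : Representation (ZMod p) Δ M) (σ : Representation (ZMod p) Δ N) :
    Prop :=
  ∀ (n : ℕ) (φ : Representation (AlgebraicClosure (ZMod p)) Δ
    (Fin n → AlgebraicClosure (ZMod p))), φ.IsIrreducible → irrMult φ ρ * irrMult φ σ = 0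

end Orthogonality

section AddActions

variable (p : ℕ) {Δ A : Type*} [Group Δ] [AddCommGroup A]

/-- The `𝔽_p[Δ]`-module `A / p A`, for an abelian group `A` on which `Δ` acts. -/
def modRep (σ : Δ →* AddMonoid.End A) : Representation (ZMod p) Δ (ModN A p) where
  toFun δ := AddMonoidHom.toZModLinearMap p
    ((Submodule.mapQ (LinearMap.range (LinearMap.lsmul ℤ A p))
      (LinearMap.range (LinearMap.lsmul ℤ A p)) (AddMonoidHom.toIntLinearMap (σ δ)) (by
        rintro _ ⟨a, rfl⟩
        exact ⟨σ δ a, by simp; rfl⟩)).toAddMonoidHom)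
  map_one' := by
    refine LinearMap.ext fun x => ?_
    obtain ⟨x, rfl⟩ := Submodule.Quotient.mk_surjective _ x
    simp; rfl
  map_mul' a b := by
    refine LinearMap.ext fun x => ?_
    obtain ⟨x, rfl⟩ := Submodule.Quotient.mk_surjective _ x
    simp; rfl

instance torsionByModule : Module (ZMod p) (AddSubgroup.torsionBy A (p : ℤ)) :=
  AddSubgroup.torsionBy.zmodModule

/-- The `𝔽_p[Δ]`-module `A[p]`, for an abelian group `A` on which `Δ` acts. -/
def torsionRep (σ : Δ →* AddMonoid.End A) :
    Representation (ZMod p) Δ (AddSubgroup.torsionBy A (p : ℤ)) where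
  toFun δ := AddMonoidHom.toZModLinearMap p
    { toFun := fun x => ⟨σ δ x, by
        rw [AddSubgroup.torsionBy.nsmul_iff, ← map_nsmul,
          AddSubgroup.torsionBy.nsmul_iff.1 x.2, map_zero]⟩
      map_zero' := by ext; simp
      map_add' := fun x y => by ext; simp }
  map_one' := by ext x; simp
  map_mul' a b := by ext x; simp

end AddActions

/-! ## The abelianization of a pro-`p` group with an action -/

section Abelianization

variable {Δ N : Type*} [Group Δ] [Group N] [TopologicalSpace N] [IsTopologicalGroup N]
  (act : Δ →* MulAut N) (hact : ∀ δ, Continuous (act δ))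

/-- The action of `Δ` on the (topological) abelianization of `N`, written additively. -/
def abAct : Δ →* AddMonoid.End (Additive (TopologicalAbelianization N)) where
  toFun δ := MonoidHom.toAdditive (MulEquiv.toMonoidHom
    (quotAct act (commutator N).topologicalClosure (fun δ x hx => by
      refine map_mem_closure (hact δ) hx fun y hy => ?_
      have h : (commutator N).map (act δ).toMonoidHom ≤ commutator N := by
        rw [commutator_def, Subgroup.map_commutator]
        exact Subgroup.commutator_mono le_top le_top
      exact h (Subgroup.mem_map_of_mem _ hy)) δ))
  map_one' := by rw [map_one]; rfl
  map_mul' a b := by rw [map_mul]; rfl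

end Abelianization

/-! ## The coefficients `ℚ_p / ℤ_p` -/

section Coefficients

variable (p : ℕ) [Fact p.Prime]

/-- The topological group `ℚ_p / ℤ_p`; it is discrete since `ℤ_p` is open in `ℚ_p`. -/
abbrev QpModZp : Type :=
  ℚ_[p] ⧸ (PadicInt.subring p).toAddSubgroup

instance : DiscreteTopology (QpModZp p) := by
  rw [QuotientAddGroup.discreteTopology_iff]
  have h : ((PadicInt.subring p).toAddSubgroup : Set ℚ_[p]) = Metric.closedBall 0 1 := by
    ext x
    simp [PadicInt.subring]
  rw [h]
  exact IsUltrametricDist.isOpen_closedBall _ one_ne_zero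

end Coefficients

/-! ## Logarithm and the Lie algebra of a subgroup of `GL_m(ℤ_p)` -/

section Lie

variable {p : ℕ} [Fact p.Prime] {m : ℕ}

/-- The kernel of the reduction `GL_m(ℤ_p) → GL_m(𝔽_p)`. -/
noncomputable def glOne (p : ℕ) [Fact p.Prime] (m : ℕ) : Subgroup (GL (Fin m) ℤ_[p]) :=
  (Matrix.GeneralLinearGroup.map (n := Fin m) (PadicInt.toZMod (p := p))).ker

/-- A matrix over `ℤ_p` seen as a matrix over `ℚ_p`. -/
noncomputable def toQp (A : GL (Fin m) ℤ_[p]) : Matrix (Fin m) (Fin m) ℚ_[p] :=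
  (A : Matrix (Fin m) (Fin m) ℤ_[p]).map (algebraMap ℤ_[p] ℚ_[p])

/-- The `p`-adic logarithm `∑_{n ≥ 1} (-1) ^ (n + 1) (A - 1) ^ n / n`. -/
noncomputable def matLog (A : GL (Fin m) ℤ_[p]) : Matrix (Fin m) (Fin m) ℚ_[p] :=
  ∑' n : ℕ, ((-1 : ℚ_[p]) ^ n / (n + 1)) • (toQp A - 1) ^ (n + 1)

/-- The `ℤ_p`-Lie algebra `𝔤 = log G` of a uniform group `G ⊆ ker (GL_m(ℤ_p) → GL_m(𝔽_p))`,
`p` odd. For such `G` the set `log G` is a `ℤ_p`-submodule, so that taking the span adds nothing. -/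
noncomputable def lieAlg (G : Subgroup (GL (Fin m) ℤ_[p])) :
    Submodule ℤ_[p] (Matrix (Fin m) (Fin m) ℚ_[p]) :=
  Submodule.span ℤ_[p] (matLog '' (G : Set (GL (Fin m) ℤ_[p])))

/-- Conjugation by an element of `GL_m(ℤ_p)` on matrices over `ℚ_p`. -/
noncomputable def matConj (d : GL (Fin m) ℤ_[p]) :
    Matrix (Fin m) (Fin m) ℚ_[p] →ₗ[ℤ_[p]] Matrix (Fin m) (Fin m) ℚ_[p] where
  toFun X := toQp d * X * toQp d⁻¹
  map_add' X Y := by rw [Matrix.mul_add, Matrix.add_mul]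
  map_smul' c X := by simp

theorem toQp_one : toQp (1 : GL (Fin m) ℤ_[p]) = 1 := by
  rw [toQp, Units.val_one, Matrix.map_one _ (map_zero _) (map_one _)]

theorem toQp_mul (a b : GL (Fin m) ℤ_[p]) : toQp (a * b) = toQp a * toQp b := by
  simp [toQp, Matrix.map_mul]

theorem toQp_inv_mul (a : GL (Fin m) ℤ_[p]) : toQp a⁻¹ * toQp a = 1 := by
  rw [← toQp_mul, inv_mul_cancel, toQp_one]

theorem toQp_mul_inv (a : GL (Fin m) ℤ_[p]) : toQp a * toQp a⁻¹ = 1 := by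
  rw [← toQp_mul, mul_inv_cancel, toQp_one]

theorem matConj_one : matConj (1 : GL (Fin m) ℤ_[p]) = LinearMap.id := by
  ext1 X
  simp [matConj, toQp_one]

theorem matConj_mul (a b : GL (Fin m) ℤ_[p]) : matConj (a * b) = matConj a ∘ₗ matConj b := by
  refine LinearMap.ext fun X => ?_
  simp [matConj, toQp_mul, mul_assoc]

theorem matLog_conj (d A : GL (Fin m) ℤ_[p]) : matLog (d * A * d⁻¹) = matConj d (matLog A) := by
  let e : Matrix (Fin m) (Fin m) ℚ_[p] ≃+ Matrix (Fin m) (Fin m) ℚ_[p] :=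
    { toFun := fun X => toQp d * X * toQp d⁻¹
      invFun := fun X => toQp d⁻¹ * X * toQp d
      left_inv := fun X => by
        simp [mul_assoc, toQp_inv_mul, ← mul_assoc (toQp d⁻¹) (toQp d)]
      right_inv := fun X => by
        simp [mul_assoc, toQp_mul_inv, ← mul_assoc (toQp d) (toQp d⁻¹)]
      map_add' := fun X Y => by rw [Matrix.mul_add, Matrix.add_mul] }
  have hc : Topology.IsClosedEmbedding e :=
    (Homeomorph.mk e.toEquiv
      (by change Continuous fun X => toQp d * X * toQp d⁻¹; fun_prop)
      (by change Continuous fun X => toQp d⁻¹ * X * toQp d; fun_prop)).isClosedEmbedding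
  have hpow : ∀ (X : Matrix (Fin m) (Fin m) ℚ_[p]) (n : ℕ), e X ^ n = e (X ^ n) := by
    intro X n
    induction n with
    | zero => simp [e, toQp_mul_inv]
    | succ n ih =>
      rw [pow_succ, ih, pow_succ]
      simp [e, mul_assoc, ← mul_assoc (toQp d⁻¹) (toQp d), toQp_inv_mul]
  have hsub : toQp (d * A * d⁻¹) - 1 = e (toQp A - 1) := by
    simp [e, toQp_mul, Matrix.mul_sub, Matrix.sub_mul, toQp_mul_inv]
  have h := hc.map_tsum (L := SummationFilter.unconditional ℕ)
    (fun n : ℕ => ((-1 : ℚ_[p]) ^ n / (n + 1)) • (toQp A - 1) ^ (n + 1)) (g := e)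
  change _ = e (matLog A)
  rw [matLog, matLog, h]
  refine tsum_congr fun n => ?_
  rw [hsub, hpow]
  simp [e]

variable {Δ : Type*} [Group Δ]

theorem matConj_mem_lieAlg {G : Subgroup (GL (Fin m) ℤ_[p])} {d : GL (Fin m) ℤ_[p]}
    (hd : d ∈ Subgroup.normalizer (G : Set (GL (Fin m) ℤ_[p])))
    {X : Matrix (Fin m) (Fin m) ℚ_[p]} (hX : X ∈ lieAlg G) : matConj d X ∈ lieAlg G := by
  have h : (lieAlg G).map (matConj d) ≤ lieAlg G := by
    rw [lieAlg, Submodule.map_span]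
    refine Submodule.span_mono ?_
    rintro _ ⟨_, ⟨A, hA, rfl⟩, rfl⟩
    exact ⟨d * A * d⁻¹, (Subgroup.mem_normalizer_iff.1 hd A).1 hA, matLog_conj d A⟩
  exact h (Submodule.mem_map_of_mem hX)

/-- The action of `Δ` on `𝔤 = log G` by conjugation through `ρ₀`. -/
noncomputable def lieAct (ρ₀ : Δ →* GL (Fin m) ℤ_[p]) (G : Subgroup (GL (Fin m) ℤ_[p]))
    (h : ρ₀.range ≤ Subgroup.normalizer (G : Set (GL (Fin m) ℤ_[p]))) :
    Δ →* AddMonoid.End (lieAlg G) where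
  toFun δ := ((matConj (ρ₀ δ)).restrict
    (fun _ hX => matConj_mem_lieAlg (h ⟨δ, rfl⟩) hX)).toAddMonoidHom
  map_one' := by
    ext1 X
    exact Subtype.ext (by change matConj (ρ₀ 1) X = X; simp [matConj_one])
  map_mul' a b := by
    ext1 X
    exact Subtype.ext (by change matConj (ρ₀ (a * b)) X = matConj (ρ₀ a) (matConj (ρ₀ b) X); simp [matConj_mul])

end Lie

/-! The map `f` restricts to a `Δ`-equivariant surjection `f₀` from `𝒢` to `G' / Φ(G')`, since a
pro-`p` group has no nontrivial image in `Δ'`. It has to be lifted to an equivariant homomorphism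
`𝒢 → G'`; a lift is automatically onto, because its image is closed and generates `G'` modulo
`Φ(G')` (`eq_top_of_sup_frattiniP`). Write `G_1 = G ≥ G_2 ≥ …` for the descending `p`-central
series.

For uniform `G` the logarithms form a lattice `𝔤`, every element of `G_{n+1}` is `y ^ (p ^ n)` for
a unique `y ∈ G`, and `y ^ (p ^ n) ↦ log y` induces an isomorphism `G_{n+1} / G_{n+2} ≃ 𝔤 / p 𝔤`
which is invariant under conjugation by `G` and equivariant for `Δ` (`levelClass` and the lemmas on
it). The logarithm enters only through `log x = lim (x ^ (p ^ n) - 1) / p ^ n`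
(`tendsto_logApprox`), which makes `log (x ^ p) = p log x`, injectivity and the approximate
additivity of `log` elementary. Independence of the `log g_i` then gives `G' ≤ G_{k+1}` and
`Φ(G') = G' ∩ G_{k+2}` (`mem_frattiniP_iff`), so that `f₀` is a homomorphism to
`G' / (G' ∩ G_{k+2})`, to be lifted successively to `G' / (G' ∩ G_n)` for all `n`.

Each step is an embedding problem for `𝒢` whose kernel is a submodule of `𝔤 / p 𝔤` with trivial
action of `𝒢` (`exists_lifting_step`). Let `R → 𝒢` be the fibre product with `G'`, with kernel
`N = G' ∩ G_{n+1}`, and let `κ : N → 𝔤 / p 𝔤` be the map above. As `H²(𝒢, ℚ_p / ℤ_p) = 0`,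
invariant characters of `N` extend to `R` (`exists_extension_of_invariant`), so that `κ` kills
`N ∩ [R, R]` and factors through the image of `N` in `R^ab`. The `p`-th powers of `R^ab` that lie
in this image define an equivariant connecting homomorphism `𝒯[p] → 𝔤 / p 𝔤`, which vanishes by
orthogonality (`eq_zero_of_pow_eq`, `ModOrthogonal.eq_zero`). Hence `κ` kills `N ∩ Φ(R)`, and a
`Δ`-stable complement of the image of `N` in an elementary abelian quotient of `R`, which exists
since `p ∤ |Δ|`, provides the lift.

The partial lifts are kept as closed stable subgroups of `𝒢 × G'` (`IsGraphModulo`). They form a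
descending sequence, and by compactness their intersection is the graph of the lift
(`exists_hom_of_isGraphModulo`). -/

/-! ### Continuous cocycles when `H²` vanishes -/

section H2
open CategoryTheory TopRep ContRepresentation Limits

/-- Topological modules do not form an abelian category, but the forgetful functor to modules
preserves homology, so that exactness can be read off there. -/
theorem TopModuleCat.exists_of_subsingleton_homology {R : Type*} [Ring R] [TopologicalSpace R]
    (S : ShortComplex (TopModuleCat R)) (h : Subsingleton S.homology) (x : S.X₂)
    (hx : S.g.hom x = 0) : ∃ y : S.X₁, S.f.hom y = x := by
  have hz : IsZero (S.map (forget₂ (TopModuleCat R) (ModuleCat R))).homology := by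
    have : Subsingleton ((forget₂ (TopModuleCat R) (ModuleCat R)).obj S.homology) := h
    exact (ModuleCat.isZero_of_subsingleton _).of_iso
      (S.mapHomologyIso (forget₂ (TopModuleCat R) (ModuleCat R)))
  have he := (ShortComplex.exact_iff_isZero_homology _).2 hz
  exact (ShortComplex.moduleCat_exact_iff _).1 he x hx

variable {𝒢 : Type u} [Group 𝒢] [TopologicalSpace 𝒢] [IsTopologicalGroup 𝒢]
  {A : Type u} [AddCommGroup A] [TopologicalSpace A] [IsTopologicalAddGroup A]

/-- The vanishing of `H²` in terms of homogeneous cochains. -/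
theorem exists_homogeneous_coboundary
    (h : Subsingleton (continuousCohomology 2 (TopRep.of (ContRepresentation.trivial ℤ 𝒢 A))))
    (σ : C(𝒢, C(𝒢, C(𝒢, A))))
    (hinv : ∀ g a b c, σ (g * a) (g * b) (g * c) = σ a b c)
    (hd : ∀ a b c d, σ b c d - (σ a c d - (σ a b d - σ a b c)) = 0) :
    ∃ τ : C(𝒢, C(𝒢, A)), (∀ g a b, τ (g * a) (g * b) = τ a b) ∧
      ∀ a b c, σ a b c = τ b c - (τ a c - τ a b) := by
  let X := TopRep.of (ContRepresentation.trivial ℤ 𝒢 A)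
  let S := (homogeneousCochains X).sc' 1 2 3
  have hS : Subsingleton S.homology := by
    have e := ((homogeneousCochains X).homologyIsoSc' 1 2 3 (by simp) (by simp))
    have e2 := (forget₂ _ (ModuleCat ℤ)).mapIso e
    exact e2.toLinearEquiv.symm.toEquiv.injective.subsingleton
  let x : S.X₂ := ⟨σ, by
    intro g
    ext a b c
    have := hinv g⁻¹ a b c
    exact this⟩
  have hx : S.g.hom x = 0 := by
    refine (homogeneousCochains.d_apply X 2 x |> fun h => Subtype.ext (h.trans ?_))
    refine ContinuousMap.ext fun a => ContinuousMap.ext fun b => ContinuousMap.ext fun c =>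
      ContinuousMap.ext fun d => hd a b c d
  obtain ⟨y, hy⟩ := TopModuleCat.exists_of_subsingleton_homology S hS x hx
  refine ⟨y.1, fun g a b => ?_, fun a b c => ?_⟩
  · have h1 := DFunLike.congr_fun (DFunLike.congr_fun (y.2 g⁻¹) a) b
    simp only [coind₁_apply_apply, inv_inv] at h1
    exact h1
  · have h1 := (homogeneousCochains.d_apply X 1 y).symm.trans (congrArg Subtype.val hy)
    exact (DFunLike.congr_fun (DFunLike.congr_fun (DFunLike.congr_fun h1 a) b) c).symm

/-- If `H²(𝒢, A) = 0` (continuous cohomology, trivial action), then every continuous inhomogeneous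
2-cocycle with values in `A` is the coboundary of a continuous 1-cochain. -/
theorem exists_continuous_of_cocycle
    (h : Subsingleton (continuousCohomology 2 (TopRep.of (ContRepresentation.trivial ℤ 𝒢 A))))
    (c : 𝒢 → 𝒢 → A) (hc : Continuous fun x : 𝒢 × 𝒢 => c x.1 x.2)
    (hcoc : ∀ x y z, c y z - c (x * y) z + c x (y * z) - c x y = 0) :
    ∃ b : 𝒢 → A, Continuous b ∧ ∀ x y, c x y = b x + b y - b (x * y) := by
  -- the homogeneous cochain attached to `c`; its primitive `τ` gives `b x = τ (1, x)`
  let σ' : C((𝒢 × 𝒢) × 𝒢, A) :=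
    ⟨fun x => c (x.1.1⁻¹ * x.1.2) (x.1.2⁻¹ * x.2), hc.comp (f := fun x : (𝒢 × 𝒢) × 𝒢 =>
      ((x.1.1⁻¹ * x.1.2, x.1.2⁻¹ * x.2) : 𝒢 × 𝒢)) (by fun_prop)⟩
  obtain ⟨τ, hτ, hd⟩ := exists_homogeneous_coboundary h σ'.curry.curry
    (fun g x y z => by simp [σ', mul_assoc])
    (fun x y z w => by
      have := hcoc (x⁻¹ * y) (y⁻¹ * z) (z⁻¹ * w)
      simp only [mul_assoc, mul_inv_cancel_left] at this
      simpa [σ', sub_add_eq_add_sub, sub_sub_eq_add_sub, add_comm, add_left_comm, sub_eq_add_neg]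
        using this)
  refine ⟨fun x => τ 1 x, (τ 1).continuous, fun x y => ?_⟩
  have h1 := hd 1 x (x * y)
  have h2 := hτ x 1 y
  rw [mul_one] at h2
  rw [h2] at h1
  have h3 : σ'.curry.curry 1 x (x * y) = c x y := by simp [σ']
  rw [← h3, h1]
  abel

end H2

/-! ### Orthogonal modules have no equivariant maps between them -/

section Orth
open scoped MonoidAlgebra

theorem Representation.finite_intertwiningMap {K D V W : Type*} [Field K] [Group D]
    [AddCommGroup V] [Module K V] [AddCommGroup W] [Module K W] [Module.Finite K V]
    [Module.Finite K W]
    (P : Representation K D V) (Q : Representation K D W) :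
    Module.Finite K (Representation.IntertwiningMap P Q) :=
  Module.Finite.of_injective (Representation.IntertwiningMap.toLinearMapl P Q)
    (Representation.IntertwiningMap.toLinearMap_injective P Q)

/-- Maschke: a nonzero map `F : P → Q` of finite-dimensional representations is injective on some
irreducible subrepresentation of `P`, which is written in coordinates here. -/
theorem Representation.exists_irreducible_of_ne_zero {K D V W : Type*} [Field K] [Group D]
    [Finite D] [NeZero (Nat.card D : K)] [AddCommGroup V] [Module K V]
    [AddCommGroup W] [Module K W] [Module.Finite K V]
    {P : Representation K D V} {Q : Representation K D W}
    (F : Representation.IntertwiningMap P Q) (hF : F ≠ 0) :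
    ∃ (n : ℕ) (φ : Representation K D (Fin n → K)), φ.IsIrreducible ∧
      (∃ j : Representation.IntertwiningMap φ P, j ≠ 0) ∧
      ∃ j : Representation.IntertwiningMap φ Q, j ≠ 0 := by
  -- a simple submodule `T` of a complement of the kernel is mapped injectively
  let Fm := Representation.IntertwiningMap.equivLinearMapAsModule P Q F
  have hFm : Fm ≠ 0 := by
    simpa [Fm] using hF
  obtain ⟨C, hC⟩ := exists_isCompl (LinearMap.ker Fm)
  have hCbot : C ≠ ⊥ := by
    rintro rfl
    exact hFm (LinearMap.ker_eq_top.1 (by simpa using hC.sup_eq_top))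
  obtain ⟨T, hTC, hT⟩ := (IsSemisimpleModule.eq_bot_or_exists_simple_le C).resolve_left hCbot
  let T' : Subrepresentation P := Subrepresentation.ofSubmodule' T
  let e : T'.toSubmodule ≃ₗ[K] (Fin (Module.finrank K T'.toSubmodule) → K) :=
    (Module.finBasis K T'.toSubmodule).equivFun
  let φ : Representation K D (Fin (Module.finrank K T'.toSubmodule) → K) :=
    { toFun := fun d => e.toLinearMap ∘ₗ T'.toRepresentation d ∘ₗ e.symm.toLinearMap
      map_one' := by
        refine LinearMap.ext fun x => ?_
        simp
      map_mul' := fun a b => by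
        refine LinearMap.ext fun x => ?_
        simp }
  let j : Representation.IntertwiningMap φ P :=
    { toLinearMap := T'.toSubmodule.subtype ∘ₗ e.symm.toLinearMap
      isIntertwining' := fun d => LinearMap.ext fun x => by
        simp [φ]; rfl }
  have hjinj : Function.Injective j := Subtype.val_injective.comp e.symm.injective
  let jm := Representation.IntertwiningMap.equivLinearMapAsModule φ P j
  have hjm : Function.Injective jm := hjinj
  have hrange : LinearMap.range jm = T := by
    ext x
    constructor
    · rintro ⟨y, rfl⟩
      exact (e.symm y).2
    · intro hx
      exact ⟨e ⟨x, hx⟩, congrArg Subtype.val (e.symm_apply_apply ⟨x, hx⟩)⟩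
  have hsimple : IsSimpleModule K[D] φ.asModule :=
    IsSimpleModule.congr ((LinearEquiv.ofInjective jm hjm).trans (LinearEquiv.ofEq _ _ hrange))
  have hnt : Nontrivial φ.asModule := IsSimpleModule.nontrivial K[D] _
  obtain ⟨v, hv⟩ := exists_ne (0 : φ.asModule)
  have hjv : j v ≠ 0 := fun h => hv (hjinj (h.trans (map_zero j).symm))
  refine ⟨_, φ, (Representation.irreducible_iff_isSimpleModule_asModule φ).2 hsimple,
    ⟨j, fun h => hjv (by rw [h]; rfl)⟩, F.comp j, fun h => ?_⟩
  have h1 : Fm (j v) = 0 := by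
    have : (F.comp j) v = 0 := by rw [h]; rfl
    exact this
  have h2 : (j v : P.asModule) ∈ C := hTC (e.symm v).2
  have h3 := hC.disjoint.le_bot ⟨h1, h2⟩
  exact hjv h3

/-- Over finite `𝔽_p[Δ]`-modules with `p ∤ |Δ|`, orthogonality kills all equivariant maps. -/
theorem ModOrthogonal.eq_zero {p : ℕ} [Fact p.Prime] {Δ : Type*} [Group Δ] [Finite Δ]
    (hΔ : (Nat.card Δ).Coprime p) {M N : Type*} [AddCommGroup M] [Module (ZMod p) M]
    [AddCommGroup N] [Module (ZMod p) N] [Module.Finite (ZMod p) M] [Module.Finite (ZMod p) N]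
    {ρ : Representation (ZMod p) Δ M} {σ : Representation (ZMod p) Δ N}
    (h : ModOrthogonal ρ σ) (f : M →ₗ[ZMod p] N) (hf : ∀ d x, f (ρ d x) = σ d (f x)) : f = 0 := by
  let K := AlgebraicClosure (ZMod p)
  have : NeZero (Nat.card Δ : K) := ⟨fun h0 => by
    have h1 : p ∣ Nat.card Δ := (CharP.cast_eq_zero_iff K p _).1 h0
    exact (Fact.out : p.Prime).one_lt.ne' (Nat.Coprime.eq_one_of_dvd hΔ.symm h1)⟩
  let F : Representation.IntertwiningMap (geomRep ρ) (geomRep σ) :=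
    { toLinearMap := f.baseChange K
      isIntertwining' := fun d => by
        change f.baseChange K ∘ₗ (ρ d).baseChange K = (σ d).baseChange K ∘ₗ f.baseChange K
        rw [← LinearMap.baseChange_comp, ← LinearMap.baseChange_comp]
        congr 1
        exact LinearMap.ext (hf d) }
  by_contra hne
  have hF : F ≠ 0 := by
    intro h0
    apply hne
    ext x
    have h1 : F (1 ⊗ₜ x) = 0 := by rw [h0]; rfl
    have h2 : (1 : K) ⊗ₜ[ZMod p] f x = 0 := h1
    have := Module.Flat.rTensor_preserves_injective_linearMap (M := N)
      (Algebra.linearMap (ZMod p) K) (FaithfulSMul.algebraMap_injective (ZMod p) K)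
    have h3 : (1 : ZMod p) ⊗ₜ[ZMod p] f x = 0 := this (by simpa using h2)
    simpa using congrArg (TensorProduct.lid (ZMod p) N) h3
  obtain ⟨n, φ, hφ, ⟨j, hj⟩, j', hj'⟩ := Representation.exists_irreducible_of_ne_zero F hF
  have h1 := Representation.finite_intertwiningMap φ (geomRep ρ)
  have h2 := Representation.finite_intertwiningMap φ (geomRep σ)
  have h3 := (Module.finrank_pos_iff_exists_ne_zero (R := K).2 ⟨j, hj⟩).ne'
  have h4 := (Module.finrank_pos_iff_exists_ne_zero (R := K).2 ⟨j', hj'⟩).ne'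
  rcases mul_eq_zero.1 (h n φ hφ) with h0 | h0 <;> unfold irrMult at h0
  · refine h3 ?_
    convert h0 using 1
  · refine h4 ?_
    convert h0 using 1

end Orth

/-! ### Finiteness of the Frattini quotient and of the `p`-torsion -/

section FiniteQuotients

open scoped commutatorElement

variable {p : ℕ} {H : Type*} [Group H] [TopologicalSpace H] [IsTopologicalGroup H]

theorem powComm_le {K L : Subgroup H} (hL : IsClosed (L : Set H)) (hpow : ∀ x ∈ K, x ^ p ∈ L)
    (hcomm : ∀ x : H, ∀ y ∈ K, ⁅x, y⁆ ∈ L) : powComm p H K ≤ L := by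
  refine Subgroup.topologicalClosure_minimal _ (sup_le ?_ ?_) hL
  · rw [Subgroup.closure_le]
    rintro _ ⟨x, hx, rfl⟩
    exact hpow x hx
  · rw [Subgroup.commutator_le]
    exact fun x _ y hy => hcomm x y hy

theorem commutator_mem_powComm {K : Subgroup H} (x : H) {y : H} (hy : y ∈ K) :
    ⁅x, y⁆ ∈ powComm p H K :=
  Subgroup.le_topologicalClosure _
    (Subgroup.mem_sup_right (Subgroup.commutator_mem_commutator (Subgroup.mem_top x) hy))

theorem isClosed_powComm (K : Subgroup H) : IsClosed (powComm p H K : Set H) :=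
  Subgroup.isClosed_topologicalClosure _

/-- The images of finitely many topological generators generate a finite subgroup of
`H / H ^ p [H, H]`, which is therefore closed, hence everything. -/
theorem IsTopFG.finiteIndex_frattiniP (hp : 0 < p) (h : IsTopFG H) :
    (frattiniP p H).FiniteIndex := by
  obtain ⟨S, hS, hgen⟩ := h
  let Q := H ⧸ frattiniP p H
  let _ : CommGroup Q := { (inferInstance : Group Q) with
    mul_comm := by
      rintro ⟨x⟩ ⟨y⟩
      change ((x * y : H) : Q) = ((y * x : H) : Q)
      rw [QuotientGroup.eq]
      have := commutator_mem_powComm (p := p) (K := ⊤) y⁻¹ (Subgroup.mem_top x⁻¹)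
      simpa [commutatorElement_def, mul_assoc] using this }
  have : T1Space Q := QuotientGroup.instT1Space (hN := isClosed_powComm ⊤)
  let A : Subgroup Q := Subgroup.closure ((QuotientGroup.mk' (frattiniP p H)) '' S)
  have hfg : Group.FG A := by
    rw [Group.fg_iff_subgroup_fg, Subgroup.fg_iff]
    exact ⟨_, rfl, hS.image _⟩
  have htors : IsMulTorsion A := by
    rintro ⟨x, hx⟩
    refine isOfFinOrder_iff_pow_eq_one.2 ⟨p, hp, ?_⟩
    obtain ⟨x, rfl⟩ := QuotientGroup.mk'_surjective _ x
    exact Subtype.ext ((QuotientGroup.eq_one_iff _).2 (pow_mem_powComm p (Subgroup.mem_top x)))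
  have hfin : Finite A := CommGroup.finite_of_fg_isMulTorsion A htors
  have hcl : IsClosed (A : Set Q) := (Set.toFinite (A : Set Q)).isClosed
  have htop : A = ⊤ := by
    have hpre : (⊤ : Subgroup H) ≤ A.comap (QuotientGroup.mk' _) := by
      refine hgen.symm.trans_le ?_
      refine Subgroup.topologicalClosure_minimal _ ?_ (hcl.preimage QuotientGroup.continuous_mk)
      rw [Subgroup.closure_le]
      exact fun x hx => Subgroup.subset_closure ⟨x, hx, rfl⟩
    rw [eq_top_iff]
    rintro x -
    obtain ⟨x, rfl⟩ := QuotientGroup.mk'_surjective _ x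
    exact hpre (Subgroup.mem_top x)
  have : Finite Q := by
    rw [htop] at hfin
    exact Finite.of_equiv _ Subgroup.topEquiv.toEquiv
  exact Subgroup.finiteIndex_of_finite_quotient

/-- A compact abelian group which is topologically finitely generated, and whose elements are
separated from `1` by open subgroups, has finitely many elements of exponent `p`: in each finite
quotient, there are as many of these as cosets of `p`-th powers. -/
theorem finite_setOf_pow_eq_one {C : Type*} [CommGroup C] [TopologicalSpace C]
    [IsTopologicalGroup C] [CompactSpace C] (hp : 0 < p) (hfg : IsTopFG C)
    (hsep : ∀ x : C, x ≠ 1 → ∃ V : Subgroup C, IsOpen (V : Set C) ∧ x ∉ V) :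
    {x : C | x ^ p = 1}.Finite := by
  classical
  have hfi := hfg.finiteIndex_frattiniP hp
  by_contra hinf
  -- more elements of exponent `p` than there are cosets, separated by an open subgroup `W`
  obtain ⟨F, hF, hcard⟩ := Set.Infinite.exists_subset_card_eq hinf ((frattiniP p C).index + 1)
  choose! V hVo hV using hsep
  let W : Subgroup C := ⨅ xy : F.offDiag, V (xy.1.1⁻¹ * xy.1.2)
  have hne : ∀ x ∈ F, ∀ y ∈ F, x ≠ y → x⁻¹ * y ≠ 1 := fun x _ y _ hxy h =>
    hxy (inv_mul_eq_one.1 h)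
  have hWo : IsOpen (W : Set C) := by
    have : (W : Set C) = ⋂ xy : F.offDiag, (V (xy.1.1⁻¹ * xy.1.2) : Set C) := by
      simp [W]
    rw [this]
    refine isOpen_iInter_of_finite fun xy => hVo _ ?_
    have := Finset.mem_offDiag.1 xy.2
    exact hne _ this.1 _ this.2.1 this.2.2
  have hfinQ : Finite (C ⧸ W) := Subgroup.quotient_finite_of_isOpen W hWo
  let f : C ⧸ W →* C ⧸ W := powMonoidHom p
  have hinj : Set.InjOn (QuotientGroup.mk : C → C ⧸ W) F := by
    intro x hx y hy hxy
    by_contra hne'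
    have h1 : x⁻¹ * y ∈ W := QuotientGroup.eq.1 hxy
    exact hV _ (hne x hx y hy hne')
      (Subgroup.mem_iInf.1 h1 ⟨(x, y), Finset.mem_offDiag.2 ⟨hx, hy, hne'⟩⟩)
  have hle : F.card ≤ Nat.card f.ker := by
    rw [← Set.ncard_coe_finset, ← hinj.ncard_image]
    refine Set.ncard_le_ncard (t := (f.ker : Set (C ⧸ W))) ?_ (Set.toFinite _)
    rintro _ ⟨x, hx, rfl⟩
    have : x ^ p = 1 := hF hx
    change (x : C ⧸ W) ^ p = 1
    rw [← QuotientGroup.mk_pow, this, QuotientGroup.mk_one]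
  -- kernel and cokernel of the `p`-th power map on the finite group `C / W` have the same order
  have hker : Nat.card f.ker = f.range.index := by
    have h1 := Subgroup.card_mul_index f.range
    have h2 := Subgroup.card_mul_index f.ker
    rw [Subgroup.index_ker, ← h1, mul_comm] at h2
    exact Nat.eq_of_mul_eq_mul_left Nat.card_pos h2
  have hdvd : f.range.index ∣ (frattiniP p C).index := by
    rw [← Subgroup.index_comap_of_surjective f.range (QuotientGroup.mk'_surjective W)]
    refine Subgroup.index_dvd_of_le (powComm_le ?_ ?_ ?_)
    · refine Subgroup.isClosed_of_isOpen _ (Subgroup.isOpen_mono (H₁ := W) ?_ hWo)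
      intro x hx
      exact ⟨1, by simpa [f] using ((QuotientGroup.eq_one_iff x).2 hx).symm⟩
    · exact fun x _ => ⟨(x : C ⧸ W), rfl⟩
    · intro x y _
      rw [commutatorElement_eq_one_iff_mul_comm.2 (mul_comm x y)]
      exact one_mem _
  have := Nat.le_of_dvd (Nat.pos_of_ne_zero hfi.index_ne_zero) hdvd
  omega

end FiniteQuotients

/-! ### Stable complements in elementary abelian quotients -/

section Complement
open scoped commutatorElement

/-- Maschke's theorem for submodules of `𝔽_p[Δ]`-modules, `p ∤ |Δ|`. -/
theorem Representation.exists_isCompl_of_coprime {p : ℕ} [Fact p.Prime] {Δ : Type*} [Group Δ]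
    [Finite Δ] (hΔ : (Nat.card Δ).Coprime p) {V : Type*} [AddCommGroup V] [Module (ZMod p) V]
    (τ : Representation (ZMod p) Δ V) (W : Submodule (ZMod p) V) (hW : ∀ d, ∀ w ∈ W, τ d w ∈ W) :
    ∃ W' : Submodule (ZMod p) V, (∀ d, ∀ w ∈ W', τ d w ∈ W') ∧ IsCompl W W' := by
  have : NeZero (Nat.card Δ : ZMod p) := ⟨fun h0 => by
    have h1 : p ∣ Nat.card Δ := (CharP.cast_eq_zero_iff (ZMod p) p _).1 h0
    exact (Fact.out : p.Prime).one_lt.ne' (Nat.Coprime.eq_one_of_dvd hΔ.symm h1)⟩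
  have hss : τ.IsSemisimpleRepresentation :=
    (Representation.isSemisimpleRepresentation_iff_isSemisimpleModule_asModule τ).2 inferInstance
  let W₀ : Subrepresentation τ := ⟨W, fun d w hw => hW d w hw⟩
  obtain ⟨W', hW'⟩ := hss.exists_isCompl W₀
  refine ⟨W'.toSubmodule, fun d w hw => W'.apply_mem_toSubmodule d hw, ?_, ?_⟩
  · rw [disjoint_iff, ← Subrepresentation.toSubmodule_inf W₀ W', hW'.inf_eq_bot]
    rfl
  · rw [codisjoint_iff, ← Subrepresentation.toSubmodule_sup W₀ W', hW'.sup_eq_top]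
    rfl

/-- The `𝔽_p[Δ]`-module given by an action of `Δ` on an elementary abelian group. -/
def additiveRep {p : ℕ} {Δ Q : Type*} [Group Δ] [CommGroup Q] [Module (ZMod p) (Additive Q)]
    (a : Δ →* MulAut Q) : Representation (ZMod p) Δ (Additive Q) where
  toFun d := AddMonoidHom.toZModLinearMap p (MonoidHom.toAdditive (a d).toMonoidHom)
  map_one' := LinearMap.ext fun x => by
    change Additive.ofMul (a 1 x.toMul) = x
    rw [map_one]; rfl
  map_mul' c d := LinearMap.ext fun x => by
    change Additive.ofMul (a (c * d) x.toMul) = _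
    rw [map_mul]; rfl

/-- Maschke's theorem for an elementary abelian quotient `Q` of a group `R` with an action of `Δ`:
the image of a stable subgroup `N` has a stable complement in `Q`, whose preimage is `R'`. -/
theorem exists_stable_complement_of_hom {p : ℕ} [Fact p.Prime] {Δ : Type*} [Group Δ] [Finite Δ]
    (hΔ : (Nat.card Δ).Coprime p) {R : Type*} [Group R] (act : Δ →* MulAut R)
    {Q : Type*} [CommGroup Q] (hQ : ∀ x : Q, x ^ p = 1) (actQ : Δ →* MulAut Q)
    (q : R →* Q) (hact : ∀ d x, q (act d x) = actQ d (q x))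
    (N : Subgroup R) (hN : ∀ d, ∀ x ∈ N, act d x ∈ N) :
    ∃ R' : Subgroup R, q.ker ≤ R' ∧ (∀ d, ∀ x ∈ R', act d x ∈ R') ∧
      (∀ x ∈ R', x ∈ N → q x = 1) ∧ ∀ x, ∃ n ∈ N, n⁻¹ * x ∈ R' := by
  let _ : Module (ZMod p) (Additive Q) := AddCommGroup.zmodModule (n := p) hQ
  let τ : Representation (ZMod p) Δ (Additive Q) := additiveRep actQ
  let W : Submodule (ZMod p) (Additive Q) :=
    AddSubgroup.toZModSubmodule p (Subgroup.toAddSubgroup (N.map q))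
  have hW : ∀ d, ∀ w ∈ W, τ d w ∈ W := by
    rintro d _ ⟨n, hn, rfl⟩
    exact ⟨act d n, hN d n hn, hact d n⟩
  obtain ⟨W', hW', hcompl⟩ := Representation.exists_isCompl_of_coprime hΔ τ W hW
  let R' : Subgroup R := (AddSubgroup.toSubgroup' W'.toAddSubgroup).comap q
  have hR' : ∀ x, x ∈ R' ↔ Additive.ofMul (q x) ∈ W' := fun x => Iff.rfl
  refine ⟨R', fun x hx => ?_, fun d x hx => ?_, fun x hx hxN => ?_, fun x => ?_⟩
  · rw [hR', MonoidHom.mem_ker.1 hx]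
    exact zero_mem W'
  · rw [hR', hact]
    exact hW' d _ hx
  · have := hcompl.disjoint.le_bot (show Additive.ofMul (q x) ∈ W ⊓ W' from ⟨⟨x, hxN, rfl⟩, hx⟩)
    simpa using this
  · have h1 : Additive.ofMul (q x) ∈ W ⊔ W' := by rw [hcompl.sup_eq_top]; trivial
    obtain ⟨_, ⟨n, hn, rfl⟩, w', hw', h2⟩ := Submodule.mem_sup.1 h1
    refine ⟨n, hn, ?_⟩
    rw [hR']
    have h3 : w' = Additive.ofMul (q (n⁻¹ * x)) := by
      refine add_left_cancel (h2.trans ?_)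
      change q x = q n * q (n⁻¹ * x)
      rw [← map_mul, mul_inv_cancel_left]
    rwa [← h3]

/-- The case of `exists_stable_complement_of_hom` where the elementary abelian quotient is
`R / Ψ`. -/
theorem exists_stable_complement {p : ℕ} [Fact p.Prime] {Δ : Type*} [Group Δ] [Finite Δ]
    (hΔ : (Nat.card Δ).Coprime p) {R : Type*} [Group R] (act : Δ →* MulAut R)
    (Ψ N : Subgroup R) [Ψ.Normal] (hΨ : ∀ d, ∀ x ∈ Ψ, act d x ∈ Ψ) (hN : ∀ d, ∀ x ∈ N, act d x ∈ N)
    (hpow : ∀ x, x ^ p ∈ Ψ) (hcomm : ∀ x y : R, ⁅x, y⁆ ∈ Ψ) :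
    ∃ R' : Subgroup R, Ψ ≤ R' ∧ (∀ d, ∀ x ∈ R', act d x ∈ R') ∧ (∀ x ∈ R', x ∈ N → x ∈ Ψ) ∧
      ∀ x, ∃ n ∈ N, n⁻¹ * x ∈ R' := by
  let _ : CommGroup (R ⧸ Ψ) := { (inferInstance : Group (R ⧸ Ψ)) with
    mul_comm := by
      rintro ⟨x⟩ ⟨y⟩
      change ((x * y : R) : R ⧸ Ψ) = ((y * x : R) : R ⧸ Ψ)
      rw [QuotientGroup.eq]
      have := hcomm y⁻¹ x⁻¹
      simpa [commutatorElement_def, mul_assoc] using this }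
  have := exists_stable_complement_of_hom hΔ act (Q := R ⧸ Ψ) (fun x => by
      obtain ⟨y, rfl⟩ := QuotientGroup.mk'_surjective Ψ x
      rw [← map_pow]
      exact (QuotientGroup.eq_one_iff _).2 (hpow y)) (quotAct act Ψ hΨ) (QuotientGroup.mk' Ψ)
    (fun _ _ => rfl) N hN
  rw [QuotientGroup.ker_mk'] at this
  simpa using this

end Complement

/-! ### Extending invariant characters from a kernel -/

section Extension
open scoped commutatorElement

/-- If `H²(𝒢, A) = 0`, then every continuous conjugation invariant homomorphism `lam` from the
kernel of `π : R → 𝒢` to `A` extends to `R`. Here `lam` is a function on `R` of which only the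
values on the kernel matter, and `s` is a continuous section of `π`. -/
theorem exists_extension_of_invariant {𝒢 : Type u} [Group 𝒢] [TopologicalSpace 𝒢]
    [IsTopologicalGroup 𝒢] {A : Type u} [AddCommGroup A] [TopologicalSpace A]
    [IsTopologicalAddGroup A]
    (h : Subsingleton (continuousCohomology 2 (TopRep.of (ContRepresentation.trivial ℤ 𝒢 A))))
    {R : Type*} [Group R] [TopologicalSpace R] [IsTopologicalGroup R]
    (π : R →* 𝒢) (hπ : Continuous π) (s : 𝒢 → R) (hs : Continuous s) (hsπ : ∀ x, π (s x) = x)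
    (lam : R → A) (hmul : ∀ a b, π a = 1 → π b = 1 → lam (a * b) = lam a + lam b)
    (hconj : ∀ r n, π n = 1 → lam (r * n * r⁻¹) = lam n) (hcont : ContinuousOn lam {n | π n = 1}) :
    ∃ Λ : R →* Multiplicative A, Continuous (fun r => (Λ r).toAdd) ∧
      ∀ n, π n = 1 → (Λ n).toAdd = lam n := by
  have hsinv : ∀ x, π (s x)⁻¹ = x⁻¹ := fun x => by rw [map_inv, hsπ]
  have h1 : lam 1 = 0 := by
    have := hmul 1 1 (map_one π) (map_one π)
    rwa [one_mul, left_eq_add] at this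
  have hc : ∀ x y, π (s x * s y * (s (x * y))⁻¹) = 1 := fun x y => by
    simp [hsπ]
  -- the image under `lam` of the factor set of `s` is a cocycle, the coboundary of some `b`;
  -- then `r ↦ lam (r * (s (π r))⁻¹) + b (π r)` is the extension
  obtain ⟨b, hb, hcb⟩ := exists_continuous_of_cocycle h
    (fun x y => lam (s x * s y * (s (x * y))⁻¹))
    (hcont.comp_continuous (f := fun x : 𝒢 × 𝒢 => s x.1 * s x.2 * (s (x.1 * x.2))⁻¹)
      (by fun_prop) (fun x => hc _ _)) (by
      intro x y z
      have e1 : lam (s y * s z * (s (y * z))⁻¹) + lam (s x * s (y * z) * (s (x * (y * z)))⁻¹) =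
          lam (s x * s y * (s (x * y))⁻¹) + lam (s (x * y) * s z * (s (x * y * z))⁻¹) := by
        rw [← hconj (s x) _ (hc y z), ← hmul _ _ (by simp [hsπ]) (hc _ _),
          ← hmul _ _ (hc _ _) (hc _ _)]
        congr 1
        rw [mul_assoc x y z]
        group
      rw [sub_eq_zero, sub_add_eq_add_sub, e1]
      abel)
  have hmem : ∀ r, π (r * (s (π r))⁻¹) = 1 := fun r => by simp [hsπ]
  have hs1 : lam (s 1) = b 1 := by
    have e1 := hcb 1 1
    simpa using e1
  refine ⟨MonoidHom.mk' (fun r => Multiplicative.ofAdd (lam (r * (s (π r))⁻¹) + b (π r))) ?_,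
    ?_, ?_⟩
  · intro r r'
    rw [← ofAdd_add]
    congr 1
    have e2 : r * r' * (s (π (r * r')))⁻¹ = (r * (s (π r))⁻¹) *
        ((s (π r) * (r' * (s (π r'))⁻¹) * (s (π r))⁻¹) *
          (s (π r) * s (π r') * (s (π r * π r'))⁻¹)) := by
      rw [map_mul]; group
    rw [e2, hmul _ _ (hmem r) (by simp [hsπ]), hmul _ _ (by simp [hsπ]) (hc _ _),
      hconj _ _ (hmem r'), hcb, map_mul]
    abel
  · exact (hcont.comp_continuous (f := fun r => r * (s (π r))⁻¹) (by fun_prop) hmem).add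
      (hb.comp hπ)
  · intro n hn
    change lam (n * (s (π n))⁻¹) + b (π n) = lam n
    have e3 : lam (s 1)⁻¹ = - lam (s 1) := by
      have := hmul (s 1) (s 1)⁻¹ (hsπ 1) (by rw [hsinv, inv_one])
      rw [mul_inv_cancel, h1] at this
      exact eq_neg_of_add_eq_zero_right this.symm
    rw [hn, hmul _ _ hn (by rw [hsinv, inv_one]), e3, hs1, neg_add_cancel_right]

/-- The elements of an `𝔽_p`-vector space are separated by its characters to `ℚ_p / ℤ_p`. -/
theorem exists_character_ne_zero {p : ℕ} [Fact p.Prime] {M : Type*} [AddCommGroup M]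
    [Module (ZMod p) M] {x : M} (hx : x ≠ 0) : ∃ χ : M →+ QpModZp p, χ x ≠ 0 := by
  obtain ⟨l, hl⟩ : ∃ l : Module.Dual (ZMod p) M, l x ≠ 0 := by
    by_contra! hall
    exact hx ((Module.forall_dual_apply_eq_zero_iff (ZMod p) x).1 hall)
  have hp : (p : ℚ_[p]) ≠ 0 := by exact_mod_cast (Fact.out : p.Prime).ne_zero
  -- `ZMod p` embeds in `ℚ_p / ℤ_p` by `1 ↦ 1 / p`
  let e : ℤ →+ QpModZp p := (zmultiplesHom _) (((p : ℚ_[p])⁻¹ : ℚ_[p]) : QpModZp p)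
  have he : e p = 0 := by
    change (p : ℤ) • (((p : ℚ_[p])⁻¹ : ℚ_[p]) : QpModZp p) = 0
    rw [← QuotientAddGroup.mk_zsmul, QuotientAddGroup.eq_zero_iff]
    have : (p : ℤ) • (p : ℚ_[p])⁻¹ = 1 := by
      simp [hp]
    rw [this]
    exact one_mem (PadicInt.subring p)
  let j : ZMod p →+ QpModZp p := ZMod.lift p ⟨e, he⟩
  have hj1 : j 1 ≠ 0 := by
    have : j 1 = (((p : ℚ_[p])⁻¹ : ℚ_[p]) : QpModZp p) := by
      have := ZMod.lift_coe p ⟨e, he⟩ 1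
      simpa [e] using this
    rw [this, Ne, QuotientAddGroup.eq_zero_iff]
    intro hmem
    have h1 : ‖(p : ℚ_[p])⁻¹‖ ≤ 1 := hmem
    rw [norm_inv, Padic.norm_p, inv_inv] at h1
    exact absurd h1 (not_le.2 (by exact_mod_cast (Fact.out : p.Prime).one_lt))
  refine ⟨j.comp ((l x)⁻¹ • l).toAddMonoidHom, ?_⟩
  simpa [hl] using hj1

/-- If `H²(𝒢, ℚ_p / ℤ_p) = 0`, then an invariant homomorphism `κ` from `ker π` to an `𝔽_p`-vector
space kills the intersection of `ker π` with the closure of `[R, R]`: composed with any character,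
it extends to a homomorphism from `R` to an abelian group. -/
theorem eq_zero_of_mem_closure_commutator {p : ℕ} [Fact p.Prime] {𝒢 : Type u} [Group 𝒢]
    [TopologicalSpace 𝒢] [IsTopologicalGroup 𝒢]
    (h : Subsingleton (continuousCohomology 2
      (TopRep.of (ContRepresentation.trivial ℤ 𝒢 (ULift.{u} (QpModZp p))))))
    {R : Type*} [Group R] [TopologicalSpace R] [IsTopologicalGroup R]
    (π : R →* 𝒢) (hπ : Continuous π) (s : 𝒢 → R) (hs : Continuous s) (hsπ : ∀ x, π (s x) = x)
    {M : Type*} [AddCommGroup M] [Module (ZMod p) M] [TopologicalSpace M] [DiscreteTopology M]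
    (κ : R → M) (hmul : ∀ a b, π a = 1 → π b = 1 → κ (a * b) = κ a + κ b)
    (hconj : ∀ r n, π n = 1 → κ (r * n * r⁻¹) = κ n) (hcont : ContinuousOn κ {n | π n = 1})
    {n : R} (hn : π n = 1) (hnc : n ∈ (commutator R).topologicalClosure) : κ n = 0 := by
  by_contra hne
  obtain ⟨χ, hχ⟩ := exists_character_ne_zero (p := p) hne
  obtain ⟨Λ, hΛ, hΛn⟩ := exists_extension_of_invariant h π hπ s hs hsπ
    (fun r => ULift.up (χ (κ r))) (fun a b ha hb => by rw [hmul a b ha hb, map_add]; rfl)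
    (fun r n hn => by rw [hconj r n hn])
    ((continuous_of_discreteTopology (f := fun x : M => (ULift.up (χ x) : ULift.{u} (QpModZp p)))
      ).comp_continuousOn hcont)
  have hle : (commutator R).topologicalClosure ≤ Λ.ker := by
    refine Subgroup.topologicalClosure_minimal _ (Abelianization.commutator_subset_ker Λ) ?_
    have : (Λ.ker : Set R) = (fun r => (Λ r).toAdd) ⁻¹' {0} := by
      ext r; simp [MonoidHom.mem_ker]
    rw [this]
    exact isClosed_singleton.preimage hΛ
  have h1 := hΛn n hn
  rw [MonoidHom.mem_ker.1 (hle hnc)] at h1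
  exact hχ (congrArg ULift.down h1).symm

end Extension

/-! ### The connecting homomorphism from the `p`-torsion -/

section Connecting
open scoped commutatorElement

theorem map_mem_closure_commutator {R S : Type*} [Group R] [TopologicalSpace R]
    [IsTopologicalGroup R] [Group S] [TopologicalSpace S] [IsTopologicalGroup S] (φ : R →* S)
    (hφ : Continuous φ) {x : R} (hx : x ∈ (commutator R).topologicalClosure) :
    φ x ∈ (commutator S).topologicalClosure := by
  refine map_mem_closure hφ hx fun y hy => ?_
  have h : (commutator R).map φ ≤ commutator S := by
    rw [commutator_def, Subgroup.map_commutator]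
    exact Subgroup.commutator_mono le_top le_top
  exact h (Subgroup.mem_map_of_mem _ hy)

/-- By compactness, a continuous surjection maps the closed commutator subgroup onto the closed
commutator subgroup. -/
theorem exists_mem_closure_commutator {R S : Type*} [Group R] [TopologicalSpace R]
    [IsTopologicalGroup R] [CompactSpace R] [Group S] [TopologicalSpace S] [IsTopologicalGroup S]
    [T2Space S] (φ : R →* S) (hφ : Continuous φ) (hs : Function.Surjective φ) {x : S}
    (hx : x ∈ (commutator S).topologicalClosure) :
    ∃ c ∈ (commutator R).topologicalClosure, φ c = x := by
  have hcl : IsClosed (((commutator R).topologicalClosure.map φ : Subgroup S) : Set S) :=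
    ((Subgroup.isClosed_topologicalClosure _).isCompact.image hφ).isClosed
  have hle : commutator S ≤ (commutator R).topologicalClosure.map φ := by
    have e : (commutator R).map φ = commutator S := by
      rw [commutator_def, commutator_def, Subgroup.map_commutator,
        Subgroup.map_top_of_surjective φ hs]
    rw [← e]
    exact Subgroup.map_mono (Subgroup.le_topologicalClosure _)
  obtain ⟨c, hc, rfl⟩ := Subgroup.topologicalClosure_minimal _ hle hcl hx
  exact ⟨c, hc, rfl⟩

theorem IsTopFG.of_surjective {R S : Type*} [Group R] [TopologicalSpace R]
    [IsTopologicalGroup R] [Group S] [TopologicalSpace S] [IsTopologicalGroup S] (h : IsTopFG R)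
    (φ : R →* S) (hφ : Continuous φ) (hs : Function.Surjective φ) : IsTopFG S := by
  obtain ⟨X, hX, hgen⟩ := h
  refine ⟨φ '' X, hX.image _, ?_⟩
  have h1 : closedSubgroupGen X ≤ (closedSubgroupGen (φ '' X)).comap φ := by
    refine Subgroup.topologicalClosure_minimal _ ?_
      ((Subgroup.isClosed_topologicalClosure _).preimage hφ)
    rw [Subgroup.closure_le]
    exact fun x hx => Subgroup.le_topologicalClosure _ (Subgroup.subset_closure ⟨x, hx, rfl⟩)
  rw [hgen] at h1
  rw [eq_top_iff]
  rintro y -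
  obtain ⟨x, rfl⟩ := hs y
  exact h1 (Subgroup.mem_top x)

/-- The group `𝒯[p]` is finite. -/
theorem finite_torsionBy_abelianization {p : ℕ} (hp : 0 < p) {N : Type*} [Group N]
    [TopologicalSpace N] [IsTopologicalGroup N] [CompactSpace N] [TotallyDisconnectedSpace N]
    (h : IsTopFG N) :
    Finite (AddSubgroup.torsionBy (Additive (TopologicalAbelianization N)) (p : ℤ)) := by
  have hq := QuotientGroup.mk'_surjective (commutator N).topologicalClosure
  have hfin := finite_setOf_pow_eq_one (C := TopologicalAbelianization N) hp
    (h.of_surjective (QuotientGroup.mk' _) QuotientGroup.continuous_mk hq) (by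
      intro x hx
      obtain ⟨x, rfl⟩ := hq x
      have hx' : x ∉ (commutator N).topologicalClosure := fun hx' =>
        hx ((QuotientGroup.eq_one_iff x).2 hx')
      let K : ClosedSubgroup N := ⟨(commutator N).topologicalClosure,
        Subgroup.isClosed_topologicalClosure _⟩
      have hK := ProfiniteGrp.closedSubgroup_eq_sInf_open K
      have : x ∉ sInf {V : Subgroup N | IsOpen (V : Set N) ∧ K ≤ V} := hK ▸ hx'
      simp only [Subgroup.mem_sInf, not_forall] at this
      obtain ⟨V, ⟨hVo, hKV⟩, hxV⟩ := this
      refine ⟨V.map (QuotientGroup.mk' _), QuotientGroup.isOpenMap_coe _ hVo, ?_⟩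
      rintro ⟨v, hv, hvx⟩
      have h1 : v⁻¹ * x ∈ K := QuotientGroup.eq.1 hvx
      apply hxV
      simpa using V.mul_mem hv (hKV h1))
  have : Finite {x : TopologicalAbelianization N | x ^ p = 1} := hfin
  refine Finite.of_injective (β := {x : TopologicalAbelianization N | x ^ p = 1})
    (fun x => ⟨x.1.toMul, ?_⟩) ?_
  · have := AddSubgroup.torsionBy.nsmul_iff.1 x.2
    exact this
  · intro x y hxy
    have h := congrArg Subtype.val hxy
    exact Subtype.ext (Additive.toMul.injective h)

/-- The connecting homomorphism `𝒯[p] → M`, sending the class of `π r` with `π r ^ p` in the closure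
of `[𝒢, 𝒢]` to `κ n`, where `r ^ p` and `n ∈ ker π` agree modulo the closure of `[R, R]`, is
equivariant. Orthogonality makes it zero. -/
theorem eq_zero_of_pow_eq {p : ℕ} [Fact p.Prime] {𝒢 : Type*} [Group 𝒢]
    [TopologicalSpace 𝒢] [IsTopologicalGroup 𝒢] [CompactSpace 𝒢] [TotallyDisconnectedSpace 𝒢]
    (h𝒢 : IsTopFG 𝒢) {Δ : Type*} [Group Δ] [Finite Δ] (hΔ : (Nat.card Δ).Coprime p)
    (act : Δ →* MulAut 𝒢) (hact : ∀ δ, Continuous (act δ))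
    {M : Type*} [AddCommGroup M] [Module (ZMod p) M] [Finite M] (σ : Representation (ZMod p) Δ M)
    (horth : ModOrthogonal (torsionRep p (abAct act hact)) σ)
    {R : Type*} [Group R] [TopologicalSpace R] [IsTopologicalGroup R] [CompactSpace R]
    (actR : Δ →* MulAut R) (hactR : ∀ δ, Continuous (actR δ))
    (π : R →* 𝒢) (hπ : Continuous π) (hπs : Function.Surjective π)
    (hπΔ : ∀ δ r, π (actR δ r) = act δ (π r))
    (κ : R → M) (hmul : ∀ a b, π a = 1 → π b = 1 → κ (a * b) = κ a + κ b)
    (hκΔ : ∀ δ n, π n = 1 → κ (actR δ n) = σ δ (κ n))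
    (hκ0 : ∀ n, π n = 1 → n ∈ (commutator R).topologicalClosure → κ n = 0)
    {r n : R} (hn : π n = 1)
    (hrn : (r : TopologicalAbelianization R) ^ p = (n : TopologicalAbelianization R)) :
    κ n = 0 := by
  have hfin := finite_torsionBy_abelianization (p := p) (Fact.out : p.Prime).pos h𝒢
  let T := AddSubgroup.torsionBy (Additive (TopologicalAbelianization 𝒢)) (p : ℤ)
  let mkG : 𝒢 → Additive (TopologicalAbelianization 𝒢) := fun x =>
    Additive.ofMul (x : TopologicalAbelianization 𝒢)
  let q : R →* TopologicalAbelianization R := QuotientGroup.mk' _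
  have hone : κ 1 = 0 := by
    have := hmul 1 1 (map_one π) (map_one π)
    rwa [one_mul, left_eq_add] at this
  have hpowκ : ∀ a, π a = 1 → ∀ j : ℕ, κ (a ^ j) = j • κ a := by
    intro a ha j
    induction j with
    | zero => simpa using hone
    | succ j ih => rw [pow_succ, hmul _ _ (by rw [map_pow, ha, one_pow]) ha, ih, succ_nsmul]
  have hp0 : ∀ x : M, p • x = 0 := fun x => by
    rw [← Nat.cast_smul_eq_nsmul (ZMod p), CharP.cast_eq_zero, zero_smul]
  -- `κ` only depends on the class in the abelianization of `R`
  have hκq : ∀ a b, π a = 1 → π b = 1 → q a = q b → κ a = κ b := by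
    intro a b ha hb hab
    have h1 : π (a * b⁻¹) = 1 := by simp [ha, hb]
    have h2 : q (a * b⁻¹) = 1 := by rw [map_mul, map_inv, hab, mul_inv_cancel]
    have h3 := hκ0 _ h1 ((QuotientGroup.eq_one_iff _).1 h2)
    have h4 := hmul _ _ h1 hb
    rwa [inv_mul_cancel_right, h3, zero_add] at h4
  -- the graph of the connecting homomorphism
  let Rel : T → M → Prop := fun t m =>
    ∃ r n, mkG (π r) = t ∧ π n = 1 ∧ q r ^ p = q n ∧ κ n = m
  have hex : ∀ t : T, ∃ m, Rel t m := by
    rintro ⟨t, ht⟩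
    obtain ⟨x, hx⟩ := QuotientGroup.mk'_surjective _ t.toMul
    obtain ⟨r, rfl⟩ := hπs x
    have h1 : (π r) ^ p ∈ (commutator 𝒢).topologicalClosure := by
      have h2 := AddSubgroup.torsionBy.nsmul_iff.1 ht
      have h3 : t.toMul ^ p = 1 := h2
      rw [← hx, ← map_pow] at h3
      exact (QuotientGroup.eq_one_iff _).1 h3
    obtain ⟨c, hc, hcr⟩ := exists_mem_closure_commutator π hπ hπs h1
    refine ⟨κ (r ^ p * c⁻¹), r, r ^ p * c⁻¹, congrArg Additive.ofMul hx, by simp [hcr], ?_, rfl⟩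
    rw [map_mul, map_inv, show q c = 1 from (QuotientGroup.eq_one_iff _).2 hc, inv_one, mul_one,
      map_pow]
  have hadd : ∀ t t' m m', Rel t m → Rel t' m' → Rel (t + t') (m + m') := by
    rintro t t' m m' ⟨r, n, h1, h2, h3, h4⟩ ⟨r', n', h1', h2', h3', h4'⟩
    refine ⟨r * r', n * n', ?_, by rw [map_mul, h2, h2', one_mul], ?_, by
      rw [hmul _ _ h2 h2', h4, h4']⟩
    · rw [AddSubgroup.coe_add, ← h1, ← h1', map_mul]; rfl
    · rw [map_mul, map_mul, mul_pow, h3, h3']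
  have hneg : ∀ t m, Rel t m → Rel (-t) (-m) := by
    rintro t m ⟨r, n, h1, h2, h3, h4⟩
    refine ⟨r⁻¹, n⁻¹, ?_, by rw [map_inv, h2, inv_one], by rw [map_inv, map_inv, inv_pow, h3], ?_⟩
    · rw [AddSubgroup.coe_neg, ← h1, map_inv]; rfl
    · have := hmul n n⁻¹ h2 (by rw [map_inv, h2, inv_one])
      rw [mul_inv_cancel, hone, h4] at this
      exact eq_neg_of_add_eq_zero_right this.symm
  have hzero : ∀ m, Rel 0 m → m = 0 := by
    rintro m ⟨r, n, h1, h2, h3, rfl⟩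
    have h4 : π r ∈ (commutator 𝒢).topologicalClosure :=
      (QuotientGroup.eq_one_iff _).1 (Additive.ofMul.injective h1)
    obtain ⟨c, hc, hcr⟩ := exists_mem_closure_commutator π hπ hπs h4
    have h5 : π (r * c⁻¹) = 1 := by simp [hcr]
    have h6 : q (r * c⁻¹) = q r := by
      rw [map_mul, map_inv, show q c = 1 from (QuotientGroup.eq_one_iff _).2 hc, inv_one, mul_one]
    rw [hκq n ((r * c⁻¹) ^ p) h2 (by rw [map_pow, h5, one_pow]) (by rw [map_pow, h6, h3]),
      hpowκ _ h5, hp0]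
  have huniq : ∀ t m m', Rel t m → Rel t m' → m = m' := by
    intro t m m' h h'
    have := hadd _ _ _ _ h (hneg _ _ h')
    rw [add_neg_cancel] at this
    exact add_neg_eq_zero.1 (hzero _ this)
  choose f hf using hex
  let F : T →ₗ[ZMod p] M := AddMonoidHom.toZModLinearMap p
    (AddMonoidHom.mk' f fun t t' => huniq _ _ _ (hf _) (hadd _ _ _ _ (hf t) (hf t')))
  have hF : F = 0 := by
    refine horth.eq_zero hΔ F fun d t => huniq _ _ _ (hf _) ?_
    obtain ⟨r, n, h1, h2, h3, h4⟩ := hf t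
    refine ⟨actR d r, actR d n, ?_, by rw [hπΔ, h2, map_one], ?_, ?_⟩
    · rw [hπΔ]
      change mkG (act d (π r)) = abAct act hact d t
      rw [← h1]; rfl
    · rw [← map_pow, ← map_pow]
      rw [← map_pow] at h3
      refine QuotientGroup.eq.2 ?_
      rw [← map_inv, ← map_mul]
      exact map_mem_closure_commutator (actR d).toMonoidHom (hactR d) (QuotientGroup.eq.1 h3)
    · rw [hκΔ d n h2, h4]; rfl
  have ht : mkG (π r) ∈ T := by
    rw [AddSubgroup.torsionBy.nsmul_iff]
    have h1 : r ^ p * n⁻¹ ∈ (commutator R).topologicalClosure := by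
      rw [← QuotientGroup.eq_one_iff]
      rw [QuotientGroup.mk_mul, QuotientGroup.mk_pow, hrn, QuotientGroup.mk_inv, mul_inv_cancel]
    have h2 := map_mem_closure_commutator π hπ h1
    rw [map_mul, map_inv, hn, inv_one, mul_one, map_pow] at h2
    exact (QuotientGroup.eq_one_iff _).2 h2
  have h1 : Rel ⟨_, ht⟩ (κ n) := ⟨r, n, rfl, hn, hrn, rfl⟩
  rw [huniq _ _ _ h1 (hf _)]
  exact DFunLike.congr_fun hF ⟨_, ht⟩

end Connecting

/-! ### Embedding problems with kernel orthogonal to the torsion -/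

section LiftStep
open scoped commutatorElement

/-- One step of the lifting. The kernel of `π : R → 𝒢` carries an equivariant homomorphism `κ` to a
module orthogonal to `𝒯[p]`. Then `R` has a closed stable subgroup `R'` which still maps onto `𝒢`
and meets the kernel of `π` in the kernel of `κ`; that is, the extension of `𝒢` by the image of `κ`
splits equivariantly. -/
theorem exists_lifting_step {p : ℕ} [Fact p.Prime] {𝒢 : Type u} [Group 𝒢]
    [TopologicalSpace 𝒢] [IsTopologicalGroup 𝒢] [CompactSpace 𝒢] [TotallyDisconnectedSpace 𝒢]
    (h𝒢 : IsTopFG 𝒢) {Δ : Type*} [Group Δ] [Finite Δ] (hΔ : (Nat.card Δ).Coprime p)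
    (act : Δ →* MulAut 𝒢) (hact : ∀ δ, Continuous (act δ))
    (hH2 : Subsingleton (continuousCohomology 2
      (TopRep.of (ContRepresentation.trivial ℤ 𝒢 (ULift.{u} (QpModZp p))))))
    {M : Type*} [AddCommGroup M] [Module (ZMod p) M] [Finite M] [TopologicalSpace M]
    [DiscreteTopology M] (σ : Representation (ZMod p) Δ M)
    (horth : ModOrthogonal (torsionRep p (abAct act hact)) σ)
    {R : Type*} [Group R] [TopologicalSpace R] [IsTopologicalGroup R] [CompactSpace R] [T2Space R]
    (actR : Δ →* MulAut R) (hactR : ∀ δ, Continuous (actR δ))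
    (π : R →* 𝒢) (hπ : Continuous π) (hπΔ : ∀ δ r, π (actR δ r) = act δ (π r))
    (s : 𝒢 → R) (hs : Continuous s) (hsπ : ∀ x, π (s x) = x)
    (κ : R → M) (hmul : ∀ a b, π a = 1 → π b = 1 → κ (a * b) = κ a + κ b)
    (hconj : ∀ r n, π n = 1 → κ (r * n * r⁻¹) = κ n) (hcont : ContinuousOn κ {n | π n = 1})
    (hκΔ : ∀ δ n, π n = 1 → κ (actR δ n) = σ δ (κ n)) :
    ∃ R' : Subgroup R, IsClosed (R' : Set R) ∧ (∀ δ, ∀ r ∈ R', actR δ r ∈ R') ∧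
      (∀ x, ∃ r ∈ R', π r = x) ∧ ∀ n, π n = 1 → (n ∈ R' ↔ κ n = 0) := by
  have hπs : Function.Surjective π := fun x => ⟨s x, hsπ x⟩
  have hκ0 : ∀ n, π n = 1 → n ∈ (commutator R).topologicalClosure → κ n = 0 := fun n hn hnc =>
    eq_zero_of_mem_closure_commutator hH2 π hπ s hs hsπ κ hmul hconj hcont hn hnc
  have hone : κ 1 = 0 := by
    have := hmul 1 1 (map_one π) (map_one π)
    rwa [one_mul, left_eq_add] at this
  have hinv : ∀ n, π n = 1 → κ n⁻¹ = - κ n := fun n hn => by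
    have := hmul n n⁻¹ hn (by rw [map_inv, hn, inv_one])
    rw [mul_inv_cancel, hone] at this
    exact eq_neg_of_add_eq_zero_right this.symm
  -- elements of the kernel which are Frattini in `R` are killed by `κ`
  have hfr : ∀ n, π n = 1 → n ∈ frattiniP p R → κ n = 0 := by
    intro n hn hnf
    let B := TopologicalAbelianization R
    have : T1Space B := QuotientGroup.instT1Space (hN := Subgroup.isClosed_topologicalClosure _)
    let P : Subgroup B := (powMonoidHom p : B →* B).range
    have hPcl : IsClosed (P : Set B) := by
      have : (P : Set B) = Set.range fun x : B => x ^ p := rfl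
      rw [this]
      exact (isCompact_range (continuous_pow p)).isClosed
    have hle : frattiniP p R ≤ P.comap (QuotientGroup.mk' _) := by
      refine powComm_le (hPcl.preimage QuotientGroup.continuous_mk) (fun x _ => ⟨(x : B), rfl⟩) ?_
      intro x y _
      have h1 : ((⁅x, y⁆ : R) : B) = 1 := (QuotientGroup.eq_one_iff _).2
        (Subgroup.le_topologicalClosure _ (Subgroup.commutator_mem_commutator
          (Subgroup.mem_top x) (Subgroup.mem_top y)))
      change ((⁅x, y⁆ : R) : B) ∈ P
      rw [h1]
      exact one_mem _
    obtain ⟨b, hb⟩ := hle hnf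
    obtain ⟨r, rfl⟩ := QuotientGroup.mk'_surjective _ b
    exact eq_zero_of_pow_eq h𝒢 hΔ act hact σ horth actR hactR π hπ hπs hπΔ κ hmul hκΔ hκ0 hn hb
  -- a stable complement `R'` of `ker π` in `R / Ψ`, with `Ψ` generated by `Φ(R)` and `ker κ`,
  -- is the desired subgroup, as `ker π ∩ Ψ` is the kernel of `κ`
  let Kκ : Subgroup R :=
    { carrier := {n | π n = 1 ∧ κ n = 0}
      one_mem' := ⟨map_one π, hone⟩
      mul_mem' := fun {a b} ha hb => ⟨by rw [map_mul, ha.1, hb.1, one_mul], by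
        rw [hmul a b ha.1 hb.1, ha.2, hb.2, add_zero]⟩
      inv_mem' := fun {a} ha => ⟨by rw [map_inv, ha.1, inv_one], by
        rw [hinv a ha.1, ha.2, neg_zero]⟩ }
  have hKn : Kκ.Normal := ⟨fun n hn r => ⟨by simp [hn.1], by rw [hconj r n hn.1, hn.2]⟩⟩
  have hker : IsClosed {n : R | π n = 1} := isClosed_singleton.preimage hπ
  have hKcl : IsClosed (Kκ : Set R) :=
    hcont.preimage_isClosed_of_isClosed hker (isClosed_discrete {0})
  let Ψ : Subgroup R := frattiniP p R ⊔ Kκ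
  have hΨcl : IsClosed (Ψ : Set R) := by
    rw [Subgroup.mul_normal]
    exact ((isClosed_powComm ⊤).isCompact.mul hKcl.isCompact).isClosed
  have hΨn : Ψ.Normal := Subgroup.sup_normal _ _
  have hΨker : ∀ n, π n = 1 → n ∈ Ψ → κ n = 0 := by
    intro n hn hnΨ
    obtain ⟨a, ha, b, hb, rfl⟩ := Subgroup.mem_sup_of_normal_right.1 hnΨ
    have hπa : π a = 1 := by rwa [map_mul, hb.1, mul_one] at hn
    rw [hmul a b hπa hb.1, hfr a hπa ha, hb.2, add_zero]
  have hΨle : frattiniP p R ≤ Ψ := le_sup_left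
  have hΨact : ∀ d, ∀ x ∈ Ψ, actR d x ∈ Ψ := by
    intro d x hx
    obtain ⟨a, ha, b, hb, rfl⟩ := Subgroup.mem_sup_of_normal_right.1 hx
    rw [map_mul]
    refine mul_mem (hΨle (map_mem_powComm p (actR d).toMonoidHom (hactR d)
      (fun _ _ => Subgroup.mem_top _) ha)) (Subgroup.mem_sup_right ⟨?_, ?_⟩)
    · rw [hπΔ, hb.1, map_one]
    · rw [hκΔ d b hb.1, hb.2, map_zero]
  obtain ⟨R', hΨR', hR'act, hR'ker, hR'top⟩ := exists_stable_complement hΔ actR Ψ π.ker hΨact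
    (fun d x hx => by rw [MonoidHom.mem_ker, hπΔ, MonoidHom.mem_ker.1 hx, map_one])
    (fun x => hΨle (pow_mem_powComm p (Subgroup.mem_top x)))
    (fun x y => hΨle (commutator_mem_powComm x (Subgroup.mem_top y)))
  -- `R / Ψ` is finite: modulo the kernel of `π` it is a quotient of `𝒢 / Φ(𝒢)`
  have hfi : Ψ.FiniteIndex := by
    refine ⟨?_⟩
    rw [← Subgroup.relIndex_mul_index (le_sup_left : Ψ ≤ Ψ ⊔ π.ker), Subgroup.relIndex_sup_left]
    refine mul_ne_zero ?_ ?_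
    · let κ' : π.ker →* Multiplicative M := MonoidHom.mk' (fun n => Multiplicative.ofAdd (κ n))
        fun a b => congrArg Multiplicative.ofAdd (hmul a b a.2 b.2)
      have hle : κ'.ker ≤ Ψ.subgroupOf π.ker := fun n hn =>
        Subgroup.mem_sup_right ⟨n.2, Multiplicative.ofAdd.injective hn⟩
      have : Finite κ'.range := Finite.of_injective Subtype.val Subtype.val_injective
      have h1 : κ'.ker.index ≠ 0 := by
        rw [Subgroup.index_ker]
        exact Nat.card_pos.ne'
      exact fun h0 => h1 (Nat.eq_zero_of_zero_dvd (h0 ▸ Subgroup.index_dvd_of_le hle))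
    · have h2 : (Ψ.map π).index ≠ 0 := by
        have hcl : IsClosed ((Ψ.map π : Subgroup 𝒢) : Set 𝒢) :=
          (hΨcl.isCompact.image hπ).isClosed
        have hle : frattiniP p 𝒢 ≤ Ψ.map π := by
          refine powComm_le hcl (fun x _ => ?_) (fun x y _ => ?_)
          · obtain ⟨r, rfl⟩ := hπs x
            exact ⟨r ^ p, hΨle (pow_mem_powComm p (Subgroup.mem_top r)), map_pow π r p⟩
          · obtain ⟨r, rfl⟩ := hπs x
            obtain ⟨r', rfl⟩ := hπs y
            exact ⟨⁅r, r'⁆, hΨle (commutator_mem_powComm r (Subgroup.mem_top r')),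
              map_commutatorElement π r r'⟩
        have hne := (h𝒢.finiteIndex_frattiniP (p := p) (Fact.out : p.Prime).pos).index_ne_zero
        exact fun h0 => hne (Nat.eq_zero_of_zero_dvd (h0 ▸ Subgroup.index_dvd_of_le hle))
      rwa [← Subgroup.comap_map_eq, Subgroup.index_comap_of_surjective _ hπs]
  have hΨo : IsOpen (Ψ : Set R) := Subgroup.isOpen_of_isClosed_of_finiteIndex Ψ hΨcl
  refine ⟨R', Subgroup.isClosed_of_isOpen _ (Subgroup.isOpen_mono hΨR' hΨo), hR'act,
    fun x => ?_, fun n hn => ⟨fun h => hΨker n hn (hR'ker n h hn), fun h =>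
      hΨR' (Subgroup.mem_sup_right ⟨hn, h⟩)⟩⟩
  obtain ⟨n, hn, hR'⟩ := hR'top (s x)
  exact ⟨_, hR', by rw [map_mul, map_inv, MonoidHom.mem_ker.1 hn, inv_one, one_mul, hsπ]⟩

end LiftStep

/-! ### The lattices `p ^ r M_m(ℤ_p)` and the `p`-th power map -/

section MatrixBall

variable {p : ℕ} [Fact p.Prime] {m : ℕ}

/-- The lattice `p ^ r M_m(ℤ_p)` in `M_m(ℚ_p)`. -/
def matBall (p : ℕ) [Fact p.Prime] (m r : ℕ) : AddSubgroup (Matrix (Fin m) (Fin m) ℚ_[p]) where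
  carrier := {A | ∀ i j, ‖A i j‖ ≤ (p : ℝ) ^ (-(r : ℤ))}
  zero_mem' i j := by simp
  add_mem' ha hb i j := (IsUltrametricDist.norm_add_le_max _ _).trans (max_le (ha i j) (hb i j))
  neg_mem' ha i j := by simpa using ha i j

theorem matBall_mono {r s : ℕ} (h : r ≤ s) : matBall p m s ≤ matBall p m r := fun A hA i j =>
  (hA i j).trans (zpow_le_zpow_right₀ (by exact_mod_cast (Fact.out : p.Prime).one_lt.le)
    (by omega))

theorem isClosed_matBall (r : ℕ) :
    IsClosed (matBall p m r : Set (Matrix (Fin m) (Fin m) ℚ_[p])) := by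
  have : (matBall p m r : Set (Matrix (Fin m) (Fin m) ℚ_[p])) =
      ⋂ i, ⋂ j, {A | ‖A i j‖ ≤ (p : ℝ) ^ (-(r : ℤ))} := by
    ext A; simp [matBall]
  rw [this]
  exact isClosed_iInter fun i => isClosed_iInter fun j =>
    isClosed_le (by fun_prop) continuous_const

theorem matBall_mem_nhds (r : ℕ) : (matBall p m r : Set (Matrix (Fin m) (Fin m) ℚ_[p])) ∈
    nhds 0 := by
  have : (matBall p m r : Set (Matrix (Fin m) (Fin m) ℚ_[p])) =
      ⋂ i, ⋂ j, (fun A : Matrix (Fin m) (Fin m) ℚ_[p] => A i j) ⁻¹'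
        (Metric.closedBall 0 ((p : ℝ) ^ (-(r : ℤ)))) := by
    ext A; simp [matBall]
  rw [this]
  have hp : (0 : ℝ) < p := by exact_mod_cast (Fact.out : p.Prime).pos
  refine (isOpen_iInter_of_finite fun i => isOpen_iInter_of_finite fun j =>
    (IsUltrametricDist.isOpen_closedBall _ (by positivity)).preimage (by fun_prop)).mem_nhds ?_
  simp only [Set.mem_iInter, Set.mem_preimage, Matrix.zero_apply]
  exact fun _ _ => Metric.mem_closedBall_self (by positivity)

theorem eq_zero_of_forall_mem_matBall {A : Matrix (Fin m) (Fin m) ℚ_[p]}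
    (h : ∀ r, A ∈ matBall p m r) : A = 0 := by
  ext i j
  have hp : (1 : ℝ) < p := by exact_mod_cast (Fact.out : p.Prime).one_lt
  have : Filter.Tendsto (fun r : ℕ => ((p : ℝ)⁻¹) ^ r) Filter.atTop (nhds 0) :=
    tendsto_pow_atTop_nhds_zero_of_lt_one (by positivity) (inv_lt_one_of_one_lt₀ hp)
  have h1 := ge_of_tendsto this (Filter.Eventually.of_forall fun r => by
    have := h r i j
    rwa [zpow_neg, zpow_natCast, ← inv_pow] at this)
  simpa using h1

theorem mul_mem_matBall {r s : ℕ} {A B : Matrix (Fin m) (Fin m) ℚ_[p]} (hA : A ∈ matBall p m r)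
    (hB : B ∈ matBall p m s) : A * B ∈ matBall p m (r + s) := fun i j => by
  have hp : (0 : ℝ) < p := by exact_mod_cast (Fact.out : p.Prime).pos
  rw [Matrix.mul_apply]
  refine IsUltrametricDist.norm_sum_le_of_forall_le_of_nonneg (by positivity) fun k _ => ?_
  rw [norm_mul, Nat.cast_add, neg_add, zpow_add₀ hp.ne']
  exact mul_le_mul (hA i k) (hB k j) (norm_nonneg _) (by positivity)

theorem one_mem_matBall : (1 : Matrix (Fin m) (Fin m) ℚ_[p]) ∈ matBall p m 0 := fun i j => by
  rw [Matrix.one_apply]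
  split_ifs <;> simp

theorem pow_mem_matBall {s : ℕ} {A : Matrix (Fin m) (Fin m) ℚ_[p]} (hA : A ∈ matBall p m s)
    (j : ℕ) : A ^ j ∈ matBall p m (j * s) := by
  induction j with
  | zero => simpa using one_mem_matBall
  | succ j ih =>
    rw [pow_succ, add_mul, one_mul]
    exact mul_mem_matBall ih hA

theorem smul_mem_matBall {r : ℕ} {c : ℚ_[p]} (hc : ‖c‖ ≤ 1) {A : Matrix (Fin m) (Fin m) ℚ_[p]}
    (hA : A ∈ matBall p m r) : c • A ∈ matBall p m r := fun i j => by
  rw [Matrix.smul_apply, smul_eq_mul, norm_mul]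
  exact (mul_le_of_le_one_left (norm_nonneg _) hc).trans (hA i j)

theorem pow_smul_mem_matBall_iff {r n : ℕ} {A : Matrix (Fin m) (Fin m) ℚ_[p]} :
    (p : ℚ_[p]) ^ n • A ∈ matBall p m (r + n) ↔ A ∈ matBall p m r := by
  have hp : (0 : ℝ) < p := by exact_mod_cast (Fact.out : p.Prime).pos
  refine forall_congr' fun i => forall_congr' fun j => ?_
  rw [Matrix.smul_apply, smul_eq_mul, norm_mul, norm_pow, Padic.norm_p, Nat.cast_add, neg_add,
    zpow_add₀ hp.ne', mul_comm, inv_pow, zpow_neg _ (n : ℤ), zpow_natCast]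
  exact mul_le_mul_iff_of_pos_right (by positivity)

theorem natCast_smul_mem_matBall {r : ℕ} {c : ℕ} (hc : p ∣ c)
    {A : Matrix (Fin m) (Fin m) ℚ_[p]} (hA : A ∈ matBall p m r) :
    (c : ℚ_[p]) • A ∈ matBall p m (r + 1) := by
  obtain ⟨d, rfl⟩ := hc
  rw [Nat.cast_mul, mul_smul]
  have := pow_smul_mem_matBall_iff (p := p) (n := 1).2
    (smul_mem_matBall (c := (d : ℚ_[p])) (by simpa using Padic.norm_int_le_one (p := p) (d : ℤ)) hA)
  rwa [pow_one] at this

theorem pow_sub_pow_mem_matBall {r s : ℕ} {A B : Matrix (Fin m) (Fin m) ℚ_[p]}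
    (hA : A ∈ matBall p m s) (hB : B ∈ matBall p m s) (hAB : A - B ∈ matBall p m r) (j : ℕ) :
    A ^ (j + 1) - B ^ (j + 1) ∈ matBall p m (r + j * s) := by
  induction j with
  | zero => simpa using hAB
  | succ j ih =>
    have e : A ^ (j + 1 + 1) - B ^ (j + 1 + 1) =
        A * (A ^ (j + 1) - B ^ (j + 1)) + (A - B) * B ^ (j + 1) := by
      rw [pow_succ' A (j + 1), pow_succ' B (j + 1)]
      noncomm_ring
    rw [e]
    refine add_mem ?_ (mul_mem_matBall hAB (pow_mem_matBall hB _))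
    have := mul_mem_matBall hA ih
    rwa [show r + (j + 1) * s = s + (r + j * s) by ring]

/-- The `p`-th power map on `1 + p ^ s M_m(ℤ_p)` is close to multiplication by `p` on
differences. -/
theorem pow_prime_sub_mem_matBall (hp : p ≠ 2) {r s : ℕ} (hs : 1 ≤ s)
    {x y : Matrix (Fin m) (Fin m) ℚ_[p]} (hx : x - 1 ∈ matBall p m s) (hy : y - 1 ∈ matBall p m s)
    (hxy : x - y ∈ matBall p m r) :
    x ^ p - y ^ p - (p : ℚ_[p]) • (x - y) ∈ matBall p m (r + s + 1) := by
  have hpp : p.Prime := Fact.out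
  have hexp : ∀ z : Matrix (Fin m) (Fin m) ℚ_[p],
      z ^ p = ∑ j ∈ Finset.range (p + 1), ((p.choose j : ℕ) : ℚ_[p]) • (z - 1) ^ j := by
    intro z
    have := (Commute.one_right (z - 1)).add_pow p
    rw [sub_add_cancel] at this
    rw [this]
    refine Finset.sum_congr rfl fun j _ => ?_
    rw [one_pow, mul_one, ← nsmul_eq_mul', Nat.cast_smul_eq_nsmul]
  have h2 : 2 < p := lt_of_le_of_ne hpp.two_le (Ne.symm hp)
  have e : x ^ p - y ^ p - (p : ℚ_[p]) • (x - y) =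
      ∑ j ∈ Finset.range (p - 1), ((p.choose (j + 2) : ℕ) : ℚ_[p]) •
        ((x - 1) ^ (j + 2) - (y - 1) ^ (j + 2)) := by
    rw [hexp x, hexp y, ← Finset.sum_sub_distrib, show p + 1 = (p - 1) + 1 + 1 by omega,
      Finset.sum_range_succ', Finset.sum_range_succ']
    simp only [← smul_sub, pow_zero, sub_self, add_zero, zero_add, pow_one,
      Nat.choose_one_right, sub_sub_sub_cancel_right, add_sub_cancel_right]
  rw [e]
  refine sum_mem fun j hj => ?_
  have hj' := Finset.mem_range.1 hj
  have h3 := pow_sub_pow_mem_matBall hx hy (r := r) (by simpa using hxy) (j + 1)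
  by_cases hjp : j + 2 = p
  · rw [hjp, Nat.choose_self, Nat.cast_one, one_smul]
    rw [show j + 1 + 1 = p from hjp] at h3
    refine matBall_mono ?_ h3
    -- this term has coefficient `1`, but `p ≥ 3` gives it `p - 1 ≥ 2` further factors in
    -- `p ^ s M_m(ℤ_p)`
    have : 1 ≤ j := by omega
    nlinarith
  · refine matBall_mono ?_ (natCast_smul_mem_matBall
      (hpp.dvd_choose_self (by omega) (by omega)) h3)
    nlinarith

theorem pow_prime_sub_pow_mem_matBall (hp : p ≠ 2) {r s : ℕ} (hs : 1 ≤ s)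
    {x y : Matrix (Fin m) (Fin m) ℚ_[p]} (hx : x - 1 ∈ matBall p m s) (hy : y - 1 ∈ matBall p m s)
    (hxy : x - y ∈ matBall p m r) : x ^ p - y ^ p ∈ matBall p m (r + 1) := by
  have h1 := pow_prime_sub_mem_matBall hp hs hx hy hxy
  have h2 := natCast_smul_mem_matBall (dvd_refl p) hxy
  have h3 := add_mem (matBall_mono (by omega) h1) h2
  rwa [sub_add_cancel] at h3

theorem pow_prime_sub_one_mem_matBall (hp : p ≠ 2) {s : ℕ} (hs : 1 ≤ s)
    {x : Matrix (Fin m) (Fin m) ℚ_[p]} (hx : x - 1 ∈ matBall p m s) :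
    x ^ p - 1 ∈ matBall p m (s + 1) := by
  have := pow_prime_sub_pow_mem_matBall hp hs hx (y := 1) (by rw [sub_self]; exact zero_mem _) hx
  rwa [one_pow] at this

theorem pow_prime_pow_sub_one_mem_matBall (hp : p ≠ 2) {s : ℕ} (hs : 1 ≤ s)
    {x : Matrix (Fin m) (Fin m) ℚ_[p]} (hx : x - 1 ∈ matBall p m s) (n : ℕ) :
    x ^ p ^ n - 1 ∈ matBall p m (s + n) := by
  induction n with
  | zero => simpa using hx
  | succ n ih =>
    rw [pow_succ, pow_mul]
    exact pow_prime_sub_one_mem_matBall hp (s := s + n) (by omega) ih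

theorem pow_prime_pow_sub_pow_mem_matBall (hp : p ≠ 2) {r s : ℕ} (hs : 1 ≤ s)
    {x y : Matrix (Fin m) (Fin m) ℚ_[p]} (hx : x - 1 ∈ matBall p m s) (hy : y - 1 ∈ matBall p m s)
    (hxy : x - y ∈ matBall p m r) (n : ℕ) : x ^ p ^ n - y ^ p ^ n ∈ matBall p m (r + n) := by
  induction n with
  | zero => simpa using hxy
  | succ n ih =>
    rw [pow_succ, pow_mul, pow_mul]
    exact pow_prime_sub_pow_mem_matBall hp (s := s + n) (by omega)
      (pow_prime_pow_sub_one_mem_matBall hp hs hx n)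
      (pow_prime_pow_sub_one_mem_matBall hp hs hy n) ih

/-- The difference quotients `(x ^ (p ^ n) - 1) / p ^ n`, which converge to `log x`. -/
noncomputable def logApprox (n : ℕ) (x : Matrix (Fin m) (Fin m) ℚ_[p]) :
    Matrix (Fin m) (Fin m) ℚ_[p] :=
  ((p : ℚ_[p]) ^ n)⁻¹ • (x ^ p ^ n - 1)

/-- For `x`, `y` congruent modulo `p ^ r`, the difference of their difference quotients is congruent
to `x - y` modulo `p ^ (r + s)`, uniformly in `n`. -/
theorem logApprox_sub_mem_matBall (hp : p ≠ 2) {r s : ℕ} (hs : 1 ≤ s)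
    {x y : Matrix (Fin m) (Fin m) ℚ_[p]} (hx : x - 1 ∈ matBall p m s) (hy : y - 1 ∈ matBall p m s)
    (hxy : x - y ∈ matBall p m r) (n : ℕ) :
    logApprox n x - logApprox n y - (x - y) ∈ matBall p m (r + s) := by
  have hp0 : (p : ℚ_[p]) ≠ 0 := by exact_mod_cast (Fact.out : p.Prime).ne_zero
  induction n with
  | zero =>
    simp only [logApprox, pow_zero, inv_one, one_smul, pow_one, sub_sub_sub_cancel_right, sub_self]
    exact zero_mem _
  | succ n ih =>
    have h1 := pow_prime_sub_mem_matBall hp (s := s + n) (r := r + n) (by omega)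
      (pow_prime_pow_sub_one_mem_matBall hp hs hx n)
      (pow_prime_pow_sub_one_mem_matBall hp hs hy n)
      (pow_prime_pow_sub_pow_mem_matBall hp hs hx hy hxy n)
    have e : (p : ℚ_[p]) ^ (n + 1) • ((logApprox (n + 1) x - logApprox (n + 1) y) -
        (logApprox n x - logApprox n y)) = (x ^ p ^ n) ^ p - (y ^ p ^ n) ^ p -
          (p : ℚ_[p]) • (x ^ p ^ n - y ^ p ^ n) := by
      simp only [logApprox, ← smul_sub, sub_sub_sub_cancel_right]
      rw [smul_sub, smul_smul, smul_smul, mul_inv_cancel₀ (pow_ne_zero _ hp0), one_smul,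
        pow_succ (p : ℚ_[p]), mul_right_comm, mul_inv_cancel₀ (pow_ne_zero _ hp0), one_mul,
        pow_succ p, pow_mul, pow_mul]
    rw [← e] at h1
    have h2 : (logApprox (n + 1) x - logApprox (n + 1) y) - (logApprox n x - logApprox n y) ∈
        matBall p m (r + s) := by
      rw [← pow_smul_mem_matBall_iff (n := n + 1)]
      exact matBall_mono (by omega) h1
    have := add_mem h2 ih
    rwa [sub_add_sub_cancel] at this

end MatrixBall

/-! ### The matrix logarithm as a limit of difference quotients -/

section LogLimit

variable {p : ℕ} [Fact p.Prime] {m : ℕ}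

/-- The binomial coefficients of `p ^ n - 1` converge `p`-adically to those of `-1`. -/
theorem tendsto_choose_prime_pow_sub_one (j : ℕ) :
    Filter.Tendsto (fun n : ℕ => (((p ^ n - 1).choose j : ℕ) : ℚ_[p])) Filter.atTop
      (nhds ((-1) ^ j)) := by
  have hpp : p.Prime := Fact.out
  induction j with
  | zero => simp
  | succ j ih =>
    have h1 : Filter.Tendsto (fun n : ℕ => (((p ^ n).choose (j + 1) : ℕ) : ℚ_[p])) Filter.atTop
        (nhds 0) := by
      have h2 : Filter.Tendsto (fun n : ℕ => (p : ℚ_[p]) ^ n) Filter.atTop (nhds 0) :=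
        tendsto_pow_atTop_nhds_zero_of_norm_lt_one Padic.norm_p_lt_one
      have h3 := (h2.mul ih).div_const ((j + 1 : ℕ) : ℚ_[p])
      rw [zero_mul, zero_div] at h3
      refine h3.congr fun n => ?_
      rw [div_eq_iff (by exact_mod_cast Nat.succ_ne_zero j)]
      have h4 := Nat.add_one_mul_choose_eq (p ^ n - 1) j
      rw [Nat.sub_add_cancel (Nat.one_le_pow _ _ hpp.pos)] at h4
      exact_mod_cast h4
    have h5 := h1.sub ih
    rw [zero_sub, ← neg_one_mul, ← pow_succ'] at h5
    refine h5.congr fun n => ?_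
    have h6 : (p ^ n).choose (j + 1) = (p ^ n - 1).choose j + (p ^ n - 1).choose (j + 1) := by
      have := Nat.choose_succ_succ (p ^ n - 1) j
      rwa [Nat.succ_eq_add_one, Nat.sub_add_cancel (Nat.one_le_pow _ _ hpp.pos)] at this
    rw [h6]
    push_cast
    ring

theorem norm_inv_natCast_add_one_le (k : ℕ) : ‖((k : ℚ_[p]) + 1)⁻¹‖ ≤ k + 1 := by
  have hpp : p.Prime := Fact.out
  have h1 : ((k : ℚ_[p]) + 1) = ((k + 1 : ℕ) : ℚ_[p]) := by push_cast; ring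
  have h0 : ((k + 1 : ℕ) : ℚ_[p]) ≠ 0 := by exact_mod_cast Nat.succ_ne_zero k
  rw [h1, norm_inv, Padic.norm_eq_zpow_neg_valuation h0, Padic.valuation_natCast, ← zpow_neg,
    neg_neg, zpow_natCast]
  exact_mod_cast Nat.le_of_dvd (Nat.succ_pos k) pow_padicValNat_dvd

/-- The domination of the terms of the logarithm series, for any integral numerators `c`. -/
theorem norm_log_term_le {A : Matrix (Fin m) (Fin m) ℚ_[p]} (hA : A ∈ matBall p m 1) {c : ℚ_[p]}
    (hc : ‖c‖ ≤ 1) (i j : Fin m) (k : ℕ) :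
    ‖c / (k + 1) * (A ^ (k + 1)) i j‖ ≤ (k + 1) * ((p : ℝ)⁻¹ * (p : ℝ)⁻¹ ^ k) := by
  rw [norm_mul, div_eq_mul_inv, norm_mul, ← pow_succ']
  have h1 := pow_mem_matBall hA (k + 1) i j
  rw [mul_one, zpow_neg, zpow_natCast, ← inv_pow] at h1
  refine mul_le_mul ?_ h1 (norm_nonneg _) (by positivity)
  exact (mul_le_of_le_one_left (norm_nonneg _) hc).trans (norm_inv_natCast_add_one_le k)

theorem summable_log_bound :
    Summable fun k : ℕ => ((k : ℝ) + 1) * ((p : ℝ)⁻¹ * (p : ℝ)⁻¹ ^ k) := by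
  have hp : (1 : ℝ) < p := by exact_mod_cast (Fact.out : p.Prime).one_lt
  have hlt : ‖(p : ℝ)⁻¹‖ < 1 := by
    rw [Real.norm_of_nonneg (by positivity)]
    exact inv_lt_one_of_one_lt₀ hp
  have h1 := summable_pow_mul_geometric_of_norm_lt_one 1 hlt
  have h2 := summable_geometric_of_norm_lt_one hlt
  refine ((h1.add h2).mul_left (p : ℝ)⁻¹).congr fun k => ?_
  simp only [pow_one]
  ring

theorem hasSum_log {A : Matrix (Fin m) (Fin m) ℚ_[p]} (hA : A ∈ matBall p m 1) :
    HasSum (fun n : ℕ => ((-1 : ℚ_[p]) ^ n / (n + 1)) • A ^ (n + 1))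
      (Matrix.of fun i j => ∑' n : ℕ, (-1 : ℚ_[p]) ^ n / (n + 1) * (A ^ (n + 1)) i j) := by
  refine Pi.hasSum.2 fun i => Pi.hasSum.2 fun j => ?_
  refine (Summable.of_norm_bounded (summable_log_bound (p := p)) fun k => ?_).hasSum
  exact norm_log_term_le hA (by simp) i j k

/-- The logarithm series of `x` is the limit of `(x ^ (p ^ n) - 1) / p ^ n`: the binomial
expansion of the latter has coefficients converging to those of the series. -/
theorem tendsto_logApprox {x : Matrix (Fin m) (Fin m) ℚ_[p]} (hx : x - 1 ∈ matBall p m 1) :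
    Filter.Tendsto (fun n => logApprox n x) Filter.atTop
      (nhds (∑' n : ℕ, ((-1 : ℚ_[p]) ^ n / (n + 1)) • (x - 1) ^ (n + 1))) := by
  have hpp : p.Prime := Fact.out
  have hp0 : (p : ℚ_[p]) ≠ 0 := by exact_mod_cast hpp.ne_zero
  rw [(hasSum_log hx).tsum_eq]
  refine tendsto_pi_nhds.2 fun i => tendsto_pi_nhds.2 fun j => ?_
  have h1 := tendsto_tsum_of_dominated_convergence (𝓕 := Filter.atTop)
    (f := fun (n k : ℕ) => (((p ^ n - 1).choose k : ℕ) : ℚ_[p]) / (k + 1) *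
      ((x - 1) ^ (k + 1)) i j) (summable_log_bound (p := p))
    (fun k => ((tendsto_choose_prime_pow_sub_one k).div_const ((k : ℚ_[p]) + 1)).mul_const
      (((x - 1) ^ (k + 1)) i j))
    (Filter.Eventually.of_forall fun n k => norm_log_term_le hx
      (by simpa using Padic.norm_int_le_one (p := p) (((p ^ n - 1).choose k : ℕ) : ℤ)) i j k)
  refine h1.congr fun n => ?_
  have hq : 1 ≤ p ^ n := Nat.one_le_pow _ _ hpp.pos
  have hexp : x ^ p ^ n - 1 =
      ∑ k ∈ Finset.range (p ^ n), (((p ^ n).choose (k + 1) : ℕ) : ℚ_[p]) • (x - 1) ^ (k + 1) := by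
    have h2 := (Commute.one_right (x - 1)).add_pow (p ^ n)
    rw [sub_add_cancel, Finset.sum_range_succ'] at h2
    simp only [one_pow, mul_one, pow_zero, Nat.choose_zero_right, Nat.cast_one] at h2
    rw [h2, add_sub_cancel_right]
    refine Finset.sum_congr rfl fun k _ => ?_
    rw [← nsmul_eq_mul', Nat.cast_smul_eq_nsmul]
  rw [tsum_eq_sum (s := Finset.range (p ^ n)), logApprox, hexp, Finset.smul_sum, Matrix.sum_apply]
  · refine Finset.sum_congr rfl fun k _ => ?_
    rw [Matrix.smul_apply, Matrix.smul_apply, smul_eq_mul, smul_eq_mul, ← mul_assoc]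
    congr 1
    have hk : ((k : ℚ_[p]) + 1) ≠ 0 := by exact_mod_cast Nat.succ_ne_zero k
    have h4 := Nat.add_one_mul_choose_eq (p ^ n - 1) k
    rw [Nat.sub_add_cancel hq] at h4
    have h5 : (p : ℚ_[p]) ^ n * ((p ^ n - 1).choose k : ℕ) =
        ((p ^ n).choose (k + 1) : ℕ) * ((k : ℚ_[p]) + 1) := by exact_mod_cast h4
    rw [div_eq_iff hk, mul_assoc, ← h5, inv_mul_cancel_left₀ (pow_ne_zero _ hp0)]
  · intro k hk
    have : (p ^ n - 1).choose k = 0 := Nat.choose_eq_zero_of_lt (by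
      have := Finset.mem_range.not.1 hk
      omega)
    simp [this]

theorem toQp_sub_one_mem_matBall {x : GL (Fin m) ℤ_[p]} (hx : x ∈ glOne p m) :
    toQp x - 1 ∈ matBall p m 1 := by
  intro i j
  have hx1 : Matrix.GeneralLinearGroup.map (n := Fin m) (PadicInt.toZMod (p := p)) x = 1 := hx
  have h1 : PadicInt.toZMod ((x : Matrix (Fin m) (Fin m) ℤ_[p]) i j) =
      (1 : Matrix (Fin m) (Fin m) (ZMod p)) i j := by
    rw [← Units.val_one, ← hx1]; rfl
  have h2 : PadicInt.toZMod ((x : Matrix (Fin m) (Fin m) ℤ_[p]) i j - (1 : Matrix _ _ ℤ_[p]) i j)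
      = 0 := by
    rw [map_sub, sub_eq_zero, h1, Matrix.one_apply, Matrix.one_apply]
    split_ifs <;> simp
  have h3 : (x : Matrix (Fin m) (Fin m) ℤ_[p]) i j - (1 : Matrix _ _ ℤ_[p]) i j ∈
      RingHom.ker (PadicInt.toZMod (p := p)) := h2
  rw [PadicInt.ker_toZMod, PadicInt.maximalIdeal_eq_span_p, ← pow_one (p : ℤ_[p]),
    ← PadicInt.norm_le_pow_iff_mem_span_pow] at h3
  have h4 : (toQp x - 1) i j = (((x : Matrix (Fin m) (Fin m) ℤ_[p]) i j -
      (1 : Matrix _ _ ℤ_[p]) i j : ℤ_[p]) : ℚ_[p]) := by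
    rw [Matrix.sub_apply, Matrix.one_apply, Matrix.one_apply]
    split_ifs <;> simp [toQp]
  rw [h4]
  exact h3

theorem toQp_pow (x : GL (Fin m) ℤ_[p]) (n : ℕ) : toQp (x ^ n) = toQp x ^ n := by
  induction n with
  | zero => rw [pow_zero, pow_zero, toQp_one]
  | succ n ih => rw [pow_succ, pow_succ, toQp_mul, ih]

theorem toQp_injective : Function.Injective (toQp : GL (Fin m) ℤ_[p] → _) := by
  intro x y h
  refine Units.ext (Matrix.ext fun i j => ?_)
  exact PadicInt.ext (congrFun (congrFun h i) j)

theorem continuous_toQp : Continuous (toQp : GL (Fin m) ℤ_[p] → _) :=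
  Units.continuous_val.matrix_map continuous_subtype_val

theorem tendsto_matLog {x : GL (Fin m) ℤ_[p]} (hx : x ∈ glOne p m) :
    Filter.Tendsto (fun n => logApprox n (toQp x)) Filter.atTop (nhds (matLog x)) :=
  tendsto_logApprox (toQp_sub_one_mem_matBall hx)

theorem matLog_one : matLog (1 : GL (Fin m) ℤ_[p]) = 0 := by
  simp [matLog, toQp_one]

theorem matLog_pow_prime {x : GL (Fin m) ℤ_[p]} (hx : x ∈ glOne p m) :
    matLog (x ^ p) = (p : ℚ_[p]) • matLog x := by
  have hp0 : (p : ℚ_[p]) ≠ 0 := by exact_mod_cast (Fact.out : p.Prime).ne_zero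
  refine tendsto_nhds_unique (tendsto_matLog (pow_mem hx p)) ?_
  refine (((tendsto_matLog hx).comp (Filter.tendsto_add_atTop_nat 1)).const_smul
    (p : ℚ_[p])).congr fun n => ?_
  rw [Function.comp_apply, logApprox, logApprox, toQp_pow, ← pow_mul, ← pow_succ', smul_smul,
    pow_succ', mul_inv, mul_inv_cancel_left₀ hp0]

theorem matLog_pow_prime_pow {x : GL (Fin m) ℤ_[p]} (hx : x ∈ glOne p m) (n : ℕ) :
    matLog (x ^ p ^ n) = (p : ℚ_[p]) ^ n • matLog x := by
  induction n with
  | zero => simp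
  | succ n ih => rw [pow_succ, pow_mul, matLog_pow_prime (pow_mem hx _), ih, smul_smul, pow_succ']

theorem matLog_sub_mem_matBall (hp : p ≠ 2) {r s : ℕ} (hs : 1 ≤ s) {x y : GL (Fin m) ℤ_[p]}
    (hx : toQp x - 1 ∈ matBall p m s) (hy : toQp y - 1 ∈ matBall p m s)
    (hxy : toQp x - toQp y ∈ matBall p m r) :
    matLog x - matLog y - (toQp x - toQp y) ∈ matBall p m (r + s) := by
  refine (isClosed_matBall (r + s)).mem_of_tendsto
    (((tendsto_logApprox (matBall_mono hs hx)).sub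
      (tendsto_logApprox (matBall_mono hs hy))).sub_const _)
    (Filter.Eventually.of_forall fun n => logApprox_sub_mem_matBall hp hs hx hy hxy n)

theorem matLog_injOn (hp : p ≠ 2) : Set.InjOn (matLog (p := p) (m := m)) (glOne p m) := by
  intro x hx y hy hxy
  have hx' := toQp_sub_one_mem_matBall hx
  have hy' := toQp_sub_one_mem_matBall hy
  refine toQp_injective (sub_eq_zero.1 (eq_zero_of_forall_mem_matBall fun r => ?_))
  induction r with
  | zero =>
    have := sub_mem hx' hy'
    rw [sub_sub_sub_cancel_right] at this
    exact matBall_mono (by omega) this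
  | succ r ih =>
    have := matLog_sub_mem_matBall hp le_rfl hx' hy' ih
    rw [hxy, sub_self, zero_sub] at this
    exact neg_mem_iff.1 this

theorem exists_matBall_subset {U : Set (Matrix (Fin m) (Fin m) ℚ_[p])} (hU : U ∈ nhds 0) :
    ∃ r, (matBall p m r : Set (Matrix (Fin m) (Fin m) ℚ_[p])) ⊆ U := by
  have hp : (1 : ℝ) < p := by exact_mod_cast (Fact.out : p.Prime).one_lt
  obtain ⟨ε, hε, hεU⟩ := (Metric.mem_nhds_iff (x := (0 : Fin m → Fin m → ℚ_[p]))).1 hU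
  obtain ⟨r, hr⟩ := exists_pow_lt_of_lt_one hε (inv_lt_one_of_one_lt₀ hp)
  refine ⟨r, fun A hA => hεU ?_⟩
  refine (dist_pi_lt_iff hε).2 fun i => (dist_pi_lt_iff hε).2 fun j => ?_
  refine lt_of_le_of_lt ?_ hr
  have := hA i j
  rw [zpow_neg, zpow_natCast, ← inv_pow] at this
  simpa using this

theorem continuousOn_matLog (hp : p ≠ 2) :
    ContinuousOn (matLog (p := p) (m := m)) (glOne p m) := by
  intro y hy
  have hy' := toQp_sub_one_mem_matBall hy
  suffices h : Filter.Tendsto (fun x => matLog x - matLog y)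
      (nhdsWithin y (glOne p m)) (nhds 0) by
    have := h.add_const (matLog y)
    simp only [sub_add_cancel, zero_add] at this
    exact this
  intro U hU
  obtain ⟨r, hr⟩ := exists_matBall_subset hU
  have h1 : Filter.Tendsto (fun x => toQp x - toQp y) (nhdsWithin y (glOne p m)) (nhds 0) := by
    have := ((continuous_toQp (p := p) (m := m)).tendsto y).sub_const (toQp y)
    rw [sub_self] at this
    exact this.mono_left nhdsWithin_le_nhds
  rw [Filter.mem_map]
  filter_upwards [h1 (matBall_mem_nhds r), self_mem_nhdsWithin] with x hx hxG
  have h2 := matLog_sub_mem_matBall hp le_rfl (toQp_sub_one_mem_matBall hxG) hy' hx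
  have h3 := add_mem (matBall_mono (by omega) h2) hx
  rw [sub_add_cancel] at h3
  exact hr h3

end LogLimit

/-! ### The descending `p`-central series -/

section LowerSeries
open scoped commutatorElement

variable {p : ℕ} {H : Type*} [Group H] [TopologicalSpace H] [IsTopologicalGroup H]

theorem isClosed_lowerP (n : ℕ) : IsClosed (lowerP p H n : Set H) := by
  cases n with
  | zero => exact isClosed_univ
  | succ n => exact isClosed_powComm _

theorem lowerP_succ_le (n : ℕ) : lowerP p H (n + 1) ≤ lowerP p H n := by
  refine powComm_le (isClosed_lowerP n) (fun x hx => pow_mem hx p) fun x y hy => ?_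
  rw [commutatorElement_def]
  exact mul_mem ((lowerP_normal (p := p) n).conj_mem y hy x) (inv_mem hy)

theorem lowerP_antitone : Antitone (lowerP p H) := antitone_nat_of_succ_le lowerP_succ_le

theorem pow_mem_lowerP_succ {n : ℕ} {x : H} (hx : x ∈ lowerP p H n) :
    x ^ p ∈ lowerP p H (n + 1) := pow_mem_powComm p hx

theorem pow_prime_pow_mem_lowerP (x : H) (n : ℕ) : x ^ p ^ n ∈ lowerP p H n := by
  induction n with
  | zero => exact Subgroup.mem_top _
  | succ n ih =>
    rw [pow_succ, pow_mul]
    exact pow_mem_lowerP_succ ih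

/-- The `n`-th power of a product whose commutator `c` is central. -/
theorem mul_pow_of_commutes {L : Type*} [Group L] {x z c : L} (hzx : z * x = x * z * c)
    (hc : ∀ y, c * y = y * c) (n : ℕ) : (x * z) ^ n = x ^ n * z ^ n * c ^ n.choose 2 := by
  have hcn : ∀ (j : ℕ) (y : L), c ^ j * y = y * c ^ j := fun j y =>
    (Commute.pow_left (show Commute c y from hc y) j).eq
  have h1 : ∀ j : ℕ, z ^ j * x = x * z ^ j * c ^ j := by
    intro j
    induction j with
    | zero => simp
    | succ j ih =>
      rw [pow_succ z, mul_assoc, hzx, ← mul_assoc, ← mul_assoc, ih, pow_succ c]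
      simp only [mul_assoc]
      rw [← mul_assoc (c ^ j) z, hcn, mul_assoc]
  induction n with
  | zero => simp
  | succ n ih =>
    rw [pow_succ (x * z), ih, Nat.choose_succ_succ' n 1, Nat.choose_one_right, pow_add c]
    calc x ^ n * z ^ n * c ^ n.choose 2 * (x * z)
        = x ^ n * (z ^ n * x) * z * c ^ n.choose 2 := by
          rw [mul_assoc, hcn]; simp only [mul_assoc]
      _ = x ^ (n + 1) * z ^ (n + 1) * (c ^ n * c ^ n.choose 2) := by
          rw [h1, pow_succ x, pow_succ z]
          simp only [mul_assoc]
          rw [← mul_assoc (c ^ n) z, hcn, mul_assoc]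

/-- For odd `p`, the commutator terms in `(x z) ^ p` lie two steps further down the series. -/
theorem mul_pow_prime_congr [Fact p.Prime] (hp : p ≠ 2) {j : ℕ} (x : H) {z : H}
    (hz : z ∈ lowerP p H j) : ((x * z) ^ p)⁻¹ * (x ^ p * z ^ p) ∈ lowerP p H (j + 2) := by
  rw [← QuotientGroup.eq]
  let mk := QuotientGroup.mk' (lowerP p H (j + 2))
  have hmem : ∀ {a}, a ∈ lowerP p H (j + 2) → mk a = 1 := fun ha =>
    (QuotientGroup.eq_one_iff _).2 ha
  let c := ⁅z⁻¹, x⁻¹⁆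
  have hc : c ∈ lowerP p H (j + 1) := by
    have := inv_mem (commutator_mem_powComm (p := p) x⁻¹ (inv_mem hz))
    rwa [commutatorElement_inv] at this
  have hcp : mk c ^ p = 1 := by
    rw [← map_pow]
    exact hmem (pow_mem_lowerP_succ hc)
  have h2 : p ∣ p.choose 2 := by
    have hpp : p.Prime := Fact.out
    exact hpp.dvd_choose_self (by norm_num) (lt_of_le_of_ne hpp.two_le (Ne.symm hp))
  change mk ((x * z) ^ p) = mk (x ^ p * z ^ p)
  rw [map_pow, map_mul, mul_pow_of_commutes (c := mk c), map_mul, map_pow, map_pow]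
  · obtain ⟨d, hd⟩ := h2
    rw [hd, pow_mul, hcp, one_pow, mul_one]
  · rw [← map_mul, ← map_mul, ← map_mul]
    congr 1
    simp only [c, commutatorElement_def]
    group
  · intro y
    obtain ⟨y, rfl⟩ := QuotientGroup.mk'_surjective _ y
    have := hmem (commutator_mem_powComm (p := p) y hc)
    rw [map_commutatorElement, commutatorElement_eq_one_iff_mul_comm] at this
    exact this.symm

end LowerSeries

/-! ### Power maps on uniform groups -/

section Uniform
open scoped commutatorElement

variable {p : ℕ} {H : Type*} [Group H] [TopologicalSpace H] [IsTopologicalGroup H]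

/-- Surjectivity of `H_n / H_{n+1} → H_{n+1} / H_{n+2}`. -/
theorem IsUniform.exists_pow_congr (h : IsUniform p H) {n : ℕ} {y : H}
    (hy : y ∈ lowerP p H (n + 1)) : ∃ x ∈ lowerP p H n, (x ^ p)⁻¹ * y ∈ lowerP p H (n + 2) := by
  obtain ⟨α, hα⟩ := h.pow_iso n
  obtain ⟨x, hx⟩ := α.surjective (QuotientGroup.mk ⟨y, hy⟩)
  obtain ⟨x, rfl⟩ := QuotientGroup.mk_surjective x
  rw [hα] at hx
  have hx' := QuotientGroup.eq.1 hx
  exact ⟨x, x.2, hx'⟩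

/-- The maps `x ↦ x ^ (p ^ n)` are homomorphisms modulo `H_{n+2}`, and induce injective maps
`H / H_2 → H_{n+1} / H_{n+2}`: they are composites of the isomorphisms of the definition. -/
theorem IsUniform.exists_powHom (h : IsUniform p H) (n : ℕ) :
    ∃ β : H →* H ⧸ lowerP p H (n + 1), (∀ x : H, β x = ((x ^ p ^ n : H) : H ⧸ lowerP p H (n + 1))) ∧
      β.ker = lowerP p H 1 := by
  induction n with
  | zero =>
    refine ⟨QuotientGroup.mk' _, fun x => ?_, QuotientGroup.ker_mk' _⟩
    rw [pow_zero, pow_one]; rfl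
  | succ n ih =>
    obtain ⟨β, hβ, hker⟩ := ih
    obtain ⟨α, hα⟩ := h.pow_iso n
    have key : ∀ {u v w : H}, u ∈ lowerP p H n → v ∈ lowerP p H n → w ∈ lowerP p H n →
        (u : H ⧸ lowerP p H (n + 1)) = v * w →
        ((u ^ p : H) : H ⧸ lowerP p H (n + 2)) = (v ^ p : H) * (w ^ p : H) := by
      intro u v w hu hv hw huvw
      have h1 : (QuotientGroup.mk (⟨u, hu⟩ : lowerP p H n) :
          lowerP p H n ⧸ (lowerP p H (n + 1)).subgroupOf (lowerP p H n)) =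
          QuotientGroup.mk ⟨v, hv⟩ * QuotientGroup.mk ⟨w, hw⟩ := by
        rw [← QuotientGroup.mk_mul] at huvw ⊢
        have h3 := QuotientGroup.eq.1 huvw
        exact QuotientGroup.eq.2 h3
      have h2 := congrArg α h1
      rw [map_mul, hα, hα, hα, ← QuotientGroup.mk_mul] at h2
      rw [← QuotientGroup.mk_mul]
      have h3 := QuotientGroup.eq.1 h2
      exact QuotientGroup.eq.2 h3
    refine ⟨MonoidHom.mk' (fun x => ((x ^ p ^ (n + 1) : H) : H ⧸ lowerP p H (n + 2))) ?_,
      fun x => rfl, ?_⟩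
    · intro x y
      simp only [pow_succ p n, pow_mul]
      refine key (pow_prime_pow_mem_lowerP _ n) (pow_prime_pow_mem_lowerP _ n)
        (pow_prime_pow_mem_lowerP _ n) ?_
      rw [← hβ, ← hβ, ← hβ, map_mul]
    · ext x
      rw [← hker, MonoidHom.mem_ker, MonoidHom.mem_ker, hβ]
      change ((x ^ p ^ (n + 1) : H) : H ⧸ lowerP p H (n + 2)) = 1 ↔ _
      rw [QuotientGroup.eq_one_iff, QuotientGroup.eq_one_iff, pow_succ p n, pow_mul]
      refine ⟨fun hx => ?_, fun hx => pow_mem_lowerP_succ hx⟩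
      have hm := pow_prime_pow_mem_lowerP (p := p) x n
      have h1 : α (QuotientGroup.mk ⟨_, hm⟩) = 1 := by
        rw [hα, QuotientGroup.eq_one_iff]
        exact hx
      rw [map_eq_one_iff α α.injective, QuotientGroup.eq_one_iff] at h1
      exact h1

variable [Fact p.Prime]

/-- In a uniform group with trivial `⋂ H_n`, every element of `H_{n+1}` is a `p`-th power of one
of `H_n`: successive approximation, together with compactness. -/
theorem IsUniform.exists_pow_eq (hp : p ≠ 2) (h : IsUniform p H)
    (hbot : ∀ x : H, (∀ n, x ∈ lowerP p H n) → x = 1) {n : ℕ} {y : H}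
    (hy : y ∈ lowerP p H (n + 1)) : ∃ x ∈ lowerP p H n, x ^ p = y := by
  have := h.isProP.compact
  let t : ℕ → Set H := fun j => {x | x ∈ lowerP p H n ∧ (x ^ p)⁻¹ * y ∈ lowerP p H (n + 1 + j)}
  have hcl : ∀ j, IsClosed (t j) := fun j => (isClosed_lowerP n).inter
    ((isClosed_lowerP (n + 1 + j)).preimage (by fun_prop : Continuous fun x : H => (x ^ p)⁻¹ * y))
  have hne : ∀ j, (t j).Nonempty := by
    intro j
    induction j with
    | zero => exact ⟨1, one_mem _, by simpa using hy⟩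
    | succ j ih =>
      obtain ⟨x, hx, hxy⟩ := ih
      rw [show n + 1 + j = n + j + 1 by ring] at hxy
      obtain ⟨z, hz, hzw⟩ := h.exists_pow_congr hxy
      refine ⟨x * z, mul_mem hx (lowerP_antitone (Nat.le_add_right n j) hz), ?_⟩
      have h1 := mul_pow_prime_congr hp x hz
      have h2 := mul_mem h1 hzw
      rw [show n + 1 + (j + 1) = n + j + 2 by ring]
      convert h2 using 1
      group
  obtain ⟨x, hx⟩ := IsCompact.nonempty_iInter_of_sequence_nonempty_isCompact_isClosed t
    (fun j x hx => ⟨hx.1, lowerP_antitone (by omega) hx.2⟩) hne (hcl 0).isCompact hcl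
  rw [Set.mem_iInter] at hx
  refine ⟨x, (hx 0).1, inv_mul_eq_one.1 (hbot _ fun j => ?_)⟩
  exact lowerP_antitone (by omega) (hx j).2

theorem IsUniform.exists_pow_prime_pow_eq (hp : p ≠ 2) (h : IsUniform p H)
    (hbot : ∀ x : H, (∀ n, x ∈ lowerP p H n) → x = 1) {n : ℕ} {y : H}
    (hy : y ∈ lowerP p H n) : ∃ x : H, x ^ p ^ n = y := by
  induction n generalizing y with
  | zero => exact ⟨y, by simp⟩
  | succ n ih =>
    obtain ⟨x, hx, rfl⟩ := h.exists_pow_eq hp hbot hy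
    obtain ⟨z, rfl⟩ := ih hx
    exact ⟨z, by rw [pow_succ, pow_mul]⟩

theorem IsUniform.isOpen_lowerP (h : IsUniform p H) (n : ℕ) : IsOpen (lowerP p H n : Set H) := by
  have h1 : ∀ n, (lowerP p H (n + 1)).relIndex (lowerP p H n) ≠ 0 := by
    intro n
    induction n with
    | zero =>
      have h2 := (h.isTopFG.finiteIndex_frattiniP (p := p) (Fact.out : p.Prime).pos).index_ne_zero
      have h3 := Subgroup.relIndex_top_right (H := lowerP p H 1)
      exact fun h0 => h2 (h3.symm.trans h0)
    | succ n ih =>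
      obtain ⟨α, -⟩ := h.pow_iso n
      have := Nat.card_congr α.toEquiv
      exact fun h0 => ih (this.trans h0)
  have h2 : (lowerP p H n).index ≠ 0 := by
    induction n with
    | zero => simp [lowerP]
    | succ n ih =>
      rw [← Subgroup.relIndex_mul_index (lowerP_succ_le n)]
      exact mul_ne_zero (h1 n) ih
  have : (lowerP p H n).FiniteIndex := ⟨h2⟩
  exact Subgroup.isOpen_of_isClosed_of_finiteIndex _ (isClosed_lowerP n)

end Uniform

/-! ### The logarithm on a uniform group of matrices -/

section UniformLog
open scoped commutatorElement

variable {p : ℕ} [Fact p.Prime] {m : ℕ}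

theorem toQp_mem_matBall_zero (x : GL (Fin m) ℤ_[p]) : toQp x ∈ matBall p m 0 := fun i j => by
  rw [Nat.cast_zero, neg_zero, zpow_zero]
  exact PadicInt.norm_le_one ((x : Matrix (Fin m) (Fin m) ℤ_[p]) i j)

theorem toQp_mul_sub_one (x y : GL (Fin m) ℤ_[p]) :
    toQp (x * y) - 1 = (toQp x - 1) + (toQp y - 1) + (toQp x - 1) * (toQp y - 1) := by
  rw [toQp_mul]
  noncomm_ring

theorem toQp_inv_sub_one (x : GL (Fin m) ℤ_[p]) : toQp x⁻¹ - 1 = -(toQp x⁻¹ * (toQp x - 1)) := by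
  rw [mul_sub, toQp_inv_mul, mul_one]
  noncomm_ring

theorem toQp_inv_sub_one_mem {r : ℕ} {x : GL (Fin m) ℤ_[p]} (hx : toQp x - 1 ∈ matBall p m r) :
    toQp x⁻¹ - 1 ∈ matBall p m r := by
  rw [toQp_inv_sub_one]
  have := mul_mem_matBall (toQp_mem_matBall_zero x⁻¹) hx
  rw [zero_add] at this
  exact neg_mem this

/-- The elements of a matrix group congruent to `1` modulo `p ^ r`. -/
def congrSubgroup (G : Subgroup (GL (Fin m) ℤ_[p])) (r : ℕ) : Subgroup G where
  carrier := {x | toQp (x : GL (Fin m) ℤ_[p]) - 1 ∈ matBall p m r}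
  one_mem' := by
    change toQp 1 - 1 ∈ matBall p m r
    rw [toQp_one, sub_self]
    exact zero_mem _
  mul_mem' {x y} hx hy := by
    change toQp (x * y : GL (Fin m) ℤ_[p]) - 1 ∈ matBall p m r
    rw [toQp_mul_sub_one]
    exact add_mem (add_mem hx hy) (matBall_mono (by omega) (mul_mem_matBall hx hy))
  inv_mem' {x} hx := toQp_inv_sub_one_mem hx

theorem toQp_commutator_sub_one_mem {r s : ℕ} {x y : GL (Fin m) ℤ_[p]}
    (hx : toQp x - 1 ∈ matBall p m r) (hy : toQp y - 1 ∈ matBall p m s) :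
    toQp ⁅x, y⁆ - 1 ∈ matBall p m (r + s) := by
  have e : toQp ⁅x, y⁆ - 1 = ((toQp x - 1) * (toQp y - 1) - (toQp y - 1) * (toQp x - 1)) *
      toQp (x⁻¹ * y⁻¹) := by
    have h1 : ((toQp x - 1) * (toQp y - 1) - (toQp y - 1) * (toQp x - 1)) =
        toQp (x * y) - toQp (y * x) := by
      rw [toQp_mul, toQp_mul]
      noncomm_ring
    rw [h1, sub_mul, ← toQp_mul, ← toQp_mul, commutatorElement_def]
    congr 1
    · congr 1; group
    · rw [← toQp_one]; congr 1; group
  rw [e]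
  have := mul_mem_matBall (sub_mem (mul_mem_matBall hx hy)
    (by rw [add_comm]; exact mul_mem_matBall hy hx)) (toQp_mem_matBall_zero (x⁻¹ * y⁻¹))
  simpa using this

/-- For odd `p`, the `p`-central series of a group of matrices congruent to `1` modulo `p` descends
at least as fast as the congruence subgroups. -/
theorem lowerP_le_congrSubgroup (hp : p ≠ 2) {G : Subgroup (GL (Fin m) ℤ_[p])} (hG : G ≤ glOne p m)
    (n : ℕ) : lowerP p G n ≤ congrSubgroup G (n + 1) := by
  induction n with
  | zero => exact fun x _ => toQp_sub_one_mem_matBall (hG x.2)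
  | succ n ih =>
    refine powComm_le ?_ (fun x hx => ?_) (fun x y hy => ?_)
    · exact (isClosed_matBall (n + 1 + 1)).preimage
        ((continuous_toQp.comp continuous_subtype_val).sub continuous_const)
    · change toQp ((x : GL (Fin m) ℤ_[p]) ^ p) - 1 ∈ matBall p m (n + 1 + 1)
      rw [toQp_pow]
      exact pow_prime_sub_one_mem_matBall hp (by omega) (ih hx)
    · have := toQp_commutator_sub_one_mem (toQp_sub_one_mem_matBall (hG x.2)) (ih hy)
      rw [add_comm] at this
      exact this

theorem eq_one_of_forall_mem_lowerP (hp : p ≠ 2) {G : Subgroup (GL (Fin m) ℤ_[p])}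
    (hG : G ≤ glOne p m) (x : G) (h : ∀ n, x ∈ lowerP p G n) : x = 1 := by
  refine Subtype.ext (toQp_injective ?_)
  rw [Subgroup.coe_one, toQp_one]
  exact sub_eq_zero.1 (eq_zero_of_forall_mem_matBall fun r =>
    matBall_mono (Nat.le_succ r) (lowerP_le_congrSubgroup hp hG r (h r)))

/-- `log x` agrees with `x - 1` to twice the precision. -/
theorem matLog_sub_sub_one_mem (hp : p ≠ 2) {s : ℕ} (hs : 1 ≤ s) {x : GL (Fin m) ℤ_[p]}
    (hx : toQp x - 1 ∈ matBall p m s) : matLog x - (toQp x - 1) ∈ matBall p m (s + s) := by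
  have := matLog_sub_mem_matBall hp hs hx (y := 1) (by rw [toQp_one, sub_self]; exact zero_mem _)
    (by rwa [toQp_one])
  rwa [matLog_one, sub_zero, toQp_one] at this

theorem matLog_mul_mem (hp : p ≠ 2) {s : ℕ} (hs : 1 ≤ s) {x y : GL (Fin m) ℤ_[p]}
    (hx : toQp x - 1 ∈ matBall p m s) (hy : toQp y - 1 ∈ matBall p m s) :
    matLog (x * y) - (matLog x + matLog y) ∈ matBall p m (s + s) := by
  have hxy : toQp (x * y) - 1 ∈ matBall p m s := by
    rw [toQp_mul_sub_one]
    exact add_mem (add_mem hx hy) (matBall_mono (by omega) (mul_mem_matBall hx hy))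
  have h1 := matLog_sub_sub_one_mem hp hs hx
  have h2 := matLog_sub_sub_one_mem hp hs hy
  have h3 := matLog_sub_sub_one_mem hp hs hxy
  have h4 := sub_mem (sub_mem (add_mem h3 (mul_mem_matBall hx hy)) h1) h2
  convert h4 using 1
  rw [toQp_mul_sub_one]
  abel

/-- The lattices `p ^ r M_m(ℤ_p)` form a basis of neighbourhoods of `0`, so that closed sets may be
tested with them. -/
theorem mem_of_forall_exists_sub_mem {C : Set (Matrix (Fin m) (Fin m) ℚ_[p])} (hC : IsClosed C)
    {a : Matrix (Fin m) (Fin m) ℚ_[p]} (h : ∀ r, ∃ c ∈ C, c - a ∈ matBall p m r) : a ∈ C := by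
  rw [← hC.closure_eq, mem_closure_iff_nhds]
  intro U hU
  have h1 : (fun x => x + a) ⁻¹' U ∈ nhds (0 : Matrix (Fin m) (Fin m) ℚ_[p]) := by
    refine (continuous_id.add continuous_const).continuousAt.preimage_mem_nhds ?_
    simpa using hU
  obtain ⟨r, hr⟩ := exists_matBall_subset h1
  obtain ⟨c, hc, hca⟩ := h r
  refine ⟨c, ?_, hc⟩
  have := hr hca
  simpa using this

variable {G : Subgroup (GL (Fin m) ℤ_[p])}

theorem continuous_matLog_coe (hp : p ≠ 2) (hG1 : G ≤ glOne p m) :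
    Continuous fun x : G => matLog (x : GL (Fin m) ℤ_[p]) :=
  (continuousOn_matLog hp).comp_continuous continuous_subtype_val fun x => hG1 x.2

theorem exists_pow_prime_pow_eq (hp : p ≠ 2) (hG1 : G ≤ glOne p m) (hG : IsUniform p G) {n : ℕ}
    {y : G} (hy : y ∈ lowerP p G n) : ∃ x : G, x ^ p ^ n = y :=
  hG.exists_pow_prime_pow_eq hp (eq_one_of_forall_mem_lowerP hp hG1) hy

/-- The logarithms of a uniform group `G` form an additive monoid, and addition of logarithms
agrees with multiplication modulo `G_2`: the elements `z_n` with
`z_n ^ (p ^ n) = x ^ (p ^ n) * y ^ (p ^ n)` are congruent to `x * y`, and their logarithms converge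
to `log x + log y`. -/
theorem exists_matLog_eq_add (hp : p ≠ 2) (hG1 : G ≤ glOne p m) (hG : IsUniform p G) (x y : G) :
    ∃ z : G, matLog (z : GL (Fin m) ℤ_[p]) =
      matLog (x : GL (Fin m) ℤ_[p]) + matLog (y : GL (Fin m) ℤ_[p]) ∧
      z⁻¹ * (x * y) ∈ lowerP p G 1 := by
  have := hG.isProP.compact
  let C : Set G := {z | z⁻¹ * (x * y) ∈ lowerP p G 1}
  have hC : IsClosed C := (isClosed_lowerP 1).preimage
    (f := fun z : G => z⁻¹ * (x * y)) (continuous_inv.mul continuous_const)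
  have hCl := (hC.isCompact.image (continuous_matLog_coe hp hG1)).isClosed
  obtain ⟨z, hz, hzlog⟩ := mem_of_forall_exists_sub_mem hCl
    (a := matLog (x : GL (Fin m) ℤ_[p]) + matLog (y : GL (Fin m) ℤ_[p])) (by
      intro n
      obtain ⟨z, hz⟩ := exists_pow_prime_pow_eq hp hG1 hG
        (mul_mem (pow_prime_pow_mem_lowerP x n) (pow_prime_pow_mem_lowerP y n))
      obtain ⟨β, hβ, hker⟩ := hG.exists_powHom n
      refine ⟨_, ⟨z, ?_, rfl⟩, ?_⟩
      · change z⁻¹ * (x * y) ∈ lowerP p G 1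
        rw [← hker, MonoidHom.mem_ker, map_mul, map_inv, map_mul, hβ, hβ, hβ, hz,
          QuotientGroup.mk_mul, inv_mul_cancel]
      · have h1 := matLog_mul_mem hp (s := n + 1) (by omega)
          (lowerP_le_congrSubgroup hp hG1 n (pow_prime_pow_mem_lowerP x n))
          (lowerP_le_congrSubgroup hp hG1 n (pow_prime_pow_mem_lowerP y n))
        rw [← Subgroup.coe_mul, ← hz, Subgroup.coe_pow, Subgroup.coe_pow, Subgroup.coe_pow,
          matLog_pow_prime_pow (hG1 z.2), matLog_pow_prime_pow (hG1 x.2),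
          matLog_pow_prime_pow (hG1 y.2), ← smul_add, ← smul_sub] at h1
        rw [← pow_smul_mem_matBall_iff (n := n)]
        exact matBall_mono (by omega) h1)
  exact ⟨z, hzlog, hz⟩

/-- The Lie algebra `𝔤` of a uniform group is the set of its logarithms. -/
theorem mem_lieAlg_iff (hp : p ≠ 2) (hG1 : G ≤ glOne p m) (hG : IsUniform p G)
    {X : Matrix (Fin m) (Fin m) ℚ_[p]} :
    X ∈ lieAlg G ↔ ∃ x : G, matLog (x : GL (Fin m) ℤ_[p]) = X := by
  have := hG.isProP.compact
  let L := Set.range fun x : G => matLog (x : GL (Fin m) ℤ_[p])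
  have hLcl : IsClosed L := (isCompact_range (continuous_matLog_coe hp hG1)).isClosed
  have hadd : ∀ {X Y}, X ∈ L → Y ∈ L → X + Y ∈ L := by
    rintro _ _ ⟨x, rfl⟩ ⟨y, rfl⟩
    obtain ⟨z, hz, -⟩ := exists_matLog_eq_add hp hG1 hG x y
    exact ⟨z, hz⟩
  have hzero : (0 : Matrix (Fin m) (Fin m) ℚ_[p]) ∈ L := ⟨1, matLog_one⟩
  let S : Submodule ℤ_[p] (Matrix (Fin m) (Fin m) ℚ_[p]) :=
    { carrier := L
      add_mem' := hadd
      zero_mem' := hzero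
      smul_mem' := fun c X hX => by
        have hc : IsClosed {c : ℤ_[p] | c • X ∈ L} := hLcl.preimage
          ((continuous_subtype_val (p := fun c : ℚ_[p] => ‖c‖ ≤ 1)).smul continuous_const)
        refine PadicInt.denseRange_natCast.induction_on (p := fun c => c • X ∈ L) c hc ?_
        intro k
        induction k with
        | zero => simpa using hzero
        | succ k ih =>
          rw [Nat.cast_succ, add_smul, one_smul]
          exact hadd ih hX }
  constructor
  · intro hX
    have hle : lieAlg G ≤ S := Submodule.span_le.2 (by
      rintro _ ⟨x, hx, rfl⟩
      exact ⟨⟨x, hx⟩, rfl⟩)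
    exact hle hX
  · rintro ⟨x, rfl⟩
    exact Submodule.subset_span ⟨x, x.2, rfl⟩

theorem matLog_mem_lieAlg (x : G) : matLog (x : GL (Fin m) ℤ_[p]) ∈ lieAlg G :=
  Submodule.subset_span ⟨x, x.2, rfl⟩

/-- The class of `log x` in `𝔤 / p 𝔤`. -/
noncomputable def logClass (x : G) : ModN (lieAlg G) p :=
  ModN.mkQ p ⟨matLog (x : GL (Fin m) ℤ_[p]), matLog_mem_lieAlg x⟩

/-- `log x ∈ p 𝔤` means that `x` is a `p`-th power in `G`. -/
theorem logClass_eq_zero_iff (hp : p ≠ 2) (hG1 : G ≤ glOne p m) (hG : IsUniform p G) {x : G} :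
    logClass x = 0 ↔ x ∈ lowerP p G 1 := by
  have hmk : ∀ X : lieAlg G, ModN.mkQ p X = 0 ↔ ∃ Y : lieAlg G, (p : ℤ) • Y = X := fun X =>
    (Submodule.Quotient.mk_eq_zero _).trans Iff.rfl
  rw [logClass, hmk]
  constructor
  · rintro ⟨⟨Y, hY⟩, hYx⟩
    obtain ⟨y, rfl⟩ := (mem_lieAlg_iff hp hG1 hG).1 hY
    have h1 : (p : ℤ) • matLog (y : GL (Fin m) ℤ_[p]) = matLog (x : GL (Fin m) ℤ_[p]) :=
      congrArg Subtype.val hYx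
    have h2 : x = y ^ p := by
      refine Subtype.ext (matLog_injOn hp (hG1 x.2) (hG1 (y ^ p).2) ?_)
      rw [Subgroup.coe_pow, matLog_pow_prime (hG1 y.2), ← h1, ← Int.cast_smul_eq_zsmul ℚ_[p],
        Int.cast_natCast]
    rw [h2]
    exact pow_mem_lowerP_succ (n := 0) (Subgroup.mem_top y)
  · intro hx
    obtain ⟨y, hy⟩ := exists_pow_prime_pow_eq hp hG1 hG hx
    rw [pow_one] at hy
    refine ⟨⟨_, matLog_mem_lieAlg y⟩, Subtype.ext ?_⟩
    change (p : ℤ) • matLog (y : GL (Fin m) ℤ_[p]) = matLog (x : GL (Fin m) ℤ_[p])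
    rw [← hy, Subgroup.coe_pow, matLog_pow_prime (hG1 y.2), ← Int.cast_smul_eq_zsmul ℚ_[p],
        Int.cast_natCast]

theorem logClass_congr (hp : p ≠ 2) (hG1 : G ≤ glOne p m) (hG : IsUniform p G) {a b : G}
    (h : a⁻¹ * b ∈ lowerP p G 1) : logClass a = logClass b := by
  obtain ⟨w, hw⟩ := (mem_lieAlg_iff hp hG1 hG).1
    (sub_mem (matLog_mem_lieAlg b) (matLog_mem_lieAlg a))
  obtain ⟨z, hz, hzw⟩ := exists_matLog_eq_add hp hG1 hG a w
  rw [hw, add_sub_cancel] at hz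
  obtain rfl : z = b := Subtype.ext (matLog_injOn hp (hG1 z.2) (hG1 b.2) hz)
  have h1 : w ∈ lowerP p G 1 := by
    have := mul_mem h hzw
    simpa [mul_assoc] using this
  have h2 := (logClass_eq_zero_iff hp hG1 hG).2 h1
  have h3 : logClass w = logClass z - logClass a := by
    rw [logClass, logClass, logClass, ← map_sub]
    congr 1
    exact Subtype.ext hw
  rw [h3, sub_eq_zero] at h2
  exact h2.symm

theorem logClass_mul (hp : p ≠ 2) (hG1 : G ≤ glOne p m) (hG : IsUniform p G) (x y : G) :
    logClass (x * y) = logClass x + logClass y := by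
  obtain ⟨z, hz, hzxy⟩ := exists_matLog_eq_add hp hG1 hG x y
  rw [← logClass_congr hp hG1 hG hzxy, logClass, logClass, logClass, ← map_add]
  congr 1
  exact Subtype.ext hz

theorem finite_modN_lieAlg (hp : p ≠ 2) (hG1 : G ≤ glOne p m) (hG : IsUniform p G) :
    Finite (ModN (lieAlg G) p) := by
  have := hG.isTopFG.finiteIndex_frattiniP (p := p) (Fact.out : p.Prime).pos
  have hfin : Finite (G ⧸ lowerP p G 1) :=
    Subgroup.finite_quotient_of_finiteIndex (H := frattiniP p G)
  refine Finite.of_surjective (α := G ⧸ lowerP p G 1) (Quotient.lift logClass fun a b hab =>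
    logClass_congr hp hG1 hG (QuotientGroup.leftRel_apply.1 hab)) ?_
  intro X
  obtain ⟨⟨X, hX⟩, rfl⟩ := Submodule.Quotient.mk_surjective _ X
  obtain ⟨x, rfl⟩ := (mem_lieAlg_iff hp hG1 hG).1 hX
  exact ⟨QuotientGroup.mk x, rfl⟩

end UniformLog

/-! ### The quotients of the `p`-central series as copies of `𝔤 / p 𝔤` -/

section LevelClass

variable {p : ℕ} [Fact p.Prime] {m : ℕ} {G : Subgroup (GL (Fin m) ℤ_[p])}

open scoped Classical in
/-- The map `G_{n+1} → 𝔤 / p 𝔤` sending `y ^ (p ^ n)` to the class of `log y`; on elements of `G`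
which are not `p ^ n`-th powers the value is `0`. -/
noncomputable def levelClass (n : ℕ) (x : G) : ModN (lieAlg G) p :=
  if h : ∃ y : G, y ^ p ^ n = x then logClass h.choose else 0

theorem pow_prime_pow_injective (hp : p ≠ 2) (hG1 : G ≤ glOne p m) (n : ℕ) {x y : G}
    (h : x ^ p ^ n = y ^ p ^ n) : x = y := by
  refine Subtype.ext (matLog_injOn hp (hG1 x.2) (hG1 y.2) ?_)
  have h1 := congrArg (fun z : G => matLog (z : GL (Fin m) ℤ_[p])) h
  simp only [Subgroup.coe_pow, matLog_pow_prime_pow (hG1 x.2), matLog_pow_prime_pow (hG1 y.2)] at h1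
  exact smul_right_injective _
    (pow_ne_zero n (Nat.cast_ne_zero.2 (Fact.out : p.Prime).ne_zero)) h1

theorem levelClass_pow (hp : p ≠ 2) (hG1 : G ≤ glOne p m) (n : ℕ) (y : G) :
    levelClass n (y ^ p ^ n) = logClass y := by
  have h : ∃ z : G, z ^ p ^ n = y ^ p ^ n := ⟨y, rfl⟩
  rw [levelClass, dif_pos h]
  congr 1
  exact pow_prime_pow_injective hp hG1 n h.choose_spec

/-- On `G_{n+1}`, the kernel of `levelClass n` is `G_{n+2}`. -/
theorem levelClass_eq_zero_iff (hp : p ≠ 2) (hG1 : G ≤ glOne p m) (hG : IsUniform p G) {n : ℕ}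
    {x : G} (hx : x ∈ lowerP p G n) : levelClass n x = 0 ↔ x ∈ lowerP p G (n + 1) := by
  obtain ⟨y, rfl⟩ := exists_pow_prime_pow_eq hp hG1 hG hx
  obtain ⟨β, hβ, hker⟩ := hG.exists_powHom n
  rw [levelClass_pow hp hG1, logClass_eq_zero_iff hp hG1 hG, ← hker, MonoidHom.mem_ker, hβ,
    QuotientGroup.eq_one_iff]

theorem levelClass_mul (hp : p ≠ 2) (hG1 : G ≤ glOne p m) (hG : IsUniform p G) {n : ℕ}
    {x y : G} (hx : x ∈ lowerP p G n) (hy : y ∈ lowerP p G n) :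
    levelClass n (x * y) = levelClass n x + levelClass n y := by
  obtain ⟨β, hβ, hker⟩ := hG.exists_powHom n
  obtain ⟨z, hz⟩ := exists_pow_prime_pow_eq hp hG1 hG (mul_mem hx hy)
  obtain ⟨x, rfl⟩ := exists_pow_prime_pow_eq hp hG1 hG hx
  obtain ⟨y, rfl⟩ := exists_pow_prime_pow_eq hp hG1 hG hy
  rw [← hz, levelClass_pow hp hG1, levelClass_pow hp hG1, levelClass_pow hp hG1,
    ← logClass_mul hp hG1 hG]
  refine logClass_congr hp hG1 hG ?_
  rw [← hker, MonoidHom.mem_ker, map_mul, map_inv, map_mul, hβ, hβ, hβ, hz,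
    QuotientGroup.mk_mul, inv_mul_cancel]

theorem logClass_one : logClass (1 : G) = 0 := by
  have : (⟨matLog ((1 : G) : GL (Fin m) ℤ_[p]), matLog_mem_lieAlg 1⟩ : lieAlg G) = 0 :=
    Subtype.ext matLog_one
  rw [logClass, this, map_zero]

theorem logClass_inv (hp : p ≠ 2) (hG1 : G ≤ glOne p m) (hG : IsUniform p G) (x : G) :
    logClass x⁻¹ = -logClass x := by
  rw [eq_neg_iff_add_eq_zero, ← logClass_mul hp hG1 hG, inv_mul_cancel, logClass_one]

theorem levelClass_conj (hp : p ≠ 2) (hG1 : G ≤ glOne p m) (hG : IsUniform p G) {n : ℕ}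
    {x : G} (hx : x ∈ lowerP p G n) (g : G) :
    levelClass n (g * x * g⁻¹) = levelClass n x := by
  obtain ⟨y, rfl⟩ := exists_pow_prime_pow_eq hp hG1 hG hx
  rw [← conj_pow, levelClass_pow hp hG1, levelClass_pow hp hG1, logClass_mul hp hG1 hG,
    logClass_mul hp hG1 hG, logClass_inv hp hG1 hG]
  abel

/-- `levelClass n` is equivariant for conjugation by `Δ`. -/
theorem levelClass_act (hp : p ≠ 2) (hG1 : G ≤ glOne p m) (hG : IsUniform p G) {Δ : Type*}
    [Group Δ] (ρ₀ : Δ →* GL (Fin m) ℤ_[p])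
    (hΔG : ρ₀.range ≤ Subgroup.normalizer (G : Set (GL (Fin m) ℤ_[p]))) {n : ℕ} {x : G}
    (hx : x ∈ lowerP p G n) (δ : Δ) {x' : G}
    (hx' : (x' : GL (Fin m) ℤ_[p]) = ρ₀ δ * x * (ρ₀ δ)⁻¹) :
    levelClass n x' = modRep p (lieAct ρ₀ G hΔG) δ (levelClass n x) := by
  obtain ⟨y, rfl⟩ := exists_pow_prime_pow_eq hp hG1 hG hx
  let y' : G := ⟨ρ₀ δ * y * (ρ₀ δ)⁻¹, (Subgroup.mem_normalizer_iff.1 (hΔG ⟨δ, rfl⟩) y).1 y.2⟩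
  obtain rfl : x' = y' ^ p ^ n := Subtype.ext (by
    rw [hx', Subgroup.coe_pow, Subgroup.coe_pow, conj_pow])
  rw [levelClass_pow hp hG1, levelClass_pow hp hG1]
  change logClass y' = ModN.mkQ p (lieAct ρ₀ G hΔG δ _)
  rw [logClass]
  congr 1
  exact Subtype.ext (matLog_conj _ _)

theorem levelClass_congr (hp : p ≠ 2) (hG1 : G ≤ glOne p m) (hG : IsUniform p G) {n : ℕ}
    {x y : G} (hx : x ∈ lowerP p G n) (hy : y⁻¹ * x ∈ lowerP p G (n + 1)) :
    levelClass n x = levelClass n y := by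
  have h1 : x * (y⁻¹ * x)⁻¹ = y := by group
  have h2 := lowerP_succ_le n (inv_mem hy)
  rw [← h1, levelClass_mul hp hG1 hG hx h2,
    (levelClass_eq_zero_iff hp hG1 hG h2).2 (inv_mem hy), add_zero]

/-- `levelClass n` is locally constant on `G_{n+1}`, hence continuous for every topology on
`𝔤 / p 𝔤`. -/
theorem continuousOn_levelClass (hp : p ≠ 2) (hG1 : G ≤ glOne p m) (hG : IsUniform p G)
    [TopologicalSpace (ModN (lieAlg G) p)] (n : ℕ) :
    ContinuousOn (levelClass (G := G) n) (lowerP p G n : Set G) := by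
  intro x hx
  have hopen : {y : G | y⁻¹ * x ∈ lowerP p G (n + 1)} ∈ nhds x :=
    ((hG.isOpen_lowerP (n + 1)).preimage (by fun_prop : Continuous fun y : G => y⁻¹ * x)).mem_nhds
      (by simp only [Set.preimage, Set.mem_ofPred_eq, inv_mul_cancel]; exact one_mem _)
  refine ContinuousAt.continuousWithinAt ((continuousAt_const (y := levelClass n x)).congr ?_)
  filter_upwards [hopen] with y hy
  exact levelClass_congr hp hG1 hG hx hy

end LevelClass

/-! ### The Frattini subgroup of the group generated by independent elements -/

section GeneratedSubgroup
open scoped commutatorElement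

variable {p : ℕ} [Fact p.Prime] {m : ℕ} {G : Subgroup (GL (Fin m) ℤ_[p])}

/-- The elements of `G` with logarithm in `p ^ k 𝔤` are the `p ^ k`-th powers. -/
theorem exists_pow_prime_pow_eq_of_matLog_mem (hp : p ≠ 2) (hG1 : G ≤ glOne p m)
    (hG : IsUniform p G) {k : ℕ} {x : G}
    (hx : matLog (x : GL (Fin m) ℤ_[p]) ∈ ((p : ℤ_[p]) ^ k) • lieAlg G) :
    ∃ y : G, y ^ p ^ k = x ∧
      matLog (x : GL (Fin m) ℤ_[p]) = ((p : ℤ_[p]) ^ k) • matLog (y : GL (Fin m) ℤ_[p]) := by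
  obtain ⟨Y, hY, hYx⟩ := hx
  obtain ⟨y, rfl⟩ := (mem_lieAlg_iff hp hG1 hG).1 hY
  have hYx' : ((p : ℤ_[p]) ^ k) • matLog (y : GL (Fin m) ℤ_[p]) =
    matLog (x : GL (Fin m) ℤ_[p]) := hYx
  refine ⟨y, Subtype.ext (matLog_injOn hp (hG1 (y ^ p ^ k).2) (hG1 x.2) ?_), hYx'.symm⟩
  rw [Subgroup.coe_pow, matLog_pow_prime_pow (hG1 y.2), ← hYx',
    ← algebraMap_smul ℚ_[p] ((p : ℤ_[p]) ^ k), map_pow, map_natCast]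

/-- Multiplication by `p ^ k` as a map `𝔤 / p 𝔤 → p ^ k 𝔤 / p (p ^ k 𝔤)`. -/
noncomputable def modNPowSmul (G : Subgroup (GL (Fin m) ℤ_[p])) (k : ℕ) :
    ModN (lieAlg G) p →ₗ[ZMod p] ModN ↥(((p : ℤ_[p]) ^ k) • lieAlg G) p :=
  AddMonoidHom.toZModLinearMap p
    ((Submodule.mapQ (LinearMap.range (LinearMap.lsmul ℤ (lieAlg G) p))
      (LinearMap.range (LinearMap.lsmul ℤ ↥(((p : ℤ_[p]) ^ k) • lieAlg G) p))
      (AddMonoidHom.toIntLinearMap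
        { toFun := fun X => ⟨((p : ℤ_[p]) ^ k) • X.1, Submodule.smul_mem_pointwise_smul _ _ _ X.2⟩
          map_zero' := Subtype.ext (smul_zero _)
          map_add' := fun X Y => Subtype.ext (smul_add _ _ _) }) (by
        rintro _ ⟨X, rfl⟩
        exact ⟨⟨((p : ℤ_[p]) ^ k) • X.1, Submodule.smul_mem_pointwise_smul _ _ _ X.2⟩,
          Subtype.ext (smul_comm (p : ℤ) ((p : ℤ_[p]) ^ k) X.1)⟩)).toAddMonoidHom)

/-- Independence of the `log g_i` in `p ^ k 𝔤 / p ^ (k + 1) 𝔤` is independence of the `g_i` in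
`G_{k+1} / G_{k+2}`. -/
theorem linearIndependent_levelClass (hp : p ≠ 2) (hG1 : G ≤ glOne p m) (hG : IsUniform p G)
    {k : ℕ} {ι : Type*} (g : ι → G)
    (hz : ∀ i, matLog (g i : GL (Fin m) ℤ_[p]) ∈ ((p : ℤ_[p]) ^ k) • lieAlg G)
    (hfree : LinearIndependent (ZMod p) fun i =>
      ModN.mkQ (G := ↥(((p : ℤ_[p]) ^ k) • lieAlg G)) p ⟨matLog (g i : GL (Fin m) ℤ_[p]), hz i⟩) :
    LinearIndependent (ZMod p) fun i => levelClass k (g i) := by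
  refine LinearIndependent.of_comp (modNPowSmul G k) ?_
  convert hfree using 1
  funext i
  obtain ⟨y, hy, hlog⟩ := exists_pow_prime_pow_eq_of_matLog_mem hp hG1 hG (hz i)
  have h : levelClass k (g i) = logClass y := by rw [← hy, levelClass_pow hp hG1]
  rw [Function.comp_apply, h]
  change ModN.mkQ p _ = _
  congr 1
  exact Subtype.ext hlog.symm

variable {G' : Subgroup (GL (Fin m) ℤ_[p])}

theorem inclusion_mem_lowerP_of_generators {n : ℕ} (hG'G : G' ≤ G) {S : Set (GL (Fin m) ℤ_[p])}
    (hG' : G' = closedSubgroupGen S) (hGcl : IsClosed (G : Set (GL (Fin m) ℤ_[p])))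
    (hS : ∀ x ∈ S, ∃ h : x ∈ G, (⟨x, h⟩ : G) ∈ lowerP p G n) (x : G') :
    Subgroup.inclusion hG'G x ∈ lowerP p G n := by
  have h1 : G' ≤ (lowerP p G n).map G.subtype := by
    rw [hG']
    refine Subgroup.topologicalClosure_minimal _ ((Subgroup.closure_le _).2 fun y hy => ?_) ?_
    · obtain ⟨h, h'⟩ := hS y hy
      exact ⟨⟨y, h⟩, h', rfl⟩
    · rw [Subgroup.coe_map]
      exact hGcl.isClosedEmbedding_subtypeVal.isClosedMap _ (isClosed_lowerP (H := G) n)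
  obtain ⟨y, hy, hyx⟩ := h1 x.2
  obtain rfl : Subgroup.inclusion hG'G x = y := Subtype.ext hyx.symm
  exact hy

theorem frattiniP_le_comap_lowerP {n : ℕ} (hG'G : G' ≤ G)
    (h : ∀ x : G', Subgroup.inclusion hG'G x ∈ lowerP p G n) :
    frattiniP p G' ≤ (lowerP p G (n + 1)).comap (Subgroup.inclusion hG'G) := by
  refine powComm_le ?_ (fun x _ => ?_) (fun x y _ => ?_)
  · exact (isClosed_lowerP (n + 1)).preimage (continuous_subtype_val.subtype_mk _)
  · rw [Subgroup.mem_comap, map_pow]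
    exact pow_mem_lowerP_succ (h x)
  · rw [Subgroup.mem_comap, map_commutatorElement]
    exact commutator_mem_powComm _ (h y)

/-- Linearly independent vectors can be mapped arbitrarily to an elementary abelian `p`-group. -/
theorem exists_monoidHom_of_linearIndependent {Q : Type*} [Group Q]
    (hcomm : ∀ a b : Q, a * b = b * a) (hpow : ∀ a : Q, a ^ p = 1)
    {M ι : Type*} [AddCommGroup M] [Module (ZMod p) M] {v : ι → M}
    (hv : LinearIndependent (ZMod p) v) (q : ι → Q) :
    ∃ Θ : Multiplicative M →* Q, ∀ i, Θ (Multiplicative.ofAdd (v i)) = q i := by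
  let _ : CommGroup Q := { mul_comm := hcomm }
  let _ : Module (ZMod p) (Additive Q) := AddCommGroup.zmodModule (n := p) fun a => hpow a.toMul
  obtain ⟨L, hL⟩ := LinearMap.exists_leftInverse_of_injective _ (LinearMap.ker_eq_bot.2 hv)
  refine ⟨AddMonoidHom.toMultiplicativeLeft
    (Finsupp.linearCombination (ZMod p) (fun i => Additive.ofMul (q i)) ∘ₗ L).toAddMonoidHom,
    fun i => ?_⟩
  have := LinearMap.congr_fun hL (Finsupp.single i 1)
  rw [LinearMap.comp_apply, Finsupp.linearCombination_single, one_smul] at this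
  change (Finsupp.linearCombination (ZMod p) (fun i => Additive.ofMul (q i)) (L (v i))).toMul = q i
  simp [this]

/-- If the closed subgroup `G'` is generated by elements of `G_{k+1}` which are independent in
`G_{k+1} / G_{k+2}`, then the Frattini subgroup of `G'` is `G' ∩ G_{k+2}`: both `G' / Φ(G')` and
its image in `G_{k+1} / G_{k+2}` have the images of the generators as a basis. -/
theorem mem_frattiniP_iff (hp : p ≠ 2) (hG1 : G ≤ glOne p m) (hG : IsUniform p G)
    {k : ℕ} {ι : Type*} (hG'G : G' ≤ G) (g : ι → G')
    (hG' : G' = closedSubgroupGen (Set.range fun i => (g i : GL (Fin m) ℤ_[p])))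
    (hk : ∀ x : G', Subgroup.inclusion hG'G x ∈ lowerP p G k)
    (hli : LinearIndependent (ZMod p) fun i => levelClass k (Subgroup.inclusion hG'G (g i)))
    (x : G') : x ∈ frattiniP p G' ↔ Subgroup.inclusion hG'G x ∈ lowerP p G (k + 1) := by
  refine ⟨fun h => frattiniP_le_comap_lowerP hG'G hk h, fun hx => ?_⟩
  let : TopologicalSpace (ModN (lieAlg G) p) := ⊥
  have : DiscreteTopology (ModN (lieAlg G) p) := ⟨rfl⟩
  let Q := G' ⧸ frattiniP p G'
  obtain ⟨Θ, hΘ⟩ := exists_monoidHom_of_linearIndependent (Q := Q) (p := p)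
    (fun a b => by
      obtain ⟨a, rfl⟩ := QuotientGroup.mk_surjective a
      obtain ⟨b, rfl⟩ := QuotientGroup.mk_surjective b
      have h1 : ⁅b⁻¹, a⁻¹⁆ ∈ frattiniP p G' := commutator_mem_powComm _ (Subgroup.mem_top _)
      refine QuotientGroup.eq.2 (?_ : (a * b)⁻¹ * (b * a) ∈ _)
      convert h1 using 1
      rw [commutatorElement_def]
      group)
    (fun a => by
      obtain ⟨a, rfl⟩ := QuotientGroup.mk_surjective a
      exact (QuotientGroup.eq_one_iff (N := frattiniP p G') (a ^ p)).2
        (pow_mem_powComm p (Subgroup.mem_top a)))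
    hli (fun i => (QuotientGroup.mk (g i) : Q))
  let κ : G' →* Multiplicative (ModN (lieAlg G) p) := MonoidHom.mk'
    (fun x => Multiplicative.ofAdd (levelClass k (Subgroup.inclusion hG'G x)))
    (fun a b => by
      rw [map_mul, levelClass_mul hp hG1 hG (hk a) (hk b)]; rfl)
  -- `Θ ∘ κ` and the projection agree on the generators, hence on `G'`
  let T : Subgroup G' := (Θ.comp κ).eqLocus (QuotientGroup.mk' (frattiniP p G'))
  have hcl : IsClosed (G' : Set (GL (Fin m) ℤ_[p])) := by
    rw [hG']; exact Subgroup.isClosed_topologicalClosure _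
  have hcont : Continuous (Θ.comp κ) :=
    (continuous_of_discreteTopology
      (f := fun X : ModN (lieAlg G) p => Θ (Multiplicative.ofAdd X))).comp
      ((continuousOn_levelClass hp hG1 hG k).comp_continuous
        (continuous_subtype_val.subtype_mk _) hk)
  have : T2Space Q := by
    have : IsClosed (frattiniP p G' : Set G') := isClosed_powComm _
    infer_instance
  have hTcl : IsClosed (T : Set G') := isClosed_eq hcont QuotientGroup.continuous_mk
  have hT : G' ≤ T.map G'.subtype := by
    conv_lhs => rw [hG']
    refine Subgroup.topologicalClosure_minimal _ ((Subgroup.closure_le _).2 ?_) ?_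
    · rintro _ ⟨i, rfl⟩
      exact ⟨g i, hΘ i, rfl⟩
    · rw [Subgroup.coe_map]
      exact hcl.isClosedEmbedding_subtypeVal.isClosedMap _ hTcl
  obtain ⟨x', hx', hxx'⟩ := hT x.2
  obtain rfl : x' = x := Subtype.ext hxx'
  have h3 : Θ (κ x') = (QuotientGroup.mk x' : Q) := hx'
  have h4 : κ x' = 1 := (levelClass_eq_zero_iff hp hG1 hG (hk x')).2 hx
  rw [h4, map_one] at h3
  exact (QuotientGroup.eq_one_iff (N := frattiniP p G') x').1 h3.symm

end GeneratedSubgroup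

/-! ### Closed subgroups of `𝒢 × H` as homomorphisms modulo a subgroup -/

section Tower
open scoped commutatorElement

variable {𝒢 : Type u} [Group 𝒢] [TopologicalSpace 𝒢] {Δ : Type*} [Group Δ]
  {H : Type*} [Group H] [TopologicalSpace H]

/-- A closed `Δ`-stable subgroup `R` of `𝒢 × H` mapping onto `𝒢`, whose intersection with `1 × H`
is `K`. For normal `K` it is the graph of an equivariant homomorphism `𝒢 → H / K`. -/
structure IsGraphModulo (act : Δ →* MulAut 𝒢) (actH : Δ →* MulAut H) (K : Subgroup H)
    (R : Subgroup (𝒢 × H)) : Prop where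
  isClosed : IsClosed (R : Set (𝒢 × H))
  act_mem : ∀ δ, ∀ r ∈ R, (act δ r.1, actH δ r.2) ∈ R
  exists_mem : ∀ x, ∃ h, (x, h) ∈ R
  mem_iff : ∀ h, (1, h) ∈ R ↔ h ∈ K

variable {act : Δ →* MulAut 𝒢} {actH : Δ →* MulAut H}

/-- The action of `Δ` on a `Δ`-stable subgroup of `𝒢 × H`. -/
def prodActRestrict (act : Δ →* MulAut 𝒢) (actH : Δ →* MulAut H) (R : Subgroup (𝒢 × H))
    (hR : ∀ δ, ∀ r ∈ R, (act δ r.1, actH δ r.2) ∈ R) : Δ →* MulAut R where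
  toFun δ :=
    { toFun := fun r => ⟨(act δ r.1.1, actH δ r.1.2), hR δ r.1 r.2⟩
      invFun := fun r => ⟨(act δ⁻¹ r.1.1, actH δ⁻¹ r.1.2), hR δ⁻¹ r.1 r.2⟩
      left_inv := fun r => by ext <;> simp
      right_inv := fun r => by ext <;> simp
      map_mul' := fun r r' => by ext <;> simp }
  map_one' := by ext <;> simp
  map_mul' a b := by ext <;> simp

theorem IsGraphModulo.inv_mul_mem {K : Subgroup H} {R : Subgroup (𝒢 × H)}
    (hR : IsGraphModulo act actH K R) {x : 𝒢} {a b : H} (ha : (x, a) ∈ R) (hb : (x, b) ∈ R) :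
    a⁻¹ * b ∈ K := by
  rw [← hR.mem_iff]
  have := mul_mem (inv_mem ha) hb
  simpa using this

theorem IsGraphModulo.mul_mem {K : Subgroup H} {R : Subgroup (𝒢 × H)}
    (hR : IsGraphModulo act actH K R) {x : 𝒢} {a b : H} (ha : (x, a) ∈ R) (hb : a⁻¹ * b ∈ K) :
    (x, b) ∈ R := by
  have := R.mul_mem ha ((hR.mem_iff _).2 hb)
  simpa using this

/-- The intersection of a descending sequence of graphs modulo subgroups with trivial intersection
is the graph of a homomorphism, by compactness. -/
theorem exists_hom_of_isGraphModulo [CompactSpace H] {K : ℕ → Subgroup H}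
    (hK : ∀ h, (∀ j, h ∈ K j) → h = 1)
    (R : ℕ → Subgroup (𝒢 × H)) (hle : ∀ j, R (j + 1) ≤ R j)
    (hR : ∀ j, IsGraphModulo act actH (K j) (R j)) :
    ∃ ψ : 𝒢 →* H, Continuous ψ ∧ (∀ x j, (x, ψ x) ∈ R j) ∧
      ∀ δ x, ψ (act δ x) = actH δ (ψ x) := by
  have huniq : ∀ {x : 𝒢} {a b : H}, (∀ j, (x, a) ∈ R j) → (∀ j, (x, b) ∈ R j) → a = b := by
    intro x a b ha hb
    exact inv_mul_eq_one.1 (hK _ fun j => (hR j).inv_mul_mem (ha j) (hb j))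
  have hex : ∀ x : 𝒢, ∃ a : H, ∀ j, (x, a) ∈ R j := by
    intro x
    have hcl : ∀ j, IsClosed {a : H | (x, a) ∈ R j} := fun j => (hR j).isClosed.preimage
      (by fun_prop : Continuous fun a : H => (x, a))
    obtain ⟨a, ha⟩ := IsCompact.nonempty_iInter_of_sequence_nonempty_isCompact_isClosed
      (fun j => {a : H | (x, a) ∈ R j}) (fun j a ha => hle j ha) (fun j => (hR j).exists_mem x)
      (hcl 0).isCompact hcl
    exact ⟨a, fun j => Set.mem_iInter.1 ha j⟩
  choose ψ hψ using hex
  refine ⟨MonoidHom.mk' ψ fun x y => huniq (hψ (x * y)) fun j => (R j).mul_mem (hψ x j) (hψ y j),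
    ?_, hψ, fun δ x => huniq (hψ (act δ x)) fun j => (hR j).act_mem δ _ (hψ x j)⟩
  refine continuous_iff_isClosed.2 fun A hA => ?_
  have hpre : ψ ⁻¹' A = Prod.fst '' ((⋂ j, (R j : Set (𝒢 × H))) ∩ Prod.snd ⁻¹' A) := by
    ext x
    constructor
    · intro hx
      exact ⟨(x, ψ x), ⟨Set.mem_iInter.2 fun j => hψ x j, hx⟩, rfl⟩
    · rintro ⟨⟨y, a⟩, ⟨hya, haA⟩, rfl⟩
      have : ψ y = a := huniq (hψ y) fun j => Set.mem_iInter.1 hya j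
      rw [Set.mem_preimage, this]
      exact haA
  change IsClosed (ψ ⁻¹' A)
  rw [hpre]
  exact isClosedMap_fst_of_compactSpace _
    ((isClosed_iInter fun j => (hR j).isClosed).inter (hA.preimage continuous_snd))

variable [IsTopologicalGroup H] [CompactSpace H]

/-- If `K` is open, then `R → 𝒢` has a continuous section: the fibres of `𝒢 → H / K` are clopen,
and on each of them a constant second coordinate can be chosen. -/
theorem IsGraphModulo.exists_section {K : Subgroup H} {R : Subgroup (𝒢 × H)}
    (hR : IsGraphModulo act actH K R) (hK : IsOpen (K : Set H)) :
    ∃ s : 𝒢 → H, Continuous s ∧ ∀ x, (x, s x) ∈ R := by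
  have : Finite (H ⧸ K) := K.quotient_finite_of_isOpen hK
  choose a ha using hR.exists_mem
  let t : 𝒢 → H ⧸ K := fun x => QuotientGroup.mk (a x)
  have hout : ∀ (x : 𝒢) (τ : H ⧸ K), (x, τ.out) ∈ R ↔ t x = τ := by
    intro x τ
    rw [← QuotientGroup.out_eq' τ]
    constructor
    · intro h
      rw [QuotientGroup.out_eq' τ] at h
      exact QuotientGroup.eq.2 (hR.inv_mul_mem (ha x) h)
    · intro h
      rw [QuotientGroup.out_eq' τ] at h ⊢
      refine hR.mul_mem (ha x) (QuotientGroup.eq.1 ?_)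
      rw [QuotientGroup.out_eq' τ]
      exact h
  let _ : TopologicalSpace (H ⧸ K) := ⊥
  have : DiscreteTopology (H ⧸ K) := ⟨rfl⟩
  have ht : Continuous t := by
    refine continuous_iff_isClosed.2 fun A _ => ?_
    have : t ⁻¹' A = ⋃ τ ∈ A, {x | (x, τ.out) ∈ R} := by
      ext x
      simp [hout]
    rw [this]
    exact A.toFinite.isClosed_biUnion fun τ _ => hR.isClosed.preimage
      (by fun_prop : Continuous fun x : 𝒢 => (x, τ.out))
  exact ⟨fun x => (t x).out, (continuous_of_discreteTopology (f := Quotient.out)).comp ht,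
    fun x => (hout x _).2 rfl⟩

variable [T2Space H] [IsTopologicalGroup 𝒢] [CompactSpace 𝒢] [TotallyDisconnectedSpace 𝒢]

/-- If `K / K'` embeds by `κ` in a module orthogonal to `𝒯[p]`, then a graph modulo `K` contains a
graph modulo `K'`: the corresponding homomorphism to `H / K` lifts to `H / K'`. -/
theorem IsGraphModulo.exists_le {p : ℕ} [Fact p.Prime] (h𝒢 : IsTopFG 𝒢) [Finite Δ]
    (hΔ : (Nat.card Δ).Coprime p) (hact : ∀ δ, Continuous (act δ))
    (hactH : ∀ δ, Continuous (actH δ))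
    (hH2 : Subsingleton (continuousCohomology 2
      (TopRep.of (ContRepresentation.trivial ℤ 𝒢 (ULift.{u} (QpModZp p))))))
    {M : Type*} [AddCommGroup M] [Module (ZMod p) M] [Finite M] [TopologicalSpace M]
    [DiscreteTopology M] (σ : Representation (ZMod p) Δ M)
    (horth : ModOrthogonal (torsionRep p (abAct act hact)) σ)
    {K K' : Subgroup H} {R : Subgroup (𝒢 × H)} (hR : IsGraphModulo act actH K R)
    (hK : IsOpen (K : Set H)) (hK'K : K' ≤ K) (κ : H → M)
    (hmul : ∀ a ∈ K, ∀ b ∈ K, κ (a * b) = κ a + κ b)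
    (hconj : ∀ x, ∀ a ∈ K, κ (x * a * x⁻¹) = κ a) (hcont : ContinuousOn κ K)
    (hκΔ : ∀ δ, ∀ a ∈ K, κ (actH δ a) = σ δ (κ a))
    (hker : ∀ a ∈ K, κ a = 0 ↔ a ∈ K') :
    ∃ R' ≤ R, IsGraphModulo act actH K' R' := by
  obtain ⟨s, hs, hsR⟩ := hR.exists_section hK
  have : CompactSpace R := isCompact_iff_compactSpace.1 hR.isClosed.isCompact
  have hmem : ∀ n : R, (n : 𝒢 × H).1 = 1 → (n : 𝒢 × H).2 ∈ K := fun n hn => by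
    rw [← hR.mem_iff, ← hn]
    exact n.2
  obtain ⟨R', hcl, hstab, hsurj, hR'⟩ := exists_lifting_step h𝒢 hΔ act hact hH2 σ horth (R := R)
    (prodActRestrict act actH R hR.act_mem)
    (fun δ => by
      have h1 := (hact δ).comp (continuous_fst.comp (continuous_subtype_val (p := (· ∈ R))))
      have h2 := (hactH δ).comp (continuous_snd.comp (continuous_subtype_val (p := (· ∈ R))))
      exact (h1.prodMk h2).subtype_mk _)
    ((MonoidHom.fst 𝒢 H).comp R.subtype) (continuous_fst.comp continuous_subtype_val)
    (fun δ r => rfl) (fun x => ⟨(x, s x), hsR x⟩)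
    ((continuous_id.prodMk hs).subtype_mk _) (fun x => rfl) (fun r => κ (r : 𝒢 × H).2)
    (fun a b ha hb => hmul _ (hmem a ha) _ (hmem b hb))
    (fun r n hn => hconj _ _ (hmem n hn))
    (hcont.comp (continuous_snd.comp continuous_subtype_val).continuousOn fun n hn => hmem n hn)
    (fun δ n hn => hκΔ δ _ (hmem n hn))
  refine ⟨R'.map R.subtype, Subgroup.map_subtype_le _, ?_, ?_, ?_, ?_⟩
  · rw [Subgroup.coe_map]
    exact hR.isClosed.isClosedEmbedding_subtypeVal.isClosedMap _ hcl
  · rintro δ _ ⟨r, hr, rfl⟩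
    exact ⟨_, hstab δ r hr, rfl⟩
  · intro x
    obtain ⟨r, hr, rfl⟩ := hsurj x
    exact ⟨_, r, hr, rfl⟩
  · intro h
    constructor
    · rintro ⟨n, hn, hnh⟩
      have hn1 : (n : 𝒢 × H).1 = 1 := congrArg Prod.fst hnh
      have hn2 : (n : 𝒢 × H).2 = h := congrArg Prod.snd hnh
      rw [← hn2, ← hker _ (hmem n hn1)]
      exact (hR' n hn1).1 hn
    · intro hh
      have h1 : ((1 : 𝒢), h) ∈ R := (hR.mem_iff h).2 (hK'K hh)
      exact ⟨⟨(1, h), h1⟩, (hR' ⟨(1, h), h1⟩ rfl).2 ((hker h (hK'K hh)).2 hh), rfl⟩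

end Tower

/-! ### Generation modulo the Frattini subgroup -/

section FrattiniGenerators
open scoped commutatorElement

variable {p : ℕ} {H : Type*} [Group H] [TopologicalSpace H] [IsTopologicalGroup H]

/-- `[H_2, H_n] ≤ H_{n+2}`: modulo `H_{n+2}`, the commutator with a fixed element of `H_n` is a
homomorphism from `H` to an elementary abelian central subgroup. -/
theorem commutator_mem_lowerP_add_two {n : ℕ} {x y : H} (hx : x ∈ lowerP p H 1)
    (hy : y ∈ lowerP p H n) : ⁅x, y⁆ ∈ lowerP p H (n + 2) := by
  have hcl : IsClosed {x : H | ⁅x, y⁆ ∈ lowerP p H (n + 2)} :=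
    (isClosed_lowerP (n + 2)).preimage (f := fun x : H => ⁅x, y⁆)
      (by simp only [commutatorElement_def]; fun_prop)
  let N := lowerP p H (n + 2)
  let mk := QuotientGroup.mk' N
  have hmem : ∀ {a}, a ∈ N ↔ mk a = 1 := (QuotientGroup.eq_one_iff _).symm
  have hc : ∀ (a : H) (q : H ⧸ N), Commute (mk ⁅a, y⁆) q := fun a q => by
    obtain ⟨b, rfl⟩ := QuotientGroup.mk_surjective q
    have h1 : ⁅b, ⁅a, y⁆⁆ ∈ N := commutator_mem_powComm b (commutator_mem_powComm a hy)
    rw [hmem, map_commutatorElement, commutatorElement_eq_one_iff_commute] at h1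
    exact h1.symm
  have hmul : ∀ a b : H, mk ⁅a * b, y⁆ = mk ⁅a, y⁆ * mk ⁅b, y⁆ := fun a b => by
    have h1 : ⁅a * b, y⁆ = a * ⁅b, y⁆ * a⁻¹ * ⁅a, y⁆ := by
      simp only [commutatorElement_def]; group
    rw [h1, map_mul, map_mul, map_mul, (hc b (mk a)).symm.eq, map_inv, mul_inv_cancel_right,
      (hc b _).eq]
  let φ : H →* H ⧸ N := MonoidHom.mk' (fun a => mk ⁅a, y⁆) hmul
  have hφp : ∀ a, φ a ^ p = 1 := fun a => by
    change mk ⁅a, y⁆ ^ p = 1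
    rw [← map_pow, ← hmem]
    exact pow_mem_lowerP_succ (commutator_mem_powComm a hy)
  have hle : lowerP p H 1 ≤ φ.ker := by
    refine powComm_le ?_ (fun a _ => ?_) (fun a b _ => ?_)
    · convert hcl using 1
      ext a
      exact hmem.symm
    · rw [MonoidHom.mem_ker, map_pow, hφp]
    · rw [MonoidHom.mem_ker, map_commutatorElement, commutatorElement_eq_one_iff_commute]
      exact hc a _
  exact hmem.2 (hle hx)

variable [CompactSpace H] [T2Space H]

/-- A closed subgroup `A` with `A Φ(H) = H` is all of `H`, if the `p`-central series of `H` has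
trivial intersection: inductively, `A ∩ H_n` maps onto `H_n / H_{n+1}`. -/
theorem eq_top_of_sup_frattiniP (hbot : ∀ x : H, (∀ n, x ∈ lowerP p H n) → x = 1)
    {A : Subgroup H} (hA : IsClosed (A : Set H)) (h : ∀ x, ∃ a ∈ A, a⁻¹ * x ∈ frattiniP p H) :
    A = ⊤ := by
  have hclosed : ∀ n,
      IsClosed (((A ⊓ lowerP p H n) ⊔ lowerP p H (n + 1) : Subgroup H) : Set H) := by
    intro n
    rw [Subgroup.mul_normal]
    exact ((hA.inter (isClosed_lowerP n)).isCompact.mul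
      (isClosed_lowerP (n + 1)).isCompact).isClosed
  have hmemsup : ∀ n x, x ∈ (A ⊓ lowerP p H n) ⊔ lowerP p H (n + 1) ↔
      ∃ a ∈ A, a ∈ lowerP p H n ∧ a⁻¹ * x ∈ lowerP p H (n + 1) := by
    intro n x
    rw [Subgroup.mem_sup_of_normal_right]
    constructor
    · rintro ⟨a, ⟨ha, ha'⟩, b, hb, rfl⟩
      exact ⟨a, ha, ha', by simpa using hb⟩
    · rintro ⟨a, ha, ha', hb⟩
      exact ⟨a, ⟨ha, ha'⟩, _, hb, by simp⟩
  have hstep : ∀ n, lowerP p H n ≤ (A ⊓ lowerP p H n) ⊔ lowerP p H (n + 1) := by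
    intro n
    induction n with
    | zero =>
      intro x _
      obtain ⟨a, ha, hax⟩ := h x
      exact (hmemsup 0 x).2 ⟨a, ha, Subgroup.mem_top a, hax⟩
    | succ n ih =>
      let N := lowerP p H (n + 2)
      let mk := QuotientGroup.mk' N
      have hmem : ∀ {a}, a ∈ N ↔ mk a = 1 := (QuotientGroup.eq_one_iff _).symm
      have hcen : ∀ {a}, a ∈ lowerP p H (n + 1) → ∀ b, Commute (mk b) (mk a) := fun {a} ha b => by
        rw [← commutatorElement_eq_one_iff_commute, ← map_commutatorElement, ← hmem]
        exact commutator_mem_powComm b ha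
      have hmk : ∀ {a x : H}, mk a = mk x → a⁻¹ * x ∈ N := fun h => QuotientGroup.eq.1 h
      refine powComm_le (hclosed (n + 1)) (fun x hx => ?_) (fun x y hy => ?_)
      · obtain ⟨a, ha, han, hax⟩ := (hmemsup n x).1 (ih hx)
        refine (hmemsup (n + 1) _).2 ⟨a ^ p, pow_mem ha p, pow_mem_lowerP_succ han, hmk ?_⟩
        obtain ⟨b, rfl⟩ : ∃ b, x = a * b := ⟨a⁻¹ * x, by simp⟩
        rw [inv_mul_cancel_left] at hax
        have hb : mk (b ^ p) = 1 := hmem.1 (pow_mem_lowerP_succ hax)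
        rw [map_pow, map_pow, map_mul, (hcen hax a).mul_pow, ← map_pow mk b, hb, mul_one]
      · obtain ⟨c, hc, hcx⟩ := h x
        obtain ⟨a, ha, han, hay⟩ := (hmemsup n y).1 (ih hy)
        refine (hmemsup (n + 1) _).2 ⟨⁅c, a⁆, ?_, commutator_mem_powComm c han, hmk ?_⟩
        · rw [commutatorElement_def]
          exact mul_mem (mul_mem (mul_mem hc ha) (inv_mem hc)) (inv_mem ha)
        obtain ⟨b, rfl⟩ : ∃ b, y = a * b := ⟨a⁻¹ * y, by simp⟩
        obtain ⟨d, rfl⟩ : ∃ d, x = c * d := ⟨c⁻¹ * x, by simp⟩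
        rw [inv_mul_cancel_left] at hay hcx
        have h1 : mk ⁅d, a * b⁆ = 1 := hmem.1 (commutator_mem_lowerP_add_two hcx hy)
        have h2 : mk ⁅c, b⁆ = 1 := hmem.1 (commutator_mem_powComm c hay)
        have e1 : ⁅c * d, a * b⁆ = c * ⁅d, a * b⁆ * c⁻¹ * (⁅c, a⁆ * (a * ⁅c, b⁆ * a⁻¹)) := by
          simp only [commutatorElement_def]; group
        rw [e1]
        simp [h1, h2, map_mul, -map_commutatorElement]
  have hall : ∀ n x, ∃ a ∈ A, a⁻¹ * x ∈ lowerP p H n := by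
    intro n
    induction n with
    | zero => exact fun x => ⟨1, one_mem _, Subgroup.mem_top _⟩
    | succ n ih =>
      intro x
      obtain ⟨a, ha, hax⟩ := ih x
      obtain ⟨b, hb, -, hbx⟩ := (hmemsup n _).1 (hstep n hax)
      exact ⟨a * b, mul_mem ha hb, by simpa [mul_assoc] using hbx⟩
  refine eq_top_iff.2 fun x _ => ?_
  have hcl : ∀ n, IsClosed {a : H | a ∈ A ∧ a⁻¹ * x ∈ lowerP p H n} := fun n =>
    hA.inter ((isClosed_lowerP n).preimage (by fun_prop : Continuous fun a : H => a⁻¹ * x))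
  obtain ⟨a, ha⟩ := IsCompact.nonempty_iInter_of_sequence_nonempty_isCompact_isClosed
    (fun n => {a : H | a ∈ A ∧ a⁻¹ * x ∈ lowerP p H n})
    (fun n a ha => ⟨ha.1, lowerP_succ_le n ha.2⟩) (fun n => hall n x) (hcl 0).isCompact hcl
  rw [Set.mem_iInter] at ha
  have := hbot _ fun n => (ha n).2
  rw [inv_mul_eq_one] at this
  exact this ▸ (ha 0).1

end FrattiniGenerators

/-! ### Lifting through the filtration -/

section Lift

/-- A continuous homomorphism from a pro-`p` group to a finite group of order prime to `p` is
trivial. -/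
theorem IsProP.hom_eq_one {p : ℕ} {𝒢 : Type*} [Group 𝒢] [TopologicalSpace 𝒢]
    [IsTopologicalGroup 𝒢] (h𝒢 : IsProP p 𝒢) {D : Type*} [Group D] [TopologicalSpace D] [T1Space D]
    [Finite D] (hD : (Nat.card D).Coprime p) (φ : 𝒢 →* D) (hφ : Continuous φ) (x : 𝒢) :
    φ x = 1 := by
  have hopen : IsOpen (φ.ker : Set 𝒢) := by
    have : (φ.ker : Set 𝒢) = φ ⁻¹' {1} := rfl
    rw [this]
    exact (isOpen_discrete _).preimage hφ
  obtain ⟨n, hn⟩ := h𝒢.index_eq φ.ker inferInstance hopen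
  have h1 : p ^ n ∣ Nat.card D := by
    rw [← hn, Subgroup.index_ker]
    exact Subgroup.card_subgroup_dvd_card _
  have h2 : p ^ n = 1 := Nat.Coprime.eq_one_of_dvd (hD.symm.pow_left n) h1
  rw [← MonoidHom.mem_ker, Subgroup.index_eq_one.1 (hn.trans h2)]
  exact Subgroup.mem_top x

variable {p : ℕ} [Fact p.Prime]

/-- The lifting through the whole filtration `G' ∩ G_{k+1+j}` of `G'`: its steps are embedding
problems with kernel in `G_{n+1} / G_{n+2} ≃ 𝔤 / p 𝔤`, which is orthogonal to `𝒯[p]`. -/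
theorem exists_lift_of_graph (hp : p ≠ 2)
    {𝒢 : Type u} [Group 𝒢] [TopologicalSpace 𝒢] [IsTopologicalGroup 𝒢]
    (h𝒢 : IsProP p 𝒢) (h𝒢fg : IsTopFG 𝒢)
    {Δ : Type*} [Group Δ] [Finite Δ] (hΔ : (Nat.card Δ).Coprime p)
    (act : Δ →* MulAut 𝒢) (hact : ∀ δ, Continuous (act δ))
    {m : ℕ} (ρ₀ : Δ →* GL (Fin m) ℤ_[p])
    (G : Subgroup (GL (Fin m) ℤ_[p])) (hG1 : G ≤ glOne p m) (hG : IsUniform p G)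
    (hΔG : ρ₀.range ≤ Subgroup.normalizer (G : Set (GL (Fin m) ℤ_[p])))
    (k : ℕ) (G' : Subgroup (GL (Fin m) ℤ_[p])) (hG'G : G' ≤ G)
    (hG'cl : IsClosed (G' : Set (GL (Fin m) ℤ_[p])))
    (hΔG' : ρ₀.range ≤ Subgroup.normalizer (G' : Set (GL (Fin m) ℤ_[p])))
    (hH2 : Subsingleton (continuousCohomology 2
      (TopRep.of (ContRepresentation.trivial ℤ 𝒢 (ULift.{u} (QpModZp p))))))
    (horth : ModOrthogonal (torsionRep p (abAct act hact)) (modRep p (lieAct ρ₀ G hΔG)))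
    (R : Subgroup (𝒢 × G'))
    (hR : IsGraphModulo act ((conjAct G' ρ₀.range hΔG').comp ρ₀.rangeRestrict)
      ((lowerP p G k).comap (Subgroup.inclusion hG'G)) R) :
    ∃ ψ : 𝒢 →* G', Continuous ψ ∧ (∀ x, (x, ψ x) ∈ R) ∧
      ∀ δ x, ψ (act δ x) = conjAct G' ρ₀.range hΔG' (ρ₀.rangeRestrict δ) (ψ x) := by
  have := h𝒢.compact
  have := h𝒢.totallyDisconnected
  have := hG.isProP.compact
  have hGcl : IsClosed (G : Set (GL (Fin m) ℤ_[p])) :=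
    (isCompact_iff_compactSpace.2 hG.isProP.compact).isClosed
  have : CompactSpace G' := isCompact_iff_compactSpace.1
    ((isCompact_iff_compactSpace.2 hG.isProP.compact).of_isClosed_subset hG'cl hG'G)
  let actH := (conjAct G' ρ₀.range hΔG').comp ρ₀.rangeRestrict
  let ι := Subgroup.inclusion hG'G
  have hι : Continuous ι := continuous_subtype_val.subtype_mk _
  let K : ℕ → Subgroup G' := fun j => (lowerP p G (k + j)).comap ι
  let _ : TopologicalSpace (ModN (lieAlg G) p) := ⊥
  have : DiscreteTopology (ModN (lieAlg G) p) := ⟨rfl⟩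
  have := finite_modN_lieAlg hp hG1 hG
  have hstep : ∀ j (S : Subgroup (𝒢 × G')), IsGraphModulo act actH (K j) S →
      ∃ S' ≤ S, IsGraphModulo act actH (K (j + 1)) S' := by
    intro j S hS
    refine hS.exists_le h𝒢fg hΔ hact (fun δ => conjAct_continuous G' ρ₀.range hΔG' _) hH2
      (modRep p (lieAct ρ₀ G hΔG)) horth ((hG.isOpen_lowerP (k + j)).preimage hι)
      (fun x hx => lowerP_succ_le (k + j) hx) (fun x => levelClass (k + j) (ι x))
      (fun a ha b hb => ?_) (fun x a ha => ?_) ?_ (fun δ a ha => ?_) (fun a ha => ?_)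
    · rw [map_mul]
      exact levelClass_mul hp hG1 hG ha hb
    · rw [map_mul, map_mul, map_inv]
      exact levelClass_conj hp hG1 hG ha _
    · exact (continuousOn_levelClass hp hG1 hG (k + j)).comp hι.continuousOn fun x hx => hx
    · exact levelClass_act hp hG1 hG ρ₀ hΔG ha δ rfl
    · exact levelClass_eq_zero_iff hp hG1 hG ha
  choose S hSle hS using hstep
  let T : ∀ j, {S : Subgroup (𝒢 × G') // IsGraphModulo act actH (K j) S} := fun j =>
    Nat.rec ⟨R, hR⟩ (fun j T => ⟨S j T.1 T.2, hS j T.1 T.2⟩) j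
  obtain ⟨ψ, hψ, hψR, hψΔ⟩ := exists_hom_of_isGraphModulo (K := K)
    (fun h hh => by
      refine Subgroup.inclusion_injective hG'G ?_
      rw [map_one]
      exact eq_one_of_forall_mem_lowerP hp hG1 _ fun n =>
        lowerP_antitone (Nat.le_add_left n k) (hh n))
    (fun j => (T j).1) (fun j => hSle j (T j).1 (T j).2) (fun j => (T j).2)
  exact ⟨ψ, hψ, fun x => hψR x 0, hψΔ⟩

end Lift

theorem mainTheorem4 {p : ℕ} [Fact p.Prime] (hp : p ≠ 2)
    -- a finitely generated pro-`p` group with an action of a finite group of order prime to `p`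
    {𝒢 : Type u} [Group 𝒢] [TopologicalSpace 𝒢] [IsTopologicalGroup 𝒢]
    (h𝒢 : IsProP p 𝒢) (h𝒢fg : IsTopFG 𝒢)
    {Δ : Type*} [Group Δ] [Finite Δ] [TopologicalSpace Δ] [DiscreteTopology Δ]
    (hΔ : (Nat.card Δ).Coprime p)
    (act : Δ →* MulAut 𝒢) (hact : ∀ δ, Continuous (act δ))
    {m : ℕ} (ρ₀ : Δ →* GL (Fin m) ℤ_[p])
    -- the uniform group `G`, normalized by `Δ' = ρ₀(Δ)`
    (G : Subgroup (GL (Fin m) ℤ_[p])) (hG1 : G ≤ glOne p m) (hG : IsUniform p G)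
    (hΔG : ρ₀.range ≤ Subgroup.normalizer (G : Set (GL (Fin m) ℤ_[p])))
    -- `g₁, …, g_s ∈ G` with `z_i = log g_i ∈ p ^ k 𝔤` free modulo `p ^ (k + 1) 𝔤`
    (k s : ℕ) (g : Fin s → GL (Fin m) ℤ_[p]) (hgG : ∀ i, g i ∈ G)
    (hz : ∀ i, matLog (g i) ∈ ((p : ℤ_[p]) ^ k) • lieAlg G)
    (hfree : LinearIndependent (ZMod p) fun i =>
      ModN.mkQ (G := ↥(((p : ℤ_[p]) ^ k) • lieAlg G)) p ⟨matLog (g i), hz i⟩)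
    -- the closed subgroup `G'` generated by the `g_i`, normalized by `Δ'`
    (G' : Subgroup (GL (Fin m) ℤ_[p])) (hG' : G' = closedSubgroupGen (Set.range g))
    (hΔG' : ρ₀.range ≤ Subgroup.normalizer (G' : Set (GL (Fin m) ℤ_[p])))
    -- `H²(𝒢, ℚ_p/ℤ_p) = 0` (coefficients lifted to the universe of `𝒢`) and `𝒯[p] ⟂ 𝔤_p`
    (hH2 : Subsingleton (continuousCohomology 2
      (TopRep.of (ContRepresentation.trivial ℤ 𝒢 (ULift.{u} (QpModZp p))))))
    (horth : ModOrthogonal (torsionRep p (abAct act hact)) (modRep p (lieAct ρ₀ G hΔG)))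
    -- the map to be lifted
    (f : 𝒢 ⋊[act] Δ →* (G' ⧸ frattiniP p G') ⋊[conjActFrattini p G' ρ₀.range hΔG'] ρ₀.range)
    (hf : Continuous f) (hfsurj : Function.Surjective f)
    (hfΔ : ∀ δ, f (SemidirectProduct.inr δ) = SemidirectProduct.inr (ρ₀.rangeRestrict δ)) :
    ∃ ψ : 𝒢 ⋊[act] Δ →* G' ⋊[conjAct G' ρ₀.range hΔG'] ρ₀.range,
      Continuous ψ ∧ Function.Surjective ψ ∧
      (toFrattiniSemidirect p G' ρ₀.range hΔG').comp ψ = f ∧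
      ∀ δ, ψ (SemidirectProduct.inr δ) = SemidirectProduct.inr (ρ₀.rangeRestrict δ) := by
  have hGcl : IsClosed (G : Set (GL (Fin m) ℤ_[p])) :=
    (isCompact_iff_compactSpace.2 hG.isProP.compact).isClosed
  have hG'cl : IsClosed (G' : Set (GL (Fin m) ℤ_[p])) := by
    rw [hG']
    exact Subgroup.isClosed_topologicalClosure _
  have hG'G : G' ≤ G := by
    rw [hG']
    refine Subgroup.topologicalClosure_minimal _ ((Subgroup.closure_le _).2 ?_) hGcl
    rintro _ ⟨i, rfl⟩
    exact hgG i
  have : CompactSpace G' := isCompact_iff_compactSpace.1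
    ((isCompact_iff_compactSpace.2 hG.isProP.compact).of_isClosed_subset hG'cl hG'G)
  have hgG' : ∀ i, g i ∈ G' := fun i => by
    rw [hG']
    exact Subgroup.le_topologicalClosure _ (Subgroup.subset_closure ⟨i, rfl⟩)
  -- `G' ≤ G_{k+1}` and `Φ(G') = G' ∩ G_{k+2}`
  have hk : ∀ x : G', Subgroup.inclusion hG'G x ∈ lowerP p G k := by
    refine inclusion_mem_lowerP_of_generators hG'G hG' hGcl ?_
    rintro _ ⟨i, rfl⟩
    refine ⟨hgG i, ?_⟩
    obtain ⟨y, hy, -⟩ := exists_pow_prime_pow_eq_of_matLog_mem hp hG1 hG (x := ⟨g i, hgG i⟩) (hz i)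
    rw [← hy]
    exact pow_prime_pow_mem_lowerP y k
  have hΦ := mem_frattiniP_iff hp hG1 hG hG'G (fun i => ⟨g i, hgG' i⟩) hG' hk
    (linearIndependent_levelClass hp hG1 hG (fun i => ⟨g i, hgG i⟩) hz hfree)
  -- `𝒢` is pro-`p` and `Δ'` has order prime to `p`, so that `f` maps `𝒢` to `G' / Φ(G')`
  have : Finite ρ₀.range := Finite.of_surjective _ ρ₀.rangeRestrict_surjective
  have hright : ∀ x, (f (SemidirectProduct.inl x)).right = 1 := by
    refine h𝒢.hom_eq_one (D := ρ₀.range) (hΔ.coprime_dvd_left ?_)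
      (SemidirectProduct.rightHom.comp (f.comp SemidirectProduct.inl)) ?_
    · exact Subgroup.card_range_dvd ρ₀
    · exact (continuous_snd.comp continuous_induced_dom).comp (hf.comp
        (continuous_induced_rng.2 (by
          change Continuous fun x : 𝒢 => (x, (1 : Δ))
          fun_prop)))
  let f₀ : 𝒢 →* G' ⧸ frattiniP p G' := MonoidHom.mk' (fun x => (f (SemidirectProduct.inl x)).left)
    fun x y => by
      rw [map_mul, map_mul, SemidirectProduct.mul_left, hright, map_one]
      rfl
  have hf₀ : ∀ x, f (SemidirectProduct.inl x) = SemidirectProduct.inl (f₀ x) := fun x =>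
    SemidirectProduct.ext rfl (hright x)
  have hf₀c : Continuous f₀ := (continuous_fst.comp continuous_induced_dom).comp (hf.comp
        (continuous_induced_rng.2 (by
          change Continuous fun x : 𝒢 => (x, (1 : Δ))
          fun_prop)))
  have hf₀Δ : ∀ δ x, f₀ (act δ x) =
      conjActFrattini p G' ρ₀.range hΔG' (ρ₀.rangeRestrict δ) (f₀ x) := fun δ x => by
    apply SemidirectProduct.inl_injective
      (φ := conjActFrattini p G' ρ₀.range hΔG')
    rw [← hf₀, SemidirectProduct.inl_aut, SemidirectProduct.inl_aut, map_mul, map_mul, hf₀, hfΔ,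
      map_inv, map_inv, hfΔ, map_inv]
  -- `f` is the product of `f₀` and `ρ₀`, so its surjectivity gives that of `f₀`
  have hf₀s : Function.Surjective f₀ := fun q => by
    obtain ⟨y, hy⟩ := hfsurj (SemidirectProduct.inl q)
    refine ⟨y.left, ?_⟩
    rw [← SemidirectProduct.inl_left_mul_inr_right y, map_mul, hf₀, hfΔ] at hy
    simpa using congrArg SemidirectProduct.left hy
  have hΦcl : IsClosed (frattiniP p G' : Set G') := isClosed_powComm _
  -- the graph of `f₀` modulo `Φ(G')`
  let R : Subgroup (𝒢 × G') := (f₀.comp (MonoidHom.fst 𝒢 G')).eqLocus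
    ((QuotientGroup.mk' (frattiniP p G')).comp (MonoidHom.snd 𝒢 G'))
  have hR : IsGraphModulo act ((conjAct G' ρ₀.range hΔG').comp ρ₀.rangeRestrict)
      ((lowerP p G (k + 1)).comap (Subgroup.inclusion hG'G)) R :=
    { isClosed := isClosed_eq (hf₀c.comp continuous_fst)
        (QuotientGroup.continuous_mk.comp continuous_snd)
      act_mem := fun δ r hr => by
        have hr' : f₀ r.1 = QuotientGroup.mk r.2 := hr
        change f₀ (act δ r.1) = QuotientGroup.mk _
        rw [hf₀Δ, hr']
        rfl
      exists_mem := fun x => by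
        obtain ⟨h, hh⟩ := QuotientGroup.mk_surjective (f₀ x)
        exact ⟨h, hh.symm⟩
      mem_iff := fun h => by
        rw [Subgroup.mem_comap, ← hΦ, ← QuotientGroup.eq_one_iff (N := frattiniP p G') h]
        change f₀ 1 = _ ↔ _
        rw [map_one]
        exact eq_comm }
  obtain ⟨ψ₀, hψ₀, hψ₀R, hψ₀Δ⟩ := exists_lift_of_graph hp h𝒢 h𝒢fg hΔ act hact ρ₀ G hG1 hG
    hΔG (k + 1) G' hG'G hG'cl hΔG' hH2 horth R hR
  have hψ₀f : ∀ x, (QuotientGroup.mk (ψ₀ x) : G' ⧸ frattiniP p G') = f₀ x := fun x => (hψ₀R x).symm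
  have hψ₀s : Function.Surjective ψ₀ := by
    rw [← MonoidHom.range_eq_top]
    have := h𝒢.compact
    refine eq_top_of_sup_frattiniP (p := p)
      (eq_one_of_forall_mem_lowerP hp (hG'G.trans hG1)) (isCompact_range hψ₀).isClosed fun h => ?_
    obtain ⟨x, hx⟩ := hf₀s (QuotientGroup.mk h)
    exact ⟨ψ₀ x, ⟨x, rfl⟩, QuotientGroup.eq.1 ((hψ₀f x).trans hx)⟩
  refine ⟨SemidirectProduct.map ψ₀ ρ₀.rangeRestrict fun δ => MonoidHom.ext fun x => hψ₀Δ δ x,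
    ?_, ?_, ?_, fun δ => SemidirectProduct.map_inr _ _ _ δ⟩
  · refine continuous_induced_rng.2 ?_
    have h0 : Continuous fun y : 𝒢 ⋊[act] Δ => SemidirectProduct.equivProd y :=
      continuous_induced_dom
    have h1 : Continuous fun y : 𝒢 ⋊[act] Δ => ψ₀ y.left :=
      hψ₀.comp (continuous_fst.comp h0)
    have h2 : Continuous fun y : 𝒢 ⋊[act] Δ => ρ₀.rangeRestrict y.right :=
      (continuous_of_discreteTopology (f := ρ₀.rangeRestrict)).comp
        (continuous_snd.comp h0)
    exact h1.prodMk h2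
  · rintro ⟨h, d⟩
    obtain ⟨x, rfl⟩ := hψ₀s h
    obtain ⟨δ, rfl⟩ := ρ₀.rangeRestrict_surjective d
    exact ⟨⟨x, δ⟩, rfl⟩
  · refine SemidirectProduct.hom_ext (MonoidHom.ext fun x => ?_) (MonoidHom.ext fun δ => ?_)
    · change toFrattiniSemidirect p G' ρ₀.range hΔG' (SemidirectProduct.map ψ₀ _ _ _) = f _
      rw [SemidirectProduct.map_inl, hf₀, ← hψ₀f]
      exact SemidirectProduct.map_inl _ _ _ _
    · change toFrattiniSemidirect p G' ρ₀.range hΔG' (SemidirectProduct.map ψ₀ _ _ _) = f _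
      rw [SemidirectProduct.map_inr, hfΔ]
      exact SemidirectProduct.map_inr _ _ _ _
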